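/- Let $m\in\mathbb N$, $p\in[1,+\infty)$ with $2p<m$, and $r>0$; write $\mathbb B^m_r\subset\mathbb R^m$ for the open Euclidean ball of radius $r$ centred at $0$. Let $N$ be a Hausdorff, second countable $n$-dimensional $C^2$ manifold without boundary, with a $C^1$ Riemannian metric $g_N$, its Levi-Civita connection and its Riemannian distance $d_N$. **Definitions.** A Lebesgue measurable map $u:\mathbb B^m_r\to Y$ into a manifold $Y$ is *colocally weakly differentiable* if $f\circ u$ has a locally integrable weak derivative for every $f\in C^1_c(Y,\mathbb R)$. For $Y=N$, its *colocal weak derivative* is the measurable bundle morphism $Tu$ covering $u$, $Tu(x)\in\mathcal L(\mathbb R^m,T_{u(x)}N)$, such that $T(f\circ u)=Tf\circ Tu$ a.e. for every $f\in C^1_c(N,\mathbb R)$. The map $u$ is *twice colocally weakly differentiable* if moreover $Tu:\mathbb B^m_r\to T^*\mathbb B^m_r\otimes TN$ is colocally weakly differentiable; its *colocal weak covariant derivative* is the measurable family of bilinear maps $D_K(Tu)(x):\mathbb R^m\times\mathbb R^m\to T_{u(x)}N$ such that, for every $f\in C^1_c(T^*\mathbb B^m_r\otimes TN,\mathbb R)$,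 a.e. $$T(f\circ Tu)=(Tf)(Tu)\bigl[\operatorname{Vert}\circ D_K(Tu)+\operatorname{Hor}_K\circ Tu\bigr],$$ where $\operatorname{Vert}$ is the vertical lift and $\operatorname{Hor}_K$ the horizontal lift of the connection induced on $T^*\mathbb B^m_r\otimes TN$ by the flat connection of $\mathbb B^m_r$ and the Levi-Civita connection of $N$. Norms $|\cdot|$ of linear and bilinear maps are the Euclidean (Hilbert–Schmidt) ones induced by $g_N$ and the Euclidean metric. The space $\dot W^{2,p}(\mathbb B^m_r,N)$ is the set of twice colocally weakly differentiable $u$ with $\int_{\mathbb B^m_r}|D_K(Tu)|^p<\infty$, and $L^\infty(\mathbb B^m_r,N)$ is the set of measurable $u$ with $\operatorname{osc}(u)=\operatorname{ess\,sup}\{d_N(u(x),u(y)):x,y\in\mathbb B^m_r\}<\infty$. For an isometric embedding $\iota\in C^2(N,\mathbb R^\nu)$, $\dot W^{2,p}_\iota(\mathbb B^m_r,N)$ is the set of measurable $u:\mathbb B^m_r\to N$ with $\iota\circ u\in W^{2,1}_{\mathrm{loc}}(\mathbb B^m_r,\mathbb R^\nu)$ and $|D^2(\iota\circ u)|\in L^p(\mathbb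 B^m_r)$. **Proposition.** Suppose that $N$ has a nontrivial bounded geodesic, that is, a nonconstant $C^2$ curve $\gamma:\mathbb R\to N$ with $\nabla_{\gamma'}\gamma'=0$ and $\sup_{s,t\in\mathbb R}d_N(\gamma(s),\gamma(t))<\infty$. Then: 1. there exists $\alpha>0$ such that the map $u(x)=\gamma(|x|^{-\alpha})$ belongs to $\dot W^{2,p}(\mathbb B^m_r,N)\cap L^\infty(\mathbb B^m_r,N)$ and $\int_{\mathbb B^m_r}|Tu|^{2p}=+\infty$; 2. for every $\nu\in\mathbb N$ and every isometric embedding $\iota\in C^2(N,\mathbb R^\nu)$, $\dot W^{2,p}_\iota(\mathbb B^m_r,N)\subsetneq\dot W^{2,p}(\mathbb B^m_r,N)$; 3. the Gagliardo–Nirenberg inequality fails: there is no constant $C\ge 0$ such that for every $u\in\dot W^{2,p}(\mathbb B^m_r,N)\cap L^\infty(\mathbb B^m_r,N)$ $$\int_{\mathbb B^m_r}|Tu|^{2p}\le C\,\operatorname{osc}(u)^p\int_{\mathbb B^m_r}|D_K(Tu)|^p .$$ -/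

import Mathlib

open MeasureTheory Set Manifold
open scoped ENNReal NNReal ContDiff

noncomputable section

/-! ### Weak derivatives on a Euclidean domain -/

/-- Euclidean space `ℝᵐ`. -/
abbrev Euc (m : ℕ) : Type := EuclideanSpace ℝ (Fin m)

/-- `g` is the weak derivative of `f` on the open set `Ω`: both are locally integrable on `Ω`, and
integration by parts holds against all test functions in `C_c^∞(Ω)`. -/
structure HasWeakDerivOn {m : ℕ} {V : Type*} [NormedAddCommGroup V] [NormedSpace ℝ V]
    (Ω : Set (Euc m)) (f : Euc m → V) (g : Euc m → (Euc m →L[ℝ] V)) : Prop where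
  locallyIntegrable : LocallyIntegrableOn f Ω volume
  locallyIntegrable_deriv : LocallyIntegrableOn g Ω volume
  integral_eq : ∀ φ : Euc m → ℝ, ContDiff ℝ ∞ φ → HasCompactSupport φ → tsupport φ ⊆ Ω →
    ∀ e : Euc m, ∫ x, fderiv ℝ φ x e • f x = - ∫ x, φ x • g x e

/-- Lebesgue measurability on `Ω` of a map with values in a topological space. -/
def LebesgueMeasurableOn {m : ℕ} {Y : Type*} [TopologicalSpace Y] (Ω : Set (Euc m))
    (u : Euc m → Y) : Prop :=
  ∀ O : Set Y, IsOpen O → NullMeasurableSet (Ω ∩ u ⁻¹' O) volume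

/-- Colocal weak differentiability on `Ω` of a map with values in the open subset `W` of a
manifold `Y`: it is measurable and, for every `f ∈ C¹_c(W, ℝ)` (extended by zero to `Y`), the
function `f ∘ u` is weakly differentiable on `Ω`. -/
structure ColocallyWeaklyDifferentiableOn {m : ℕ} {EY : Type*} [NormedAddCommGroup EY]
    [NormedSpace ℝ EY] {HY : Type*} [TopologicalSpace HY] (J : ModelWithCorners ℝ EY HY)
    {Y : Type*} [TopologicalSpace Y] [ChartedSpace HY Y]
    (Ω : Set (Euc m)) (W : Set Y) (u : Euc m → Y) : Prop where
  measurable : LebesgueMeasurableOn Ω u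
  mapsTo : MapsTo u Ω W
  comp : ∀ f : Y → ℝ, ContMDiff J 𝓘(ℝ, ℝ) 1 f → HasCompactSupport f → tsupport f ⊆ W →
    ∃ g, HasWeakDerivOn Ω (f ∘ u) g

/-- The Euclidean (Hilbert–Schmidt) norm of a linear map `ℝᵐ → V`. -/
def hsNorm {m : ℕ} {V : Type*} [NormedAddCommGroup V] (ξ : Euc m → V) : ℝ :=
  Real.sqrt (∑ i, ‖ξ (EuclideanSpace.single i 1)‖ ^ 2)

/-- The Euclidean (Hilbert–Schmidt) norm of a bilinear map `ℝᵐ × ℝᵐ → V`. -/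
def hsNorm₂ {m : ℕ} {V : Type*} [NormedAddCommGroup V] (B : Euc m → Euc m → V) : ℝ :=
  Real.sqrt (∑ i, ∑ j, ‖B (EuclideanSpace.single i 1) (EuclideanSpace.single j 1)‖ ^ 2)

/-! ### The bundles of linear and bilinear maps from `ℝᵐ` to the tangent spaces of `N` -/

/-- The Christoffel symbols of the first kind at `z` of a metric tensor `g` on (a part of) `ℝⁿ`:
`½ (∂_v g(w, k) + ∂_w g(v, k) - ∂_k g(v, w))` for constant vectors `v, w, k`. -/
def christoffelFirst {n : ℕ} (g : Euc n → (Euc n →L[ℝ] Euc n →L[ℝ] ℝ)) (z v w k : Euc n) : ℝ :=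
  (fderiv ℝ g z v w k + fderiv ℝ g z w v k - fderiv ℝ g z k v w) / 2

section ChristoffelFirst

variable {n : ℕ} (g : Euc n → (Euc n →L[ℝ] Euc n →L[ℝ] ℝ)) (z : Euc n)

lemma christoffelFirst_add_left (v v' w k : Euc n) :
    christoffelFirst g z (v + v') w k = christoffelFirst g z v w k + christoffelFirst g z v' w k := by
  simp only [christoffelFirst, map_add, add_apply]
  ring

lemma christoffelFirst_smul_left (c : ℝ) (v w k : Euc n) :
    christoffelFirst g z (c • v) w k = c * christoffelFirst g z v w k := by
  simp only [christoffelFirst, map_smul, smul_apply, smul_eq_mul]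
  ring

lemma christoffelFirst_add_right (v w w' k : Euc n) :
    christoffelFirst g z v (w + w') k = christoffelFirst g z v w k + christoffelFirst g z v w' k := by
  simp only [christoffelFirst, map_add, add_apply]
  ring

lemma christoffelFirst_smul_right (c : ℝ) (v w k : Euc n) :
    christoffelFirst g z v (c • w) k = c * christoffelFirst g z v w k := by
  simp only [christoffelFirst, map_smul, smul_apply, smul_eq_mul]
  ring

end ChristoffelFirst

open Bundle

section Bundles

variable (m n : ℕ) (N : Type*) [TopologicalSpace N] [ChartedSpace (Euc n) N]
  [IsManifold (𝓡 n) 1 N]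

/-- The bundle over `N` whose fibre over `y` is `L(ℝᵐ, T_y N)`. For an open set `Ω ⊆ ℝᵐ`, the
bundle `T*Ω ⊗ TN` over `Ω × N` is `Ω × HomTangent m n N`. -/
abbrev HomTangent : Type _ :=
  TotalSpace (Euc m →L[ℝ] Euc n)
    (fun y : N => Bundle.Trivial N (Euc m) y →L[ℝ] TangentSpace (𝓡 n) y)

/-- The bundle over `N` whose fibre over `y` is the space of bilinear maps `ℝᵐ × ℝᵐ → T_y N`. For
an open set `Ω ⊆ ℝᵐ`, the bundle `T*Ω ⊗ T*Ω ⊗ TN` is `Ω × BilinTangent m n N`. -/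
abbrev BilinTangent : Type _ :=
  TotalSpace (Euc m →L[ℝ] Euc m →L[ℝ] Euc n)
    (fun y : N => Bundle.Trivial N (Euc m) y →L[ℝ]
      (Bundle.Trivial N (Euc m) y →L[ℝ] TangentSpace (𝓡 n) y))

/-- The model with corners of the manifold `ℝᵐ × HomTangent m n N`, which contains `T*Ω ⊗ TN` as
the open subset `Ω × HomTangent m n N`. -/
abbrev homModel :=
  (𝓡 m).prod ((𝓡 n).prod 𝓘(ℝ, Euc m →L[ℝ] Euc n))

end Bundles

/-! ### The Levi-Civita connection and geodesics -/

section Riemannian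

variable {m n : ℕ} {N : Type*} [TopologicalSpace N] [ChartedSpace (Euc n) N]
  [IsManifold (𝓡 n) 1 N] [RiemannianBundle (fun y : N => TangentSpace (𝓡 n) y)]

instance finiteDimensional_tangentSpace {n : ℕ} {N : Type*} [TopologicalSpace N]
    [ChartedSpace (Euc n) N] (y : N) : FiniteDimensional ℝ (TangentSpace (𝓡 n) y) :=
  inferInstanceAs (FiniteDimensional ℝ (Euc n))

/-- The metric tensor of `N` at the coordinate `z` of the preferred chart around `y`:
`(v, w) ↦ ∑ g_{ij}(z) vⁱ wʲ`. -/
def metricInChart (y : N) (z : Euc n) : Euc n →L[ℝ] Euc n →L[ℝ] ℝ :=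
  (innerSL ℝ).bilinearComp
    (mfderiv (𝓡 n) (𝓡 n) (extChartAt (𝓡 n) y).symm z)
    (mfderiv (𝓡 n) (𝓡 n) (extChartAt (𝓡 n) y).symm z)

/-- The Christoffel symbols `Γ_y(v, w)` of the Levi-Civita connection at `y`, in the preferred chart
around `y`: the vector with `g_y(Γ_y(v, w), k) = christoffelFirst g z v w k` for all `k`,
where `g` is the metric tensor in the chart and `z` is the coordinate of `y`. Mathlib
identifies `T_y N` with `ℝⁿ` through this very chart, so `v`, `w` and `Γ_y(v, w)` are
elements of `T_y N`. -/
def christoffel (y : N) : TangentSpace (𝓡 n) y →L[ℝ] TangentSpace (𝓡 n) y →L[ℝ]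
    TangentSpace (𝓡 n) y :=
  let b := stdOrthonormalBasis ℝ (TangentSpace (𝓡 n) y)
  LinearMap.toContinuousBilinearMap <|
    LinearMap.mk₂ ℝ (fun v w => ∑ i, christoffelFirst (metricInChart y) (extChartAt (𝓡 n) y y) v w (b i) • b i)
      (fun v v' w => by
        rw [← Finset.sum_add_distrib]
        exact Finset.sum_congr rfl fun i _ => by
          rw [← add_smul]; exact congrArg (· • b i) (christoffelFirst_add_left _ _ v v' w (b i)))
      (fun c v w => by
        rw [Finset.smul_sum]
        exact Finset.sum_congr rfl fun i _ => by
          rw [smul_smul]; exact congrArg (· • b i) (christoffelFirst_smul_left _ _ c v w (b i)))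
      (fun v w w' => by
        rw [← Finset.sum_add_distrib]
        exact Finset.sum_congr rfl fun i _ => by
          rw [← add_smul]; exact congrArg (· • b i) (christoffelFirst_add_right _ _ v w w' (b i)))
      (fun c v w => by
        rw [Finset.smul_sum]
        exact Finset.sum_congr rfl fun i _ => by
          rw [smul_smul]; exact congrArg (· • b i) (christoffelFirst_smul_right _ _ c v w (b i)))

/-- A (complete) geodesic of `N`: a `C²` curve `γ : ℝ → N` with `∇_{γ'} γ' = 0`, that is
`(γᵏ)'' + Γᵏ_{ij} (γⁱ)' (γʲ)' = 0` in coordinates. -/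
def IsGeodesic (n : ℕ) {N : Type*} [TopologicalSpace N] [ChartedSpace (Euc n) N]
    [IsManifold (𝓡 n) 1 N] [RiemannianBundle (fun y : N => TangentSpace (𝓡 n) y)] (γ : ℝ → N) : Prop :=
  ContMDiff 𝓘(ℝ, ℝ) (𝓡 n) 2 γ ∧
    ∀ t : ℝ,
      let c : ℝ → Euc n := fun s => extChartAt (𝓡 n) (γ t) (γ s)
      let c' : TangentSpace (𝓡 n) (γ t) := deriv c t
      let c'' : TangentSpace (𝓡 n) (γ t) := deriv (deriv c) t
      c'' + christoffel (γ t) c' c' = 0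

/-- The vertical lift at `(x, y, ξ) ∈ T*Ω ⊗ TN` of a bilinear map `B : ℝᵐ × ℝᵐ → T_y N`: it maps
`e ∈ ℝᵐ` to the tangent vector at `(x, y, ξ)` to the fibre `L(ℝᵐ, T_y N)` given by `B e`. Tangent
vectors to `ℝᵐ × HomTangent m n N` are triples `(ẋ, ẏ, ξ')` read in the chart and the
trivialization preferred at `y`. -/
def vertLift (x : Euc m) (y : N) (ξ : Euc m →L[ℝ] TangentSpace (𝓡 n) y)
    (B : Euc m →L[ℝ] Euc m →L[ℝ] TangentSpace (𝓡 n) y) :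
    Euc m →L[ℝ] TangentSpace (homModel m n) ((x, ⟨y, ξ⟩) : Euc m × HomTangent m n N) :=
  (0 : Euc m →L[ℝ] Euc m).prod
    ((0 : Euc m →L[ℝ] Euc n).prod (B : Euc m →L[ℝ] Euc m →L[ℝ] Euc n))

/-- The horizontal lift at `(x, y, ξ) ∈ T*Ω ⊗ TN`, for the connection induced on `T*Ω ⊗ TN` by the
flat connection of `Ω` and the Levi-Civita connection of `N`, of the linear map
`e ↦ (e, ξ e)` from `ℝᵐ` to `T_x Ω × T_y N`: it maps `e` to `(e, ξ e, - Γ_y(ξ e, ξ ·))`. -/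
def horLift (x : Euc m) (y : N) (ξ : Euc m →L[ℝ] TangentSpace (𝓡 n) y) :
    Euc m →L[ℝ] TangentSpace (homModel m n) ((x, ⟨y, ξ⟩) : Euc m × HomTangent m n N) :=
  (ContinuousLinearMap.id ℝ (Euc m)).prod
    ((ξ : Euc m →L[ℝ] Euc n).prod
      (-((ContinuousLinearMap.precomp (TangentSpace (𝓡 n) y) ξ) ∘L (christoffel y) ∘L ξ) :
        Euc m →L[ℝ] Euc m →L[ℝ] Euc n))

/-! ### Colocal weak derivatives of maps `Ω → N` -/

/-- `U` is the colocal weak derivative `Tu` on `Ω` of the map `u` with values in `N`: a measurable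
bundle morphism that covers `u` with `T(f ∘ u) = Tf ∘ Tu` for every `f ∈ C¹_c(N, ℝ)`. -/
structure HasColocalWeakDerivOn (Ω : Set (Euc m)) (u : Euc m → N)
    (U : ∀ x, Euc m →L[ℝ] TangentSpace (𝓡 n) (u x)) : Prop where
  differentiable : ColocallyWeaklyDifferentiableOn (𝓡 n) Ω univ u
  measurable : LebesgueMeasurableOn Ω (fun x => (⟨u x, U x⟩ : HomTangent m n N))
  chain_rule : ∀ f : N → ℝ, ContMDiff (𝓡 n) 𝓘(ℝ, ℝ) 1 f → HasCompactSupport f →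
    HasWeakDerivOn Ω (f ∘ u)
      (fun x => (mfderiv (𝓡 n) 𝓘(ℝ, ℝ) f (u x) : TangentSpace (𝓡 n) (u x) →L[ℝ] ℝ) ∘L U x)

/-- The bundle morphism `U` covering `u`, as a map `x ↦ (x, u x, U x)` from `Ω` to
`T*Ω ⊗ TN ⊆ ℝᵐ × HomTangent m n N`. -/
def bundleMap (u : Euc m → N) (U : ∀ x, Euc m →L[ℝ] TangentSpace (𝓡 n) (u x)) (x : Euc m) :
    Euc m × HomTangent m n N :=
  (x, ⟨u x, U x⟩)

/-- `D` is the colocal weak covariant derivative `D_K U` on `Ω` of the colocally weakly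
differentiable map `U = Tu : Ω → T*Ω ⊗ TN`: it is measurable, and
`T(f ∘ U) = Tf(U)[Vert ∘ D + Hor ∘ U]` for every `f ∈ C¹_c(T*Ω ⊗ TN, ℝ)`. -/
structure HasColocalWeakCovDerivOn (Ω : Set (Euc m)) (u : Euc m → N)
    (U : ∀ x, Euc m →L[ℝ] TangentSpace (𝓡 n) (u x))
    (D : ∀ x, Euc m →L[ℝ] Euc m →L[ℝ] TangentSpace (𝓡 n) (u x)) : Prop where
  differentiable :
    ColocallyWeaklyDifferentiableOn (homModel m n) Ω (Ω ×ˢ univ) (bundleMap u U)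
  measurable : LebesgueMeasurableOn Ω (fun x => (⟨u x, D x⟩ : BilinTangent m n N))
  chain_rule : ∀ f : Euc m × HomTangent m n N → ℝ,
    ContMDiff (homModel m n) 𝓘(ℝ, ℝ) 1 f → HasCompactSupport f → tsupport f ⊆ Ω ×ˢ univ →
    HasWeakDerivOn Ω (f ∘ bundleMap u U)
      (fun x => (mfderiv (homModel m n) 𝓘(ℝ, ℝ) f (bundleMap u U x) :
          TangentSpace (homModel m n) (bundleMap u U x) →L[ℝ] ℝ) ∘L
        (vertLift x (u x) (U x) (D x) + horLift x (u x) (U x)))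

/-! ### Sobolev spaces -/

/-- `∫_Ω |U|^q` for a bundle morphism `U` covering `u`. -/
def firstEnergy (Ω : Set (Euc m)) (u : Euc m → N)
    (U : ∀ x, Euc m →L[ℝ] TangentSpace (𝓡 n) (u x)) (q : ℝ) : ℝ≥0∞ :=
  ∫⁻ x in Ω, ENNReal.ofReal (hsNorm (fun e => U x e)) ^ q

/-- `∫_Ω |D|^q` for a family `D` of bilinear maps covering `u`. -/
def secondEnergy (Ω : Set (Euc m)) (u : Euc m → N)
    (D : ∀ x, Euc m →L[ℝ] Euc m →L[ℝ] TangentSpace (𝓡 n) (u x)) (q : ℝ) : ℝ≥0∞ :=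
  ∫⁻ x in Ω, ENNReal.ofReal (hsNorm₂ (fun e e' => D x e e')) ^ q

/-- The map `u` belongs to the intrinsic space `Ẇ^{2,p}(Ω, N)`, with first colocal weak derivative
`Tu = U` and colocal weak covariant derivative `D_K(Tu) = D`. -/
structure IsSobolev2With (Ω : Set (Euc m)) (p : ℝ) (u : Euc m → N)
    (U : ∀ x, Euc m →L[ℝ] TangentSpace (𝓡 n) (u x))
    (D : ∀ x, Euc m →L[ℝ] Euc m →L[ℝ] TangentSpace (𝓡 n) (u x)) : Prop where
  deriv : HasColocalWeakDerivOn Ω u U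
  covDeriv : HasColocalWeakCovDerivOn Ω u U D
  energy_lt_top : secondEnergy Ω u D p < ⊤

/-- The intrinsic second-order Sobolev space `Ẇ^{2,p}(Ω, N)`. Maps on `Ω` are represented by
arbitrary extensions to `ℝᵐ`; membership depends only on the restriction to `Ω`. -/
def Sobolev2 (n : ℕ) (N : Type*) [TopologicalSpace N] [ChartedSpace (Euc n) N] [IsManifold (𝓡 n) 1 N]
    [RiemannianBundle (fun y : N => TangentSpace (𝓡 n) y)] (Ω : Set (Euc m)) (p : ℝ) : Set (Euc m → N) :=
  {u | ∃ (U : ∀ x, Euc m →L[ℝ] TangentSpace (𝓡 n) (u x))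
    (D : ∀ x, Euc m →L[ℝ] Euc m →L[ℝ] TangentSpace (𝓡 n) (u x)), IsSobolev2With Ω p u U D}

/-- The essential oscillation `ess sup {d_N(u(x), u(y)) : x, y ∈ Ω}` with respect to the Riemannian
distance. -/
def essOsc (n : ℕ) {N : Type*} [TopologicalSpace N] [ChartedSpace (Euc n) N]
    [RiemannianBundle (fun y : N => TangentSpace (𝓡 n) y)] (Ω : Set (Euc m)) (u : Euc m → N) : ℝ≥0∞ :=
  essSup (fun q : Euc m × Euc m => riemannianEDist (𝓡 n) (u q.1) (u q.2))
    ((volume.restrict Ω).prod (volume.restrict Ω))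

/-- The space `L^∞(Ω, N)` of measurable maps of finite essential oscillation. -/
def LInfty (n : ℕ) (N : Type*) [TopologicalSpace N] [ChartedSpace (Euc n) N]
    [RiemannianBundle (fun y : N => TangentSpace (𝓡 n) y)] (Ω : Set (Euc m)) :
    Set (Euc m → N) :=
  {u | LebesgueMeasurableOn Ω u ∧ essOsc n Ω u < ⊤}

/-- A `C²` isometric embedding of `N` in `ℝ^ν`. -/
structure IsIsometricEmbedding (n : ℕ) {N : Type*} [TopologicalSpace N] [ChartedSpace (Euc n) N]
    [RiemannianBundle (fun y : N => TangentSpace (𝓡 n) y)] {ν : ℕ} (ι : N → Euc ν) : Prop where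
  contMDiff : ContMDiff (𝓡 n) (𝓡 ν) 2 ι
  isEmbedding : Topology.IsEmbedding ι
  inner_eq : ∀ (y : N) (v w : TangentSpace (𝓡 n) y),
    inner ℝ (mfderiv (𝓡 n) (𝓡 ν) ι y v : Euc ν) (mfderiv (𝓡 n) (𝓡 ν) ι y w : Euc ν) = inner ℝ v w

/-- The second-order Sobolev space by embedding `Ẇ^{2,p}_ι(Ω, N)`: the maps `u` such that
`ι ∘ u ∈ W^{2,1}_loc(Ω, ℝ^ν)` and `|D²(ι ∘ u)| ∈ L^p(Ω)`. -/
def SobolevEmb2 {ν : ℕ} (ι : N → Euc ν) (Ω : Set (Euc m)) (p : ℝ) : Set (Euc m → N) :=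
  {u | LebesgueMeasurableOn Ω u ∧
    ∃ (G : Euc m → (Euc m →L[ℝ] Euc ν)) (H : Euc m → (Euc m →L[ℝ] Euc m →L[ℝ] Euc ν)),
      HasWeakDerivOn Ω (ι ∘ u) G ∧ HasWeakDerivOn Ω G H ∧
      ∫⁻ x in Ω, ENNReal.ofReal (hsNorm₂ (fun e e' => H x e e')) ^ p < ⊤}

end Riemannian

end

open Bundle

/-! Take u(x) = γ(|x|^(-α)) with α = m/(2p) - 1, which is positive because 2p < m. A geodesic has
constant speed l, and l > 0 for a nonconstant one, so |Tu| = α l |x|^(-α-1). Since (α+1)·2p = m, the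
integral of |Tu|^(2p) is a multiple of ∫ |x|^(-m) and diverges. The equation ∇_{γ'}γ' = 0 removes
from D_K(Tu) the term quadratic in the gradient of |x|^(-α). What remains is D²(|x|^(-α)) ⊗ γ', of
size O(|x|^(-α-2)), and (α+2)p = p + m/2 < m makes its p-th power integrable. Boundedness of γ gives
finite oscillation, so u makes the left side of the Gagliardo–Nirenberg inequality infinite and the
right side finite.

The origin is harmless for weak derivatives (`HasWeakDerivOn.of_diff_zero`). For f ∘ u the
derivative is dominated by the integrable function |x|^(-α-1) (`hasWeakDerivOn_comp_radialCurve`).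
For f ∘ Tu, with f compactly supported on the bundle, |Tu| → ∞ at the origin, so f ∘ Tu vanishes
nearby (`IsGeodesic.hasWeakDerivOn_comp_bundleMap`).

For the inclusion (`IsIsometricEmbedding.sobolevEmb2_subset`), let G and H be the first two weak
derivatives of ι ∘ u. Local retractions turn test functions on N and on T*Ω ⊗ TN into test functions
on vector spaces, where the weak chain rule applies. They also show that weak derivatives of maps
into a submanifold are tangent to it. By the Gauss formula the Christoffel symbols are the
tangential part of the second derivative of ι, so D_K(Tu) is the tangential part of H and is no
larger than H.

The inclusion is strict because v = ι ∘ u is bounded with |Dv| = K|x|^(-a) and 2ap = m. Suppose D²v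
were in L^p. Integrating φ|Dv|² by parts over a ball of radius s centred at distance 2s from the
origin gives a left side of order s^(m-2a). The right side consists of a term O(s^(m-a-1)),
negligible since a > 1, and a term in v·D²v, which Young's inequality bounds by a multiple of (δ +
δ^(1-p) o(1)) s^(m-2a). Letting s → 0 and then choosing δ small is a contradiction
(`energy_le_of_cutoff`, `not_integrableOn_hsNorm₂_fderiv_fderiv`). -/

open Filter Topology

set_option linter.unusedSectionVars false

/-! ### Calculus of weak derivatives. -/

section WeakDerivatives

variable {m : ℕ} {V W : Type*} [NormedAddCommGroup V] [NormedSpace ℝ V]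
  [NormedAddCommGroup W] [NormedSpace ℝ W]

/-- A test function supported in `Ω` times a locally integrable function is integrable. -/
lemma MeasureTheory.LocallyIntegrableOn.integrable_smul_of_tsupport_subset {Ω : Set (Euc m)} {f : Euc m → V}
    (hf : LocallyIntegrableOn f Ω volume) {φ : Euc m → ℝ} (hφ : Continuous φ)
    (hc : HasCompactSupport φ) (hs : tsupport φ ⊆ Ω) : Integrable (fun x => φ x • f x) volume := by
  have h1 : IntegrableOn f (tsupport φ) volume := hf.integrableOn_compact_subset hs hc
  have h2 : IntegrableOn (fun x => φ x • f x) (tsupport φ) volume :=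
    h1.continuousOn_smul hφ.continuousOn hc
  refine (integrableOn_iff_integrable_of_support_subset fun x hx => ?_).1 h2
  exact subset_tsupport φ fun h => hx (by simp [h])

lemma tsupport_fderiv_apply_subset_tsupport (φ : Euc m → ℝ) (e : Euc m) :
    tsupport (fun x => fderiv ℝ φ x e) ⊆ tsupport φ :=
  tsupport_fderiv_apply_subset ℝ e

lemma HasWeakDerivOn.congr_ae {Ω : Set (Euc m)} (hΩ : MeasurableSet Ω)
    {f f' : Euc m → V} {g g' : Euc m → (Euc m →L[ℝ] V)} (h : HasWeakDerivOn Ω f g)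
    (hf : f =ᵐ[volume.restrict Ω] f') (hg : g =ᵐ[volume.restrict Ω] g') :
    HasWeakDerivOn Ω f' g' where
  locallyIntegrable := h.locallyIntegrable.congr hf
  locallyIntegrable_deriv := h.locallyIntegrable_deriv.congr hg
  integral_eq φ hφ hc hs e := by
    rw [Filter.EventuallyEq, ae_restrict_iff' hΩ] at hf hg
    have h1 : ∫ x, fderiv ℝ φ x e • f x = ∫ x, fderiv ℝ φ x e • f' x := by
      refine integral_congr_ae ?_
      filter_upwards [hf] with x hx
      by_cases hxs : x ∈ tsupport φ
      · rw [hx (hs hxs)]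
      · rw [image_eq_zero_of_notMem_tsupport
          fun h => hxs (tsupport_fderiv_apply_subset_tsupport φ e h), zero_smul, zero_smul]
    have h2 : ∫ x, φ x • g x e = ∫ x, φ x • g' x e := by
      refine integral_congr_ae ?_
      filter_upwards [hg] with x hx
      by_cases hxs : x ∈ tsupport φ
      · rw [hx (hs hxs)]
      · rw [image_eq_zero_of_notMem_tsupport hxs, zero_smul, zero_smul]
    rw [← h1, ← h2, h.integral_eq φ hφ hc hs e]

lemma HasWeakDerivOn.mono {Ω Ω' : Set (Euc m)} {f : Euc m → V} {g : Euc m → (Euc m →L[ℝ] V)}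
    (h : HasWeakDerivOn Ω f g) (hs : Ω' ⊆ Ω) : HasWeakDerivOn Ω' f g where
  locallyIntegrable := h.locallyIntegrable.mono_set hs
  locallyIntegrable_deriv := h.locallyIntegrable_deriv.mono_set hs
  integral_eq φ hφ hc hs' e := h.integral_eq φ hφ hc (hs'.trans hs) e

/-- The fundamental lemma of the calculus of variations, applied to each of the m directional
components. It later identifies weak derivatives with classical ones away from the origin. -/
lemma HasWeakDerivOn.ae_eq [CompleteSpace V] {Ω : Set (Euc m)} (hΩ : IsOpen Ω) {f : Euc m → V}
    {g g' : Euc m → (Euc m →L[ℝ] V)}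
    (h : HasWeakDerivOn Ω f g) (h' : HasWeakDerivOn Ω f g') : g =ᵐ[volume.restrict Ω] g' := by
  have hloc : ∀ e, LocallyIntegrableOn (fun x => g x e - g' x e) Ω volume := fun e =>
    (((ContinuousLinearMap.apply ℝ V e).locallyIntegrableOn_comp h.locallyIntegrable_deriv).sub
      ((ContinuousLinearMap.apply ℝ V e).locallyIntegrableOn_comp h'.locallyIntegrable_deriv))
  have key : ∀ e : Euc m, ∀ᵐ x ∂volume, x ∈ Ω → g x e - g' x e = 0 := by
    intro e
    refine hΩ.ae_eq_zero_of_integral_contDiff_smul_eq_zero (hloc e) fun φ hφ hc hs => ?_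
    have i1 : Integrable (fun x => φ x • g x e) volume :=
      LocallyIntegrableOn.integrable_smul_of_tsupport_subset
        ((ContinuousLinearMap.apply ℝ V e).locallyIntegrableOn_comp h.locallyIntegrable_deriv)
        hφ.continuous hc hs
    have i2 : Integrable (fun x => φ x • g' x e) volume :=
      LocallyIntegrableOn.integrable_smul_of_tsupport_subset
        ((ContinuousLinearMap.apply ℝ V e).locallyIntegrableOn_comp h'.locallyIntegrable_deriv)
        hφ.continuous hc hs
    simp only [smul_sub]
    rw [integral_sub i1 i2, sub_eq_zero]
    have := (h.integral_eq φ hφ hc hs e).symm.trans (h'.integral_eq φ hφ hc hs e)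
    exact neg_injective this
  rw [Filter.EventuallyEq, ae_restrict_iff' hΩ.measurableSet]
  have := ae_all_iff.2 fun i : Fin m => key (EuclideanSpace.single i 1)
  filter_upwards [this] with x hx hxΩ
  ext1 v
  have hv : v = ∑ i, v i • EuclideanSpace.single i (1 : ℝ) := by
    ext j; simp [Finset.sum_apply, Pi.single_apply]
  rw [hv]
  simp only [map_sum, map_smul]
  exact Finset.sum_congr rfl fun i _ => by rw [sub_eq_zero.1 (hx i hxΩ)]

lemma HasWeakDerivOn.clm_comp [CompleteSpace V] [CompleteSpace W] {Ω : Set (Euc m)} {f : Euc m → V}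
    {g : Euc m → (Euc m →L[ℝ] V)}
    (h : HasWeakDerivOn Ω f g) (A : V →L[ℝ] W) :
    HasWeakDerivOn Ω (fun x => A (f x)) (fun x => A ∘L g x) where
  locallyIntegrable := A.locallyIntegrableOn_comp h.locallyIntegrable
  locallyIntegrable_deriv :=
    (ContinuousLinearMap.compL ℝ (Euc m) V W A).locallyIntegrableOn_comp h.locallyIntegrable_deriv
  integral_eq φ hφ hc hs e := by
    have hφ1 : Continuous fun x => fderiv ℝ φ x e :=
      (hφ.continuous_fderiv (by simp)).clm_apply continuous_const
    have i1 := h.locallyIntegrable.integrable_smul_of_tsupport_subset hφ1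
      (hc.fderiv_apply ℝ e) ((tsupport_fderiv_apply_subset_tsupport φ e).trans hs)
    have i2 : Integrable (fun x => φ x • g x e) volume :=
      LocallyIntegrableOn.integrable_smul_of_tsupport_subset
        ((ContinuousLinearMap.apply ℝ V e).locallyIntegrableOn_comp h.locallyIntegrable_deriv)
        hφ.continuous hc hs
    have e1 := A.integral_comp_comm i1
    have e2 := A.integral_comp_comm i2
    simp only [map_smul] at e1 e2
    simp only [ContinuousLinearMap.comp_apply, e1, e2, h.integral_eq φ hφ hc hs e, map_neg]

lemma HasWeakDerivOn.add [CompleteSpace V] {Ω : Set (Euc m)} {f f' : Euc m → V}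
    {g g' : Euc m → (Euc m →L[ℝ] V)}
    (h : HasWeakDerivOn Ω f g) (h' : HasWeakDerivOn Ω f' g') :
    HasWeakDerivOn Ω (fun x => f x + f' x) (fun x => g x + g' x) where
  locallyIntegrable := LocallyIntegrableOn.add (f := f) h.locallyIntegrable h'.locallyIntegrable
  locallyIntegrable_deriv := LocallyIntegrableOn.add (f := g) h.locallyIntegrable_deriv
    h'.locallyIntegrable_deriv
  integral_eq φ hφ hc hs e := by
    have hφ1 : Continuous fun x => fderiv ℝ φ x e :=
      (hφ.continuous_fderiv (by simp)).clm_apply continuous_const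
    have i1 := h.locallyIntegrable.integrable_smul_of_tsupport_subset hφ1
      (hc.fderiv_apply ℝ e) ((tsupport_fderiv_apply_subset_tsupport φ e).trans hs)
    have i1' := h'.locallyIntegrable.integrable_smul_of_tsupport_subset hφ1
      (hc.fderiv_apply ℝ e) ((tsupport_fderiv_apply_subset_tsupport φ e).trans hs)
    have i2 : Integrable (fun x => φ x • g x e) volume :=
      LocallyIntegrableOn.integrable_smul_of_tsupport_subset
        ((ContinuousLinearMap.apply ℝ V e).locallyIntegrableOn_comp h.locallyIntegrable_deriv)
        hφ.continuous hc hs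
    have i2' : Integrable (fun x => φ x • g' x e) volume :=
      LocallyIntegrableOn.integrable_smul_of_tsupport_subset
        ((ContinuousLinearMap.apply ℝ V e).locallyIntegrableOn_comp h'.locallyIntegrable_deriv)
        hφ.continuous hc hs
    simp only [smul_add, add_apply]
    rw [integral_add i1 i1', integral_add i2 i2', h.integral_eq φ hφ hc hs e,
      h'.integral_eq φ hφ hc hs e, neg_add]

lemma HasWeakDerivOn.prodMk [CompleteSpace V] [CompleteSpace W] {Ω : Set (Euc m)} {f : Euc m → V}
    {f' : Euc m → W} {g : Euc m → (Euc m →L[ℝ] V)} {g' : Euc m → (Euc m →L[ℝ] W)}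
    (h : HasWeakDerivOn Ω f g) (h' : HasWeakDerivOn Ω f' g') :
    HasWeakDerivOn Ω (fun x => (f x, f' x)) (fun x => (g x).prod (g' x)) := by
  have := (h.clm_comp (ContinuousLinearMap.inl ℝ V W)).add
    (h'.clm_comp (ContinuousLinearMap.inr ℝ V W))
  convert this using 2
  · simp
  · ext1 v; simp

/-- A `C¹` function on an open set is weakly differentiable there. -/
lemma ContDiffOn.hasWeakDerivOn [CompleteSpace V] {Ω : Set (Euc m)} (hΩ : IsOpen Ω) {f : Euc m → V}
    (hf : ContDiffOn ℝ 1 f Ω) : HasWeakDerivOn Ω f (fderiv ℝ f) where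
  locallyIntegrable := hf.continuousOn.locallyIntegrableOn hΩ.measurableSet
  locallyIntegrable_deriv :=
    (hf.continuousOn_fderiv_of_isOpen hΩ le_rfl).locallyIntegrableOn hΩ.measurableSet
  integral_eq φ hφ hc hs e := by
    have l1 : LocallyIntegrableOn f Ω volume := hf.continuousOn.locallyIntegrableOn hΩ.measurableSet
    have l2 : LocallyIntegrableOn (fun x => fderiv ℝ f x e) Ω volume :=
      ((hf.continuousOn_fderiv_of_isOpen hΩ le_rfl).clm_apply
        continuousOn_const).locallyIntegrableOn hΩ.measurableSet
    have hφ1 : Continuous fun x => fderiv ℝ φ x e :=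
      (hφ.continuous_fderiv (by simp)).clm_apply continuous_const
    have i1 := l1.integrable_smul_of_tsupport_subset hφ1
      (hc.fderiv_apply ℝ e) ((tsupport_fderiv_apply_subset_tsupport φ e).trans hs)
    have i2 := l2.integrable_smul_of_tsupport_subset hφ.continuous hc hs
    have i3 := l1.integrable_smul_of_tsupport_subset hφ.continuous hc hs
    -- Each factor need only be differentiable on the support of the other one, so it is enough that
    -- `f` is differentiable on the support of `φ`, which lies in `Ω`.
    rw [integral_smul_fderiv_eq_neg_fderiv_smul_of_integrable i1 i2 i3, neg_neg]
    · exact fun x _ => (hφ.differentiable (by simp)) x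
    · exact fun x hx => ((hf.contDiffAt (hΩ.mem_nhds (hs hx))).differentiableAt (by simp))

end WeakDerivatives

/-! ### The chain rule for weak derivatives, by mollification. -/

section ChainRule

/-- Smooth cutoff functions between a compact set and an open set. -/
lemma exists_contDiff_cutoff {E : Type*} [NormedAddCommGroup E] [NormedSpace ℝ E]
    [FiniteDimensional ℝ E] {K Ω : Set E} (hK : IsCompact K) (hΩ : IsOpen Ω) (h : K ⊆ Ω) :
    ∃ χ : E → ℝ, ContDiff ℝ ∞ χ ∧ HasCompactSupport χ ∧ tsupport χ ⊆ Ω ∧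
      ∀ x ∈ K, χ =ᶠ[𝓝 x] 1 := by
  have : ProperSpace E := FiniteDimensional.proper_real E
  obtain ⟨t, htc, h1, h2⟩ := exists_compact_between hK hΩ h
  obtain ⟨f, hf1, hf0, -⟩ := exists_contMDiffMap_one_nhds_of_subset_interior 𝓘(ℝ, E) (n := (⊤ : ℕ∞))
    hK.isClosed h1
  have hs : tsupport f ⊆ t := closure_minimal (fun x hx => by
    by_contra hxt; exact hx (hf0 x hxt)) htc.isClosed
  exact ⟨f, f.contMDiff.contDiff, htc.of_isClosed_subset (isClosed_tsupport _) hs, hs.trans h2,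
    fun x hx => hf1.filter_mono (nhds_le_nhdsSet hx)⟩

/-- Scheffé's lemma: almost everywhere convergence without gain of mass implies `L¹` convergence. -/
lemma tendsto_integral_norm_sub_of_ae_tendsto {X V : Type*} [MeasurableSpace X] {μ : Measure X}
    [NormedAddCommGroup V] {f : ℕ → X → V} {g : X → V} (hf : ∀ k, Integrable (f k) μ)
    (hg : Integrable g μ) (hlim : ∀ᵐ x ∂μ, Tendsto (fun k => f k x) atTop (𝓝 (g x)))
    (hle : ∀ k, ∫ x, ‖f k x‖ ∂μ ≤ ∫ x, ‖g x‖ ∂μ) :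
    Tendsto (fun k => ∫ x, ‖f k x - g x‖ ∂μ) atTop (𝓝 0) := by
  -- The triangle inequality places this integrand between 0 and 2‖g‖, so dominated convergence
  -- applies although the `f k` themselves have no common majorant.
  have h1 : Tendsto (fun k => ∫ x, (‖f k x‖ + ‖g x‖ - ‖f k x - g x‖) ∂μ) atTop
      (𝓝 (∫ x, (2 * ‖g x‖) ∂μ)) := by
    refine tendsto_integral_of_dominated_convergence (fun x => 2 * ‖g x‖)
      (fun k => (((hf k).norm.add hg.norm).sub ((hf k).sub hg).norm).aestronglyMeasurable)
      (hg.norm.const_mul 2) (fun k => ?_) ?_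
    · refine Eventually.of_forall fun x => ?_
      have a1 := norm_sub_norm_le (f k x) (g x)
      have a2 := norm_sub_le (f k x) (g x)
      rw [Real.norm_eq_abs, abs_le]
      constructor <;> linarith [norm_nonneg (g x)]
    · filter_upwards [hlim] with x hx
      have : Tendsto (fun k => ‖f k x‖ + ‖g x‖ - ‖f k x - g x‖) atTop
          (𝓝 (‖g x‖ + ‖g x‖ - ‖g x - g x‖)) :=
        (hx.norm.add tendsto_const_nhds).sub (hx.sub tendsto_const_nhds).norm
      simpa [two_mul] using this
  have h2 : ∀ k, ∫ x, (‖f k x‖ + ‖g x‖ - ‖f k x - g x‖) ∂μ =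
      ∫ x, ‖f k x‖ ∂μ + ∫ x, ‖g x‖ ∂μ - ∫ x, ‖f k x - g x‖ ∂μ := fun k => by
    have i1 : Integrable (fun x => ‖f k x‖ + ‖g x‖) μ := (hf k).norm.add hg.norm
    have i2 : Integrable (fun x => ‖f k x - g x‖) μ := ((hf k).sub hg).norm
    rw [integral_sub i1 i2, integral_add (hf k).norm hg.norm]
  rw [integral_const_mul] at h1
  have h3 : Tendsto (fun k => 2 * ∫ x, ‖g x‖ ∂μ - ∫ x, (‖f k x‖ + ‖g x‖ - ‖f k x - g x‖) ∂μ) atTop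
      (𝓝 0) := by
    have := (tendsto_const_nhds (x := 2 * ∫ x, ‖g x‖ ∂μ) (f := atTop (α := ℕ))).sub h1
    rwa [sub_self] at this
  refine squeeze_zero (fun k => integral_nonneg fun x => norm_nonneg _) (fun k => ?_) h3
  rw [h2]; linarith [hle k]

variable {m : ℕ} {V E : Type*} [NormedAddCommGroup V] [NormedSpace ℝ V] [CompleteSpace V]
  [NormedAddCommGroup E] [NormedSpace ℝ E] [CompleteSpace E]

open scoped Convolution

/-- A sequence of bump functions shrinking to the origin. -/
noncomputable def shrinkingBump (m : ℕ) (k : ℕ) : ContDiffBump (0 : Euc m) where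
  rIn := 1 / ((k : ℝ) + 1)
  rOut := 2 * (1 / ((k : ℝ) + 1))
  rIn_pos := Nat.one_div_pos_of_nat
  rIn_lt_rOut := by
    have : (0 : ℝ) < 1 / ((k : ℝ) + 1) := Nat.one_div_pos_of_nat
    linarith

/-- The mollification of `f` by the `k`-th shrinking bump function. -/
noncomputable def mollify (k : ℕ) (f : Euc m → V) : Euc m → V :=
  ((shrinkingBump m k).normed volume ⋆[ContinuousLinearMap.lsmul ℝ ℝ, volume] f)

lemma ae_tendsto_mollify {f : Euc m → V} (hf : Integrable f volume) :
    ∀ᵐ x, Tendsto (fun k => mollify k f x) atTop (𝓝 (f x)) := by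
  -- The constant 2 is the fixed ratio of outer to inner radius of the bumps.
  refine ContDiffBump.ae_convolution_tendsto_right_of_locallyIntegrable (K := 2) ?_ ?_
    hf.locallyIntegrable
  · simpa [shrinkingBump] using (tendsto_one_div_add_atTop_nhds_zero_nat (𝕜 := ℝ)).const_mul 2
  · exact Eventually.of_forall fun k => le_rfl

lemma integrable_mollify {f : Euc m → V} (hf : Integrable f volume) (k : ℕ) :
    Integrable (mollify k f) volume :=
  Integrable.integrable_convolution _ (shrinkingBump m k).integrable_normed hf

/-- The kernel is nonnegative with integral one, so the norm of the mollification is at most the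
mollification of the norm, which has the same integral as the norm. With almost everywhere
convergence this is the input of Scheffé's lemma. -/
lemma integral_norm_mollify_le {f : Euc m → V} (hf : Integrable f volume) (k : ℕ) :
    ∫ x, ‖mollify k f x‖ ≤ ∫ x, ‖f x‖ := by
  set φ := (shrinkingBump m k).normed (volume : Measure (Euc m))
  have hφ : Integrable φ volume := (shrinkingBump m k).integrable_normed
  have h1 : ∫ x, (φ ⋆[ContinuousLinearMap.lsmul ℝ ℝ, volume] fun y => ‖f y‖) x = ∫ x, ‖f x‖ := by
    rw [integral_convolution _ hφ hf.norm, ContDiffBump.integral_normed]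
    simp
  rw [← h1]
  refine integral_mono (integrable_mollify hf k).norm
    (Integrable.integrable_convolution _ hφ hf.norm) fun x => ?_
  refine (norm_integral_le_integral_norm _).trans (le_of_eq ?_)
  refine integral_congr_ae (Eventually.of_forall fun t => ?_)
  simp only [ContinuousLinearMap.lsmul_apply, norm_smul, smul_eq_mul, Real.norm_eq_abs]
  rw [abs_of_nonneg (ContDiffBump.nonneg_normed _ _)]

lemma tendsto_integral_norm_mollify_sub {f : Euc m → V} (hf : Integrable f volume) :
    Tendsto (fun k => ∫ x, ‖mollify k f x - f x‖) atTop (𝓝 0) :=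
  tendsto_integral_norm_sub_of_ae_tendsto (integrable_mollify hf) hf (ae_tendsto_mollify hf)
    (integral_norm_mollify_le hf)

lemma contDiff_mollify {f : Euc m → V} (hf : Integrable f volume) (k : ℕ) :
    ContDiff ℝ 1 (mollify k f) := by
  have := HasCompactSupport.contDiff_convolution_left (n := 1) (μ := (volume : Measure (Euc m)))
    (ContinuousLinearMap.lsmul ℝ ℝ) ((shrinkingBump m k).hasCompactSupport_normed (μ := volume))
    ((shrinkingBump m k).contDiff_normed (μ := volume)) hf.locallyIntegrable
  exact_mod_cast this

/-- The classical derivative falls on the kernel. Testing the weak derivative against t ↦ φ(x - t)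
moves it to `w`, and the sign of the reflection cancels that of the integration by parts. -/
lemma fderiv_mollify_apply {w : Euc m → V} {G : Euc m → (Euc m →L[ℝ] V)}
    (h : HasWeakDerivOn univ w G) (hw : Integrable w volume) (k : ℕ) (x e : Euc m) :
    fderiv ℝ (mollify k w) x e = mollify k (fun y => G y e) x := by
  set φ := (shrinkingBump m k).normed (volume : Measure (Euc m)) with hφdef
  have hφ : ContDiff ℝ ∞ φ := (shrinkingBump m k).contDiff_normed
  have hφc : HasCompactSupport φ := (shrinkingBump m k).hasCompactSupport_normed
  have h1 := hφc.hasFDerivAt_convolution_left (ContinuousLinearMap.lsmul ℝ ℝ)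
    (hφ.of_le (by simp)) hw.locallyIntegrable x
  have h2 : fderiv ℝ (mollify k w) x e =
      (fderiv ℝ φ ⋆[(ContinuousLinearMap.lsmul ℝ ℝ).precompL (Euc m), volume] w) x e := by
    rw [← h1.fderiv]; rfl
  have hex : ConvolutionExistsAt (fderiv ℝ φ) w x
      ((ContinuousLinearMap.lsmul ℝ ℝ).precompL (Euc m)) volume :=
    (hφc.fderiv ℝ).convolutionExists_left _ (hφ.continuous_fderiv (by simp))
      hw.locallyIntegrable x
  rw [h2, convolution_eq_swap, mollify, convolution_eq_swap,
    ContinuousLinearMap.integral_apply]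
  · set ψ : Euc m → ℝ := fun t => φ (x - t)
    have hψ : ContDiff ℝ ∞ ψ := hφ.comp (contDiff_const.sub contDiff_id)
    have hψc : HasCompactSupport ψ := hφc.comp_homeomorph (Homeomorph.subLeft x)
    have hd : ∀ t, fderiv ℝ ψ t e = - fderiv ℝ φ (x - t) e := fun t => by
      have : HasFDerivAt ψ ((fderiv ℝ φ (x - t)) ∘L (-ContinuousLinearMap.id ℝ (Euc m))) t :=
        ((hφ.differentiable (by simp)) (x - t)).hasFDerivAt.comp t
          ((hasFDerivAt_id t).const_sub x)
      rw [this.fderiv]; simp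
    have h3 := h.integral_eq ψ hψ hψc (subset_univ _) e
    simp only [hd, neg_smul, integral_neg, neg_inj] at h3
    simpa using h3
  · exact hex.integrable_swap

/-- A weakly differentiable function times a test function is weakly differentiable on the whole
space. -/
lemma HasWeakDerivOn.smul_test {Ω : Set (Euc m)} {w : Euc m → V} {G : Euc m → (Euc m →L[ℝ] V)}
    (h : HasWeakDerivOn Ω w G) {χ : Euc m → ℝ} (hχ : ContDiff ℝ ∞ χ) (hχc : HasCompactSupport χ)
    (hχs : tsupport χ ⊆ Ω) :
    Integrable (fun x => χ x • w x) volume ∧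
    Integrable (fun x => χ x • G x + (fderiv ℝ χ x).smulRight (w x)) volume ∧
    HasWeakDerivOn univ (fun x => χ x • w x)
      (fun x => χ x • G x + (fderiv ℝ χ x).smulRight (w x)) := by
  have hχ' : Continuous (fderiv ℝ χ) := hχ.continuous_fderiv (by simp)
  have i1 := h.locallyIntegrable.integrable_smul_of_tsupport_subset hχ.continuous hχc hχs
  have i2 := h.locallyIntegrable_deriv.integrable_smul_of_tsupport_subset hχ.continuous hχc hχs
  have i3 : Integrable (fun x => (fderiv ℝ χ x).smulRight (w x)) volume := by
    have h1 : IntegrableOn w (tsupport χ) volume :=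
      h.locallyIntegrable.integrableOn_compact_subset hχs hχc
    obtain ⟨C, hC⟩ := (hχc.fderiv ℝ).exists_bound_of_continuous hχ'
    have h2 : IntegrableOn (fun x => (fderiv ℝ χ x).smulRight (w x)) (tsupport χ) volume := by
      refine (h1.norm.const_mul C).mono' ?_ (Eventually.of_forall fun x => ?_)
      · have : Continuous fun q : (Euc m →L[ℝ] ℝ) × V => q.1.smulRight q.2 :=
          (ContinuousLinearMap.smulRightL ℝ (Euc m) V).continuous₂
        exact this.comp_aestronglyMeasurable
          (hχ'.aestronglyMeasurable.prodMk h1.aestronglyMeasurable)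
      · rw [ContinuousLinearMap.norm_smulRight_apply]
        exact mul_le_mul_of_nonneg_right (hC x) (norm_nonneg _)
    refine IntegrableOn.integrable_of_forall_notMem_eq_zero (ε' := Euc m →L[ℝ] V) h2
      fun x hxs => ?_
    have : fderiv ℝ χ x = 0 := by
      by_contra hne
      exact hxs (support_fderiv_subset ℝ hne)
    simp [this]
  refine ⟨i1, i2.add i3, ⟨i1.locallyIntegrable.locallyIntegrableOn _,
    (i2.add i3).locallyIntegrable.locallyIntegrableOn _, fun φ hφ hc _ e => ?_⟩⟩
  have hψ : ContDiff ℝ ∞ (fun x => φ x * χ x) := hφ.mul hχ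
  have hψc : HasCompactSupport (fun x => φ x * χ x) := hc.mul_right
  have hψs : tsupport (fun x => φ x * χ x) ⊆ Ω :=
    (tsupport_mul_subset_right (f := φ) (g := χ)).trans hχs
  have key := h.integral_eq _ hψ hψc hψs e
  have hd : ∀ x, fderiv ℝ (fun x => φ x * χ x) x e • w x
      = fderiv ℝ φ x e • χ x • w x + φ x • fderiv ℝ χ x e • w x := fun x => by
    rw [fderiv_fun_mul (hφ.differentiable (by simp) x) (hχ.differentiable (by simp) x)]
    simp only [add_apply, smul_apply, smul_eq_mul, add_smul, mul_smul]
    rw [add_comm, smul_comm (χ x)]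
  obtain ⟨C, hC⟩ := hc.exists_bound_of_continuous hφ.continuous
  have hφ1 : Continuous fun x => fderiv ℝ φ x e :=
    (hφ.continuous_fderiv (by simp)).clm_apply continuous_const
  obtain ⟨C', hC'⟩ := (hc.fderiv_apply ℝ e).exists_bound_of_continuous hφ1
  have j1 : Integrable (fun x => fderiv ℝ φ x e • χ x • w x) volume :=
    i1.bdd_smul C' hφ1.aestronglyMeasurable (Eventually.of_forall hC')
  have j2 : Integrable (fun x => φ x • fderiv ℝ χ x e • w x) volume :=
    ((ContinuousLinearMap.apply ℝ V e).integrable_comp i3).bdd_smul C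
      hφ.continuous.aestronglyMeasurable (Eventually.of_forall hC)
  have j3 : Integrable (fun x => φ x • χ x • G x e) volume :=
    ((ContinuousLinearMap.apply ℝ V e).integrable_comp i2).bdd_smul C
      hφ.continuous.aestronglyMeasurable (Eventually.of_forall hC)
  simp only [hd] at key
  rw [integral_add j1 j2] at key
  simp only [add_apply, smul_apply, ContinuousLinearMap.smulRight_apply, smul_add]
  simp only [mul_smul] at key
  rw [integral_add j3 j2, neg_add, ← key]
  abel

/-- The chain rule for an integrable function with an integrable weak derivative. -/
lemma HasWeakDerivOn.integral_comp_eq {w : Euc m → E} {G : Euc m → (Euc m →L[ℝ] E)}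
    (h : HasWeakDerivOn univ w G) (hw : Integrable w volume) (hG : Integrable G volume)
    {F : E → V} (hF : ContDiff ℝ 1 F) (hFc : HasCompactSupport F)
    {φ : Euc m → ℝ} (hφ : ContDiff ℝ ∞ φ) (hc : HasCompactSupport φ) (e : Euc m) :
    ∫ x, fderiv ℝ φ x e • F (w x) = - ∫ x, φ x • fderiv ℝ F (w x) (G x e) := by
  have hF' : Continuous (fderiv ℝ F) := hF.continuous_fderiv (by simp)
  obtain ⟨C, hC⟩ := hFc.exists_bound_of_continuous hF.continuous
  obtain ⟨C', hC'⟩ := (hFc.fderiv ℝ).exists_bound_of_continuous hF'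
  obtain ⟨M, hM⟩ := hc.exists_bound_of_continuous hφ.continuous
  have hφ1 : Continuous fun x => fderiv ℝ φ x e :=
    (hφ.continuous_fderiv (by simp)).clm_apply continuous_const
  have iφ : Integrable φ volume := hφ.continuous.integrable_of_hasCompactSupport hc
  have iφ1 : Integrable (fun x => fderiv ℝ φ x e) volume :=
    hφ1.integrable_of_hasCompactSupport (hc.fderiv_apply ℝ e)
  have hGe : Integrable (fun x => G x e) volume :=
    (ContinuousLinearMap.apply ℝ E e).integrable_comp hG
  have mF' : ∀ {w' : Euc m → E} {g : Euc m → E}, AEStronglyMeasurable w' volume →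
      AEStronglyMeasurable g volume →
      AEStronglyMeasurable (fun x => fderiv ℝ F (w' x) (g x)) volume := fun h1 h2 =>
    (isBoundedBilinearMap_apply (𝕜 := ℝ) (E := E) (F := V)).continuous.comp_aestronglyMeasurable
      ((hF'.comp_aestronglyMeasurable h1).prodMk h2)
  have step : ∀ k, ∫ x, fderiv ℝ φ x e • F (mollify k w x) =
      - ∫ x, φ x • fderiv ℝ F (mollify k w x) (mollify k (fun y => G y e) x) := fun k => by
    have hc1 : ContDiff ℝ 1 (F ∘ mollify k w) := hF.comp (contDiff_mollify hw k)
    have := (hc1.contDiffOn.hasWeakDerivOn isOpen_univ).integral_eq φ hφ hc (subset_univ _) e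
    simp only [Function.comp_apply] at this
    rw [this]
    congr 2 with x
    rw [fderiv_comp _ (hF.differentiable (by simp) _)
      ((contDiff_mollify hw k).differentiable (by simp) x), ContinuousLinearMap.comp_apply,
      fderiv_mollify_apply h hw]
  have lim1 : Tendsto (fun k => ∫ x, fderiv ℝ φ x e • F (mollify k w x)) atTop
      (𝓝 (∫ x, fderiv ℝ φ x e • F (w x))) := by
    refine tendsto_integral_of_dominated_convergence (fun x => ‖fderiv ℝ φ x e‖ * C)
      (fun k => ?_) (iφ1.norm.mul_const C) (fun k => Eventually.of_forall fun x => ?_) ?_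
    · exact hφ1.aestronglyMeasurable.smul (hF.continuous.comp_aestronglyMeasurable
        (contDiff_mollify hw k).continuous.aestronglyMeasurable)
    · rw [norm_smul]
      exact mul_le_mul_of_nonneg_left (hC _) (norm_nonneg _)
    · filter_upwards [ae_tendsto_mollify hw] with x hx
      exact ((hF.continuous.tendsto _).comp hx).const_smul _
  -- Split F'(w_k)G_k as F'(w_k)(G_k - G) + F'(w_k)G. The first term tends to 0 in L¹ because F' is
  -- bounded, and the second converges by domination.
  have ia : ∀ k, Integrable (fun x => φ x • fderiv ℝ F (mollify k w x)
      (mollify k (fun y => G y e) x - G x e)) volume := fun k => by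
    refine (((integrable_mollify hGe k).sub hGe).norm.const_mul (M * C')).mono' ?_ ?_
    · exact hφ.continuous.aestronglyMeasurable.smul (mF'
        (contDiff_mollify hw k).continuous.aestronglyMeasurable
        ((integrable_mollify hGe k).sub hGe).aestronglyMeasurable)
    · refine Eventually.of_forall fun x => ?_
      rw [norm_smul, mul_assoc]
      exact mul_le_mul (hM x) ((ContinuousLinearMap.le_opNorm _ _).trans
        (mul_le_mul_of_nonneg_right (hC' _) (norm_nonneg _))) (norm_nonneg _)
        ((norm_nonneg _).trans (hM x))
  have ib : ∀ (w' : Euc m → E), AEStronglyMeasurable w' volume →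
      Integrable (fun x => φ x • fderiv ℝ F (w' x) (G x e)) volume := fun w' hw' => by
    refine (hGe.norm.const_mul (M * C')).mono' ?_ ?_
    · exact hφ.continuous.aestronglyMeasurable.smul (mF' hw' hGe.aestronglyMeasurable)
    · refine Eventually.of_forall fun x => ?_
      rw [norm_smul, mul_assoc]
      exact mul_le_mul (hM x) ((ContinuousLinearMap.le_opNorm _ _).trans
        (mul_le_mul_of_nonneg_right (hC' _) (norm_nonneg _))) (norm_nonneg _)
        ((norm_nonneg _).trans (hM x))
  have lim2 : Tendsto (fun k => ∫ x, φ x • fderiv ℝ F (mollify k w x)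
      (mollify k (fun y => G y e) x - G x e)) atTop (𝓝 0) := by
    have := (tendsto_integral_norm_mollify_sub hGe).const_mul (M * C')
    rw [mul_zero] at this
    refine squeeze_zero_norm (fun k => ?_) this
    rw [← integral_const_mul]
    refine (norm_integral_le_integral_norm _).trans (integral_mono (ia k).norm
      (((integrable_mollify hGe k).sub hGe).norm.const_mul (M * C')) fun x => ?_)
    simp only
    rw [norm_smul, mul_assoc]
    exact mul_le_mul (hM x) ((ContinuousLinearMap.le_opNorm _ _).trans
        (mul_le_mul_of_nonneg_right (hC' _) (norm_nonneg _))) (norm_nonneg _)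
        ((norm_nonneg _).trans (hM x))
  have lim3 : Tendsto (fun k => ∫ x, φ x • fderiv ℝ F (mollify k w x) (G x e)) atTop
      (𝓝 (∫ x, φ x • fderiv ℝ F (w x) (G x e))) := by
    refine tendsto_integral_of_dominated_convergence (fun x => M * C' * ‖G x e‖)
      (fun k => (ib _ (contDiff_mollify hw k).continuous.aestronglyMeasurable).aestronglyMeasurable)
      (hGe.norm.const_mul _) (fun k => Eventually.of_forall fun x => ?_) ?_
    · rw [norm_smul, mul_assoc]
      exact mul_le_mul (hM x) ((ContinuousLinearMap.le_opNorm _ _).trans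
        (mul_le_mul_of_nonneg_right (hC' _) (norm_nonneg _))) (norm_nonneg _)
        ((norm_nonneg _).trans (hM x))
    · filter_upwards [ae_tendsto_mollify hw] with x hx
      have hcont : Continuous fun y => fderiv ℝ F y (G x e) := hF'.clm_apply continuous_const
      exact ((hcont.tendsto _).comp hx).const_smul _
  have lim4 := (lim2.add lim3).neg
  rw [zero_add] at lim4
  refine tendsto_nhds_unique lim1 (lim4.congr fun k => ?_)
  rw [step, ← integral_add (ia k) (ib _ (contDiff_mollify hw k).continuous.aestronglyMeasurable)]
  congr 2 with x
  rw [← smul_add, ← map_add, sub_add_cancel]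

/-- The chain rule for the composition of a weakly differentiable function with a compactly
supported `C¹` function. -/
lemma HasWeakDerivOn.comp_contDiff {Ω : Set (Euc m)} (hΩ : IsOpen Ω) {w : Euc m → E}
    {G : Euc m → (Euc m →L[ℝ] E)} (h : HasWeakDerivOn Ω w G)
    {F : E → V} (hF : ContDiff ℝ 1 F) (hFc : HasCompactSupport F) :
    HasWeakDerivOn Ω (fun x => F (w x)) (fun x => fderiv ℝ F (w x) ∘L G x) := by
  have hF' : Continuous (fderiv ℝ F) := hF.continuous_fderiv (by simp)
  obtain ⟨C, hC⟩ := hFc.exists_bound_of_continuous hF.continuous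
  obtain ⟨C', hC'⟩ := (hFc.fderiv ℝ).exists_bound_of_continuous hF'
  have mw := h.locallyIntegrable.aestronglyMeasurable
  have mG := h.locallyIntegrable_deriv.aestronglyMeasurable
  refine ⟨?_, ?_, fun φ hφ hc hs e => ?_⟩
  · refine (locallyIntegrableOn_iff hΩ.isLocallyClosed).2 fun k hk hkc => ?_
    refine (integrableOn_const (hs := hkc.measure_lt_top.ne) (C := C)).mono'
      (hF.continuous.comp_aestronglyMeasurable (mw.mono_measure (Measure.restrict_mono_set _ hk)))
      (Eventually.of_forall fun x => hC _)
  · refine (locallyIntegrableOn_iff hΩ.isLocallyClosed).2 fun k hk hkc => ?_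
    refine ((h.locallyIntegrable_deriv.integrableOn_compact_subset hk hkc).norm.const_mul C').mono'
      ?_ (Eventually.of_forall fun x => ?_)
    · have hcont : Continuous fun q : (E →L[ℝ] V) × (Euc m →L[ℝ] E) => q.1 ∘L q.2 :=
        (ContinuousLinearMap.compL ℝ (Euc m) E V).continuous₂
      exact (hcont.comp_aestronglyMeasurable
        ((hF'.comp_aestronglyMeasurable mw).prodMk mG)).mono_measure
        (Measure.restrict_mono_set _ hk)
    · exact (ContinuousLinearMap.opNorm_comp_le _ _).trans
        (mul_le_mul_of_nonneg_right (hC' _) (norm_nonneg _))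
  -- Since χ = 1 near the support of `φ`, replacing `w` by χw changes neither side of the identity,
  -- and χw is integrable on the whole space together with its weak derivative.
  · obtain ⟨χ, hχ, hχc, hχs, hχ1⟩ := exists_contDiff_cutoff hc hΩ hs
    obtain ⟨i1, i2, hw⟩ := h.smul_test hχ hχc hχs
    have key := hw.integral_comp_eq i1 i2 hF hFc hφ hc e
    have e1 : ∀ x, fderiv ℝ φ x e • F (χ x • w x) = fderiv ℝ φ x e • F (w x) := fun x => by
      by_cases hx : x ∈ tsupport φ
      · rw [(hχ1 x hx).self_of_nhds, Pi.one_apply, one_smul]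
      · rw [image_eq_zero_of_notMem_tsupport
          fun h => hx (tsupport_fderiv_apply_subset_tsupport φ e h), zero_smul, zero_smul]
    have e2 : ∀ x, φ x • fderiv ℝ F (χ x • w x)
        ((χ x • G x + (fderiv ℝ χ x).smulRight (w x)) e) =
        φ x • (fderiv ℝ F (w x) ∘L G x) e := fun x => by
      by_cases hx : x ∈ tsupport φ
      · have : fderiv ℝ χ x = 0 := by
          rw [(hχ1 x hx).fderiv_eq]; exact fderiv_const_apply (1 : ℝ)
        rw [(hχ1 x hx).self_of_nhds, this]
        simp
      · rw [image_eq_zero_of_notMem_tsupport hx, zero_smul, zero_smul]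
    simp only [e1, e2] at key
    exact key

end ChainRule

/-! ### Removability of a point for weak derivatives. -/

section RemovableSingularity

variable {m : ℕ} {V : Type*} [NormedAddCommGroup V] [NormedSpace ℝ V] [CompleteSpace V]

lemma nontrivial_euc (hm : 1 ≤ m) : Nontrivial (Euc m) := by
  have : Nonempty (Fin m) := ⟨⟨0, hm⟩⟩
  infer_instance

lemma restrict_diff_zero (hm : 1 ≤ m) (Ω : Set (Euc m)) :
    (volume : Measure (Euc m)).restrict (Ω \ {0}) = volume.restrict Ω := by
  have := nontrivial_euc hm
  exact Measure.restrict_congr_set (sdiff_null_ae_eq_self (by simp))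

/-- The bump functions `x ↦ η (k x)` concentrate at the origin, and in dimension at least two their
gradients tend to zero in `L¹`. -/
lemma tendsto_integral_norm_fderiv_bump (hm : 2 ≤ m) (η : ContDiffBump (0 : Euc m)) (e : Euc m) :
    Tendsto (fun k : ℕ => ∫ x, ‖fderiv ℝ (fun y => η (((k : ℝ) + 1) • y)) x e‖) atTop (𝓝 0) := by
  have hη : ContDiff ℝ ∞ η := η.contDiff
  have h1 : ∀ k : ℕ, ∫ x, ‖fderiv ℝ (fun y => η (((k : ℝ) + 1) • y)) x e‖ =
      ((k : ℝ) + 1) * (((k : ℝ) + 1) ^ m)⁻¹ * ∫ x, ‖fderiv ℝ η x e‖ := fun k => by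
    have hk : (0 : ℝ) < (k : ℝ) + 1 := by positivity
    have h2 : ∀ x, ‖fderiv ℝ (fun y => η (((k : ℝ) + 1) • y)) x e‖ =
        ((k : ℝ) + 1) * ‖fderiv ℝ η (((k : ℝ) + 1) • x) e‖ := fun x => by
      rw [fderiv_comp_smul, smul_apply, norm_smul, Real.norm_of_nonneg hk.le]
    simp only [h2]
    rw [integral_const_mul,
      Measure.integral_comp_smul volume (fun x => ‖fderiv ℝ η x e‖) ((k : ℝ) + 1),
      finrank_euclideanSpace_fin, smul_eq_mul, abs_of_pos (by positivity), mul_assoc]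
  simp only [h1]
  -- Scaling multiplies the gradient by k+1 and the volume by (k+1)^(-m). The product is at most
  -- 1/(k+1) exactly because m ≥ 2.
  have h3 : Tendsto (fun k : ℕ => ((k : ℝ) + 1) * (((k : ℝ) + 1) ^ m)⁻¹) atTop (𝓝 0) := by
    have h4 := tendsto_one_div_add_atTop_nhds_zero_nat (𝕜 := ℝ)
    refine squeeze_zero (fun k => by positivity) (fun k => ?_) h4
    have hk : (1 : ℝ) ≤ (k : ℝ) + 1 := by
      have : (0 : ℝ) ≤ k := Nat.cast_nonneg k
      linarith
    have h5 : ((k : ℝ) + 1) ^ 2 ≤ ((k : ℝ) + 1) ^ m := pow_le_pow_right₀ hk hm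
    rw [← div_eq_mul_inv, div_le_div_iff₀ (by positivity) (by positivity)]
    nlinarith
  simpa using h3.mul_const (∫ x, ‖fderiv ℝ η x e‖)

/-- In dimension at least two, a point is removable for bounded weakly differentiable functions
whose derivative is integrable near the point. -/
lemma HasWeakDerivOn.of_diff_zero (hm : 2 ≤ m) {Ω : Set (Euc m)} (hΩ : IsOpen Ω) {F : Euc m → V}
    {g : Euc m → (Euc m →L[ℝ] V)} (h : HasWeakDerivOn (Ω \ {0}) F g) {M : ℝ}
    (hM : ∀ x ∈ Ω, ‖F x‖ ≤ M) (hg : LocallyIntegrableOn g Ω volume) : HasWeakDerivOn Ω F g := by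
  have hm1 : 1 ≤ m := by omega
  have hnt := nontrivial_euc hm1
  have mF : AEStronglyMeasurable F (volume.restrict Ω) := by
    rw [← restrict_diff_zero hm1]; exact h.locallyIntegrable.aestronglyMeasurable
  have lF : LocallyIntegrableOn F Ω volume := by
    refine (locallyIntegrableOn_iff hΩ.isLocallyClosed).2 fun k hk hkc => ?_
    refine (integrableOn_const (hs := hkc.measure_lt_top.ne) (C := M)).mono'
      (mF.mono_measure (Measure.restrict_mono_set _ hk)) ?_
    exact (ae_restrict_mem hkc.measurableSet).mono fun x hx => hM x (hk hx)
  refine ⟨lF, hg, fun φ hφ hc hs e => ?_⟩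
  let η : ContDiffBump (0 : Euc m) := ⟨1, 2, one_pos, one_lt_two⟩
  have hη : ContDiff ℝ ∞ η := η.contDiff
  set ηk : ℕ → Euc m → ℝ := fun k y => η (((k : ℝ) + 1) • y) with hηk
  have hηkd : ∀ k, ContDiff ℝ ∞ (ηk k) := fun k => hη.comp (contDiff_const_smul _)
  have hηk01 : ∀ k x, ‖1 - ηk k x‖ ≤ 1 := fun k x => by
    rw [Real.norm_eq_abs, abs_le]
    constructor <;> linarith [η.nonneg (x := ((k : ℝ) + 1) • x), η.le_one (x := ((k : ℝ) + 1) • x)]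
  have hηklim : ∀ x, x ≠ 0 → Tendsto (fun k => 1 - ηk k x) atTop (𝓝 1) := fun x hx => by
    have : ∀ᶠ k : ℕ in atTop, 1 - ηk k x = 1 := by
      have h1 : Tendsto (fun k : ℕ => ((k : ℝ) + 1) * ‖x‖) atTop atTop :=
        (tendsto_natCast_atTop_atTop.atTop_add tendsto_const_nhds).atTop_mul_const
          (norm_pos_iff.2 hx)
      filter_upwards [h1.eventually_ge_atTop 2] with k hk
      have : ηk k x = 0 := η.zero_of_le_dist (by
        rw [dist_zero_right, norm_smul, Real.norm_of_nonneg (by positivity)]; exact hk)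
      rw [this, sub_zero]
    exact tendsto_const_nhds.congr' (this.mono fun k hk => hk.symm)
  have hφ1 : Continuous fun x => fderiv ℝ φ x e :=
    (hφ.continuous_fderiv (by simp)).clm_apply continuous_const
  obtain ⟨C, hC⟩ := hc.exists_bound_of_continuous hφ.continuous
  have i1 := lF.integrable_smul_of_tsupport_subset hφ1
      (hc.fderiv_apply ℝ e) ((tsupport_fderiv_apply_subset_tsupport φ e).trans hs)
  have i2 : Integrable (fun x => φ x • g x e) volume :=
    LocallyIntegrableOn.integrable_smul_of_tsupport_subset
      ((ContinuousLinearMap.apply ℝ V e).locallyIntegrableOn_comp hg) hφ.continuous hc hs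
  have i3 := lF.integrable_smul_of_tsupport_subset hφ.continuous hc hs
  have hη1 : ∀ k, Continuous fun x => fderiv ℝ (ηk k) x e := fun k =>
    ((hηkd k).continuous_fderiv (by simp)).clm_apply continuous_const
  have hηc : ∀ k, HasCompactSupport (ηk k) := fun k =>
    η.hasCompactSupport.comp_smul (by positivity)
  -- The test function φ(1 - η_k) vanishes near the origin, so the hypothesis on `Ω \ {0}` applies
  -- to it. The only error term contains the gradient of η_k, which is small in L¹ while φF is
  -- bounded.
  have step : ∀ k, ∫ x, (1 - ηk k x) • fderiv ℝ φ x e • F x =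
      (- ∫ x, (1 - ηk k x) • φ x • g x e) + ∫ x, fderiv ℝ (ηk k) x e • φ x • F x := fun k => by
    have t1 : ContDiff ℝ ∞ fun x => φ x * (1 - ηk k x) := hφ.mul (contDiff_const.sub (hηkd k))
    have t2 : HasCompactSupport fun x => φ x * (1 - ηk k x) := hc.mul_right
    have t3 : tsupport (fun x => φ x * (1 - ηk k x)) ⊆ Ω \ {0} := by
      intro x hx
      refine ⟨hs (tsupport_mul_subset_left hx), fun h0 => ?_⟩
      rw [mem_singleton_iff] at h0
      subst h0
      rw [← notMem_compl_iff] at hx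
      apply hx
      rw [mem_compl_iff, notMem_tsupport_iff_eventuallyEq]
      have : ∀ᶠ x in 𝓝 (0 : Euc m), (((k : ℝ) + 1) • x) ∈ Metric.closedBall (0 : Euc m) 1 := by
        have hcont : Continuous fun x : Euc m => ((k : ℝ) + 1) • x := continuous_const_smul _
        refine hcont.continuousAt.eventually_mem ?_
        simpa using Metric.closedBall_mem_nhds (0 : Euc m) one_pos
      filter_upwards [this] with x hx
      have : ηk k x = 1 := η.one_of_mem_closedBall hx
      simp [this]
    have key := h.integral_eq _ t1 t2 t3 e
    have hd : ∀ x, fderiv ℝ (fun x => φ x * (1 - ηk k x)) x e • F x =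
        (1 - ηk k x) • fderiv ℝ φ x e • F x - fderiv ℝ (ηk k) x e • φ x • F x := fun x => by
      rw [fderiv_fun_mul (hφ.differentiable (by simp) x)
        ((contDiff_const.sub (hηkd k)).differentiable (by simp) x), fderiv_const_sub]
      simp only [add_apply, smul_apply, smul_eq_mul, add_smul, mul_smul, neg_apply, mul_neg,
        neg_smul]
      rw [smul_comm (φ x)]
      abel
    simp only [hd] at key
    obtain ⟨C', hC'⟩ := ((hηc k).fderiv_apply ℝ e).exists_bound_of_continuous (hη1 k)
    have j1 : Integrable (fun x => (1 - ηk k x) • fderiv ℝ φ x e • F x) volume :=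
      i1.bdd_smul 1 (continuous_const.sub (hηkd k).continuous).aestronglyMeasurable
        (Eventually.of_forall (hηk01 k))
    have j2 : Integrable (fun x => fderiv ℝ (ηk k) x e • φ x • F x) volume :=
      i3.bdd_smul C' (hη1 k).aestronglyMeasurable (Eventually.of_forall hC')
    rw [integral_sub j1 j2, sub_eq_iff_eq_add] at key
    rw [key]
    simp only [mul_comm (φ _), mul_smul]
  have lim1 : Tendsto (fun k => ∫ x, (1 - ηk k x) • fderiv ℝ φ x e • F x) atTop
      (𝓝 (∫ x, fderiv ℝ φ x e • F x)) := by
    refine tendsto_integral_of_dominated_convergence (fun x => ‖fderiv ℝ φ x e • F x‖)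
      (fun k => (continuous_const.sub (hηkd k).continuous).aestronglyMeasurable.smul
        i1.aestronglyMeasurable) i1.norm (fun k => Eventually.of_forall fun x => ?_) ?_
    · rw [norm_smul]
      exact mul_le_of_le_one_left (norm_nonneg _) (hηk01 k x)
    · filter_upwards [compl_mem_ae_iff.2 (measure_singleton (0 : Euc m))] with x hx
      simpa using (hηklim x hx).smul_const (fderiv ℝ φ x e • F x)
  have lim2 : Tendsto (fun k => ∫ x, (1 - ηk k x) • φ x • g x e) atTop
      (𝓝 (∫ x, φ x • g x e)) := by
    refine tendsto_integral_of_dominated_convergence (fun x => ‖φ x • g x e‖)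
      (fun k => (continuous_const.sub (hηkd k).continuous).aestronglyMeasurable.smul
        i2.aestronglyMeasurable) i2.norm (fun k => Eventually.of_forall fun x => ?_) ?_
    · rw [norm_smul]
      exact mul_le_of_le_one_left (norm_nonneg _) (hηk01 k x)
    · filter_upwards [compl_mem_ae_iff.2 (measure_singleton (0 : Euc m))] with x hx
      simpa using (hηklim x hx).smul_const (φ x • g x e)
  have lim3 : Tendsto (fun k => ∫ x, fderiv ℝ (ηk k) x e • φ x • F x) atTop (𝓝 0) := by
    have := (tendsto_integral_norm_fderiv_bump hm η e).mul_const (|C| * |M|)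
    rw [zero_mul] at this
    refine squeeze_zero_norm (fun k => ?_) this
    rw [← integral_mul_const]
    refine norm_integral_le_of_norm_le ?_ (Eventually.of_forall fun x => ?_)
    · exact (((hη1 k).integrable_of_hasCompactSupport
        ((hηc k).fderiv_apply ℝ e)).norm.mul_const _)
    · rw [norm_smul]
      refine mul_le_mul_of_nonneg_left ?_ (norm_nonneg _)
      by_cases hx : x ∈ tsupport φ
      · rw [norm_smul]
        exact mul_le_mul ((hC x).trans (le_abs_self _)) ((hM x (hs hx)).trans (le_abs_self _))
          (norm_nonneg _) (abs_nonneg _)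
      · rw [image_eq_zero_of_notMem_tsupport hx, zero_smul, norm_zero]; positivity
  have lim4 := lim2.neg.add lim3
  rw [add_zero] at lim4
  exact tendsto_nhds_unique lim1 (lim4.congr fun k => (step k).symm)

end RemovableSingularity

/-! ### Maps with local retractions, and transfer of test functions and weak derivatives along them.
-/

section LocalRetraction

/-- `Φ : M → E` has local `C^k` retractions: near every point of its image there is a `C^k` left
inverse. -/
def HasLocalRetractions {E : Type*} [NormedAddCommGroup E] [NormedSpace ℝ E]
    {EM : Type*} [NormedAddCommGroup EM] [NormedSpace ℝ EM] {H : Type*} [TopologicalSpace H]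
    (I : ModelWithCorners ℝ EM H) {M : Type*} [TopologicalSpace M] [ChartedSpace H M]
    (k : WithTop ℕ∞) (Φ : M → E) : Prop :=
  ∀ p : M, ∃ (O : Set E) (R : E → M), IsOpen O ∧ Φ p ∈ O ∧ ContMDiffOn 𝓘(ℝ, E) I k R O ∧
    ∀ q, Φ q ∈ O → R (Φ q) = q

variable {E : Type*} [NormedAddCommGroup E] [NormedSpace ℝ E]
  {EM : Type*} [NormedAddCommGroup EM] [NormedSpace ℝ EM] {H : Type*} [TopologicalSpace H]
  {I : ModelWithCorners ℝ EM H} {M : Type*} [TopologicalSpace M] [ChartedSpace H M]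
  {k : WithTop ℕ∞} {Φ : M → E}

/-- The open set U_p ∩ R_p⁻¹(O) contains no point of the image of `Φ` other than points of Φ(O), and
such sets cover Φ(O). So the topology of `M` is induced by `Φ`, which lets measurability be tested
after composition with `Φ`. -/
lemma HasLocalRetractions.exists_isOpen_preimage_eq (h : HasLocalRetractions I k Φ) {O : Set M}
    (hO : IsOpen O) : ∃ O' : Set E, IsOpen O' ∧ Φ ⁻¹' O' = O := by
  choose U R hU hpU hR hRΦ using h
  refine ⟨⋃ p ∈ O, U p ∩ R p ⁻¹' O,
    isOpen_biUnion fun p _ => (hR p).continuousOn.isOpen_inter_preimage (hU p) hO, ?_⟩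
  ext q
  simp only [mem_preimage, mem_iUnion, mem_inter_iff, exists_prop]
  constructor
  · rintro ⟨p, -, h1, h2⟩
    rwa [hRΦ p q h1] at h2
  · exact fun hq => ⟨q, hq, hpU q, by rwa [hRΦ q q (hpU q)]⟩

/-- A compactly supported `C¹` function on `M` extends along `Φ` to a compactly supported `C¹`
function. -/
lemma HasLocalRetractions.exists_extension [FiniteDimensional ℝ E]
    (h : HasLocalRetractions I 1 Φ) (hΦ : Continuous Φ) {f : M → ℝ}
    (hf : ContMDiff I 𝓘(ℝ, ℝ) 1 f) (hfc : HasCompactSupport f) :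
    ∃ F : E → ℝ, ContDiff ℝ 1 F ∧ HasCompactSupport F ∧ ∀ p, F (Φ p) = f p := by
  have hK : IsCompact (Φ '' tsupport f) := hfc.isCompact.image hΦ
  -- Prescribing the values on the image of `Φ` is a convex condition, so local solutions glue by a
  -- partition of unity. Near Φ(supp f) a local solution is f ∘ R; off this compact set it is 0.
  obtain ⟨F, hF⟩ := exists_contMDiffMap_forall_mem_convex_of_local 𝓘(ℝ, E) (n := 1)
    (t := fun a => {s : ℝ | ∀ p, Φ p = a → s = f p}) (fun a => by
      intro s hs s' hs' α β hα hβ hαβ p hp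
      rw [hs p hp, hs' p hp, smul_eq_mul, smul_eq_mul, ← add_mul, hαβ, one_mul]) (fun a => by
      by_cases ha : a ∈ Φ '' tsupport f
      · obtain ⟨p, -, rfl⟩ := ha
        obtain ⟨O, R, hO, hpO, hR, hRΦ⟩ := h p
        refine ⟨O, hO.mem_nhds hpO, f ∘ R, hf.comp_contMDiffOn hR, ?_⟩
        rintro _ hb q rfl
        simp [hRΦ q hb]
      · refine ⟨_, hK.isClosed.isOpen_compl.mem_nhds ha, fun _ => 0, contMDiffOn_const, ?_⟩
        rintro _ hb q rfl
        refine (image_eq_zero_of_notMem_tsupport fun hq => hb ⟨q, hq, rfl⟩).symm)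
  -- The glued function need not have compact support; the cutoff restores it without changing the
  -- values on Φ(supp f).
  obtain ⟨χ, hχ, hχc, -, hχ1⟩ := exists_contDiff_cutoff hK isOpen_univ (subset_univ _)
  refine ⟨fun a => χ a * F a, (hχ.of_le (by simp)).mul F.contMDiff.contDiff, hχc.mul_right,
    fun p => ?_⟩
  simp only [hF (Φ p) p rfl]
  by_cases hp : p ∈ tsupport f
  · rw [(hχ1 _ ⟨p, hp, rfl⟩).self_of_nhds, Pi.one_apply, one_mul]
  · rw [image_eq_zero_of_notMem_tsupport hp, mul_zero]

/-- A map is measurable if its composition with `Φ` is. -/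
lemma HasLocalRetractions.lebesgueMeasurableOn {m : ℕ} (h : HasLocalRetractions I k Φ)
    {Ω : Set (Euc m)} (hΩ : MeasurableSet Ω) {q : Euc m → M} {w : Euc m → E}
    (hw : AEStronglyMeasurable w (volume.restrict Ω))
    (hwq : ∀ᵐ x ∂volume.restrict Ω, w x = Φ (q x)) : LebesgueMeasurableOn Ω q := by
  intro O hO
  obtain ⟨O', hO', rfl⟩ := h.exists_isOpen_preimage_eq hO
  borelize E
  obtain ⟨w', hw', hww'⟩ := hw
  have h1 : NullMeasurableSet (w' ⁻¹' O') (volume.restrict Ω) :=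
    (hw'.measurable hO'.measurableSet).nullMeasurableSet
  have h2 : NullMeasurableSet (q ⁻¹' (Φ ⁻¹' O')) (volume.restrict Ω) := by
    refine h1.congr ?_
    filter_upwards [hww', hwq] with x h1 h2
    have : (x ∈ w' ⁻¹' O') = (x ∈ q ⁻¹' (Φ ⁻¹' O')) := by
      rw [mem_preimage, mem_preimage, mem_preimage, ← h1, h2]
    exact this
  have := (nullMeasurableSet_restrict hΩ.nullMeasurableSet).1 h2
  rwa [inter_comm] at this

/-- The chain rule for functions on a manifold with local retractions in a vector space. -/
lemma HasLocalRetractions.hasWeakDerivOn_comp [FiniteDimensional ℝ E] {m : ℕ}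
    [CompleteSpace E] (h : HasLocalRetractions I 1 Φ) (hΦ : ContMDiff I 𝓘(ℝ, E) 1 Φ)
    {Ω : Set (Euc m)} (hΩ : IsOpen Ω)
    {q : Euc m → M} {w : Euc m → E} {W : Euc m → (Euc m →L[ℝ] E)} (hw : HasWeakDerivOn Ω w W)
    {Q : ∀ x, Euc m →L[ℝ] TangentSpace I (q x)}
    (hq : ∀ᵐ x ∂volume.restrict Ω, w x = Φ (q x))
    (hQ : ∀ᵐ x ∂volume.restrict Ω,
      W x = (mfderiv I 𝓘(ℝ, E) Φ (q x) : TangentSpace I (q x) →L[ℝ] E) ∘L Q x)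
    {f : M → ℝ} (hf : ContMDiff I 𝓘(ℝ, ℝ) 1 f) (hfc : HasCompactSupport f) :
    HasWeakDerivOn Ω (f ∘ q)
      (fun x => (mfderiv I 𝓘(ℝ, ℝ) f (q x) : TangentSpace I (q x) →L[ℝ] ℝ) ∘L Q x) := by
  obtain ⟨F, hF, hFc, hFΦ⟩ := h.exists_extension hΦ.continuous hf hfc
  refine (hw.comp_contDiff hΩ hF hFc).congr_ae hΩ.measurableSet ?_ ?_
  · filter_upwards [hq] with x hx
    rw [hx, hFΦ, Function.comp_apply]
  · filter_upwards [hq, hQ] with x hx hx'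
    have h1 : f = F ∘ Φ := funext fun p => (hFΦ p).symm
    have h2 : mfderiv I 𝓘(ℝ, ℝ) f (q x) =
        (mfderiv 𝓘(ℝ, E) 𝓘(ℝ, ℝ) F (Φ (q x))) ∘L (mfderiv I 𝓘(ℝ, E) Φ (q x)) := by
      rw [h1]
      exact mfderiv_comp _ (hF.contMDiff.mdifferentiable (by simp) _)
        (hΦ.mdifferentiable (by simp) _)
    rw [h2, mfderiv_eq_fderiv, hx, hx']
    rfl

end LocalRetraction

/-! ### Coordinates on the bundle of linear maps into TN. -/

section Coordinates

variable {m n : ℕ} {N : Type*} [TopologicalSpace N] [ChartedSpace (Euc n) N]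
  [IsManifold (𝓡 n) 2 N]

lemma inCoordinates_hom_tangent (y y' : N) (hy : y' ∈ (chartAt (Euc n) y).source)
    (ξ : Euc m →L[ℝ] TangentSpace (𝓡 n) y') :
    ContinuousLinearMap.inCoordinates (Euc m) (fun y : N => Bundle.Trivial N (Euc m) y) (Euc n)
      (fun y : N => TangentSpace (𝓡 n) y) y y' y y' ξ =
    (mfderiv (𝓡 n) (𝓡 n) (extChartAt (𝓡 n) y) y') ∘L ξ := by
  rw [ContinuousLinearMap.inCoordinates, TangentBundle.continuousLinearMapAt_trivializationAt hy]
  ext v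
  simp
  rfl

/-- The bundle chart pairs the base chart with the trivialization, and the trivialization of TN is
the differential of the base chart. The coordinate computations on T*Ω ⊗ TN rest on this formula. -/
lemma extChartAt_hom (p : Euc m × HomTangent m n N) (q : Euc m × HomTangent m n N)
    (hy : q.2.1 ∈ (chartAt (Euc n) p.2.1).source) :
    extChartAt (homModel m n) p q = (q.1, extChartAt (𝓡 n) p.2.1 q.2.1,
      (mfderiv (𝓡 n) (𝓡 n) (extChartAt (𝓡 n) p.2.1) q.2.1) ∘L q.2.2) := by
  rw [← inCoordinates_hom_tangent p.2.1 q.2.1 hy q.2.2]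
  rw [extChartAt_prod]
  simp [extChartAt, hom_chart]
  rfl

variable {E' : Type*} [NormedAddCommGroup E'] [NormedSpace ℝ E']

lemma ContinuousAt.eventually_mem_chartAt_source {b : E' → N} {x₀ : E'}
    (hb : ContinuousAt b x₀) : ∀ᶠ x in 𝓝 x₀, b x ∈ (chartAt (Euc n) (b x₀)).source :=
  hb.eventually_mem ((chartAt (Euc n) (b x₀)).open_source.mem_nhds (mem_chart_source _ _))

lemma contMDiffAt_homTangent_mk {b : E' → N} {x₀ : E'}
    {ξ : ∀ x, Euc m →L[ℝ] TangentSpace (𝓡 n) (b x)}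
    (hb : ContMDiffAt 𝓘(ℝ, E') (𝓡 n) 1 b x₀)
    {ζ : E' → (Euc m →L[ℝ] Euc n)} (hζ : ContDiffAt ℝ 1 ζ x₀)
    (hξ : ∀ᶠ x in 𝓝 x₀, (mfderiv (𝓡 n) (𝓡 n) (extChartAt (𝓡 n) (b x₀)) (b x)) ∘L ξ x = ζ x) :
    ContMDiffAt 𝓘(ℝ, E') ((𝓡 n).prod 𝓘(ℝ, Euc m →L[ℝ] Euc n)) 1
      (fun x => (⟨b x, ξ x⟩ : HomTangent m n N)) x₀ := by
  rw [contMDiffAt_hom_bundle]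
  refine ⟨hb, hζ.contMDiffAt.congr_of_eventuallyEq ?_⟩
  filter_upwards [hξ, ContinuousAt.eventually_mem_chartAt_source (n := n) hb.continuousAt] with x hx hx'
  rw [← hx]
  exact inCoordinates_hom_tangent _ _ hx' _

lemma mfderiv_extChartAt_comp_mfderiv {b : E' → N} {x₀ x : E'}
    (hb : MDifferentiableAt 𝓘(ℝ, E') (𝓡 n) b x) (hx : b x ∈ (chartAt (Euc n) (b x₀)).source) :
    (mfderiv (𝓡 n) (𝓡 n) (extChartAt (𝓡 n) (b x₀)) (b x)) ∘L
      (mfderiv 𝓘(ℝ, E') (𝓡 n) b x : E' →L[ℝ] TangentSpace (𝓡 n) (b x)) =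
    fderiv ℝ (fun x => extChartAt (𝓡 n) (b x₀) (b x)) x := by
  rw [← mfderiv_eq_fderiv]
  exact (mfderiv_comp (I' := 𝓡 n) x (mdifferentiableAt_extChartAt hx) hb).symm

lemma ContMDiffAt.contDiffAt_extChartAt {k : WithTop ℕ∞} [IsManifold (𝓡 n) k N] {b : E' → N}
    {x₀ : E'} (hb : ContMDiffAt 𝓘(ℝ, E') (𝓡 n) k b x₀) :
    ContDiffAt ℝ k (fun x => extChartAt (𝓡 n) (b x₀) (b x)) x₀ :=
  ((contMDiffAt_extChartAt (I := 𝓡 n) (x := b x₀)).comp x₀ hb).contDiffAt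

/-- The derivative of a `C²` map composed with a `C¹` family of linear maps. -/
lemma ContMDiffAt.contMDiffAt_mfderiv_comp {b : E' → N} {x₀ : E'} {ξ₀ : Euc m →L[ℝ] E'}
    (hb : ContMDiffAt 𝓘(ℝ, E') (𝓡 n) 2 b x₀) :
    ContMDiffAt 𝓘(ℝ, E' × (Euc m →L[ℝ] E')) ((𝓡 n).prod 𝓘(ℝ, Euc m →L[ℝ] Euc n)) 1
      (fun q : E' × (Euc m →L[ℝ] E') => (⟨b q.1, (mfderiv 𝓘(ℝ, E') (𝓡 n) b q.1 :
        E' →L[ℝ] TangentSpace (𝓡 n) (b q.1)) ∘L q.2⟩ : HomTangent m n N)) (x₀, ξ₀) := by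
  have h1 : ContDiffAt ℝ 1 (fderiv ℝ (fun x => extChartAt (𝓡 n) (b x₀) (b x))) x₀ :=
    hb.contDiffAt_extChartAt.fderiv_right (m := 1) (by norm_num)
  have h2 : ContDiffAt ℝ 1 (fun q : E' × (Euc m →L[ℝ] E') =>
      fderiv ℝ (fun x => extChartAt (𝓡 n) (b x₀) (b x)) q.1 ∘L q.2) (x₀, ξ₀) :=
    (ContDiffAt.comp (x₀, ξ₀) (g := fderiv ℝ (fun x => extChartAt (𝓡 n) (b x₀) (b x)))
      h1 contDiffAt_fst).clm_comp contDiffAt_snd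
  have hb1 : ContMDiffAt 𝓘(ℝ, E' × (Euc m →L[ℝ] E')) (𝓡 n) 1
      (fun q : E' × (Euc m →L[ℝ] E') => b q.1) (x₀, ξ₀) :=
    (hb.of_le (by norm_num)).comp (x₀, ξ₀) contDiffAt_fst.contMDiffAt
  refine contMDiffAt_homTangent_mk hb1 h2 ?_
  have h3 : ∀ᶠ x in 𝓝 x₀, MDifferentiableAt 𝓘(ℝ, E') (𝓡 n) b x := by
    have h := (contMDiffAt_iff_contMDiffAt_nhds (n := 1) (by simp)).1 (hb.of_le (by norm_num))
    exact h.mono fun x hx => ContMDiffAt.mdifferentiableAt hx (by simp)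
  have h4 : Tendsto (fun q : E' × (Euc m →L[ℝ] E') => q.1) (𝓝 (x₀, ξ₀)) (𝓝 x₀) :=
    continuous_fst.tendsto' _ _ rfl
  filter_upwards [h4.eventually h3,
    h4.eventually (ContinuousAt.eventually_mem_chartAt_source (n := n) hb.continuousAt)] with q h5 h6
  exact congrArg (fun A : E' →L[ℝ] Euc n => A ∘L q.2) (mfderiv_extChartAt_comp_mfderiv h5 h6)

/-- The map `(x, y, ξ) ↦ (x, ι y, dι_y ∘ ξ)`. -/
noncomputable def homPush {ν : ℕ} (ι : N → Euc ν) (q : Euc m × HomTangent m n N) :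
    Euc m × Euc ν × (Euc m →L[ℝ] Euc ν) :=
  (q.1, ι q.2.1, (mfderiv (𝓡 n) (𝓡 ν) ι q.2.1 : TangentSpace (𝓡 n) q.2.1 →L[ℝ] Euc ν) ∘L q.2.2)

variable {ν : ℕ} {ι : N → Euc ν}

/-- The expression of `ι` in the preferred chart at `y`. -/
noncomputable def readInChart (n : ℕ) {N : Type*} [TopologicalSpace N] [ChartedSpace (Euc n) N]
    {F : Type*} (ι : N → F) (y : N) : Euc n → F :=
  fun z => ι ((extChartAt (𝓡 n) y).symm z)

lemma ContMDiff.contDiffOn_readInChart {F : Type*} [NormedAddCommGroup F] [NormedSpace ℝ F]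
    {ι : N → F} {k : WithTop ℕ∞} [IsManifold (𝓡 n) k N]
    (hι : ContMDiff (𝓡 n) 𝓘(ℝ, F) k ι) (y : N) :
    ContDiffOn ℝ k (readInChart n ι y) (extChartAt (𝓡 n) y).target :=
  (hι.comp_contMDiffOn (contMDiffOn_extChartAt_symm y)).contDiffOn

lemma ContMDiff.mfderiv_eq_fderiv_readInChart_comp {F : Type*} [NormedAddCommGroup F]
    [NormedSpace ℝ F] {ι : N → F} (hι : ContMDiff (𝓡 n) 𝓘(ℝ, F) 1 ι) {y y' : N}
    (hy : y' ∈ (chartAt (Euc n) y).source) :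
    (mfderiv (𝓡 n) 𝓘(ℝ, F) ι y' : TangentSpace (𝓡 n) y' →L[ℝ] F) =
      (fderiv ℝ (readInChart n ι y) (extChartAt (𝓡 n) y y')) ∘L
        (mfderiv (𝓡 n) (𝓡 n) (extChartAt (𝓡 n) y) y' : TangentSpace (𝓡 n) y' →L[ℝ] Euc n) := by
  have hy' : y' ∈ (extChartAt (𝓡 n) y).source := by rwa [extChartAt_source]
  have h1 : ι =ᶠ[𝓝 y'] (readInChart n ι y) ∘ (extChartAt (𝓡 n) y) := by
    filter_upwards [(isOpen_extChartAt_source (I := 𝓡 n) y).mem_nhds hy'] with z hz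
    simp only [readInChart, Function.comp_apply]
    rw [(extChartAt (𝓡 n) y).left_inv hz]
  have h2 : DifferentiableAt ℝ (readInChart n ι y) (extChartAt (𝓡 n) y y') :=
    ((hι.contDiffOn_readInChart y).contDiffAt ((isOpen_extChartAt_target y).mem_nhds
      ((extChartAt (𝓡 n) y).map_source hy'))).differentiableAt (by norm_num)
  rw [h1.mfderiv_eq, ← mfderiv_eq_fderiv]
  exact mfderiv_comp y' h2.mdifferentiableAt (mdifferentiableAt_extChartAt hy)

lemma mfderiv_eq_fderiv_readInChart_comp (hι : ContMDiff (𝓡 n) (𝓡 ν) 2 ι) {y y' : N}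
    (hy : y' ∈ (chartAt (Euc n) y).source) :
    (mfderiv (𝓡 n) (𝓡 ν) ι y' : TangentSpace (𝓡 n) y' →L[ℝ] Euc ν) =
      (fderiv ℝ (readInChart n ι y) (extChartAt (𝓡 n) y y')) ∘L
        (mfderiv (𝓡 n) (𝓡 n) (extChartAt (𝓡 n) y) y' : TangentSpace (𝓡 n) y' →L[ℝ] Euc n) :=
  (hι.of_le (by norm_num)).mfderiv_eq_fderiv_readInChart_comp hy

lemma homPush_eventuallyEq (hι : ContMDiff (𝓡 n) (𝓡 ν) 2 ι) (p : Euc m × HomTangent m n N) :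
    homPush ι =ᶠ[𝓝 p] (fun c : Euc m × Euc n × (Euc m →L[ℝ] Euc n) =>
      (c.1, readInChart n ι p.2.1 c.2.1, fderiv ℝ (readInChart n ι p.2.1) c.2.1 ∘L c.2.2)) ∘
      extChartAt (homModel m n) p := by
  have h1 : ∀ᶠ q : Euc m × HomTangent m n N in 𝓝 p, q.2.1 ∈ (chartAt (Euc n) p.2.1).source := by
    have : Continuous fun q : Euc m × HomTangent m n N => q.2.1 :=
      (FiberBundle.continuous_proj (Euc m →L[ℝ] Euc n)
        (fun y : N => Bundle.Trivial N (Euc m) y →L[ℝ] TangentSpace (𝓡 n) y)).comp continuous_snd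
    exact this.continuousAt.eventually_mem
      ((chartAt (Euc n) p.2.1).open_source.mem_nhds (mem_chart_source _ _))
  filter_upwards [h1] with q hq
  have hq' : q.2.1 ∈ (extChartAt (𝓡 n) p.2.1).source := by rwa [extChartAt_source]
  rw [Function.comp_apply, extChartAt_hom p q hq, homPush]
  refine Prod.ext rfl (Prod.ext ?_ ?_)
  · simp only [readInChart]
    rw [(extChartAt (𝓡 n) p.2.1).left_inv hq']
  · simp only
    rw [mfderiv_eq_fderiv_readInChart_comp hι hq]
    rfl

lemma extChartAt_hom_self (p : Euc m × HomTangent m n N) :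
    extChartAt (homModel m n) p p =
      (p.1, extChartAt (𝓡 n) p.2.1 p.2.1, (p.2.2 : Euc m →L[ℝ] Euc n)) := by
  rw [extChartAt_hom p p (mem_chart_source _ _), mfderiv_extChartAt_self]
  rfl

/-- The coordinate expression of `homPush` is `C¹` and has the expected derivative. -/
lemma hasFDerivAt_coord_homPush {ψ : Euc n → Euc ν} {z : Euc n} (hψ : ContDiffAt ℝ 2 ψ z)
    (x : Euc m) (ζ : Euc m →L[ℝ] Euc n) :
    ContDiffAt ℝ 1 (fun c : Euc m × Euc n × (Euc m →L[ℝ] Euc n) =>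
      (c.1, ψ c.2.1, fderiv ℝ ψ c.2.1 ∘L c.2.2)) (x, z, ζ) ∧
    ∀ (a : Euc m) (b : Euc n) (η : Euc m →L[ℝ] Euc n),
      fderiv ℝ (fun c : Euc m × Euc n × (Euc m →L[ℝ] Euc n) =>
        (c.1, ψ c.2.1, fderiv ℝ ψ c.2.1 ∘L c.2.2)) (x, z, ζ) (a, b, η) =
      (a, fderiv ℝ ψ z b, (fderiv ℝ (fderiv ℝ ψ) z b) ∘L ζ + fderiv ℝ ψ z ∘L η) := by
  have h1 : ContDiffAt ℝ 1 (fderiv ℝ ψ) z := hψ.fderiv_right (m := 1) (by norm_num)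
  have p1 : HasFDerivAt (fun c : Euc m × Euc n × (Euc m →L[ℝ] Euc n) => c.2.1)
      ((ContinuousLinearMap.fst ℝ _ _) ∘L (ContinuousLinearMap.snd ℝ _ _)) (x, z, ζ) :=
    hasFDerivAt_fst.comp (x, z, ζ) hasFDerivAt_snd
  have p2 : HasFDerivAt (fun c : Euc m × Euc n × (Euc m →L[ℝ] Euc n) => c.2.2)
      ((ContinuousLinearMap.snd ℝ _ _) ∘L (ContinuousLinearMap.snd ℝ _ _)) (x, z, ζ) :=
    hasFDerivAt_snd.comp (x, z, ζ) hasFDerivAt_snd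
  have c1 : ContDiffAt ℝ 1 (fun c : Euc m × Euc n × (Euc m →L[ℝ] Euc n) => c.2.1) (x, z, ζ) :=
    contDiffAt_fst.comp _ contDiffAt_snd
  have c2 : ContDiffAt ℝ 1 (fun c : Euc m × Euc n × (Euc m →L[ℝ] Euc n) => c.2.2) (x, z, ζ) :=
    contDiffAt_snd.comp _ contDiffAt_snd
  have d1 : HasFDerivAt (fun c : Euc m × Euc n × (Euc m →L[ℝ] Euc n) => ψ c.2.1) _ (x, z, ζ) :=
    (hψ.differentiableAt (by norm_num)).hasFDerivAt.comp (x, z, ζ) p1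
  have d2 : HasFDerivAt (fun c : Euc m × Euc n × (Euc m →L[ℝ] Euc n) => fderiv ℝ ψ c.2.1) _
      (x, z, ζ) := (h1.differentiableAt (by simp)).hasFDerivAt.comp (x, z, ζ) p1
  refine ⟨?_, fun a b η => ?_⟩
  · refine contDiffAt_fst.prodMk (ContDiffAt.prodMk ?_ (ContDiffAt.clm_comp ?_ c2))
    · exact ContDiffAt.comp (x, z, ζ) (g := ψ) (hψ.of_le (by norm_num)) c1
    · exact ContDiffAt.comp (x, z, ζ) (g := fderiv ℝ ψ) h1 c1
  · rw [(hasFDerivAt_fst.prodMk (d1.prodMk (d2.clm_comp p2))).fderiv]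
    exact Prod.ext rfl (Prod.ext rfl (add_comm _ _))

lemma contMDiff_homPush (hι : ContMDiff (𝓡 n) (𝓡 ν) 2 ι) :
    ContMDiff (homModel m n) 𝓘(ℝ, Euc m × Euc ν × (Euc m →L[ℝ] Euc ν)) 1
      (homPush (m := m) (n := n) ι) := fun p => by
  refine ContMDiffAt.congr_of_eventuallyEq ?_ (homPush_eventuallyEq hι p)
  have h0 : ContDiffAt ℝ 2 (readInChart n ι p.2.1) (extChartAt (𝓡 n) p.2.1 p.2.1) :=
    (hι.contDiffOn_readInChart p.2.1).contDiffAt (extChartAt_target_mem_nhds _)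
  have h1 := (hasFDerivAt_coord_homPush h0 p.1 (p.2.2 : Euc m →L[ℝ] Euc n)).1
  have h2 := extChartAt_hom_self p
  refine ContMDiffAt.comp p ?_ (contMDiffAt_extChartAt (I := homModel m n))
  rw [h2]
  exact h1.contMDiffAt

/-- At its own base point the preferred chart has the identity as differential, so only the
coordinate expression is differentiated. The second derivative of ι enters through the product rule
for dι ∘ ξ. -/
lemma mfderiv_homPush (hι : ContMDiff (𝓡 n) (𝓡 ν) 2 ι) (p : Euc m × HomTangent m n N)
    (a : Euc m) (b : Euc n) (η : Euc m →L[ℝ] Euc n) :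
    (mfderiv (homModel m n) 𝓘(ℝ, Euc m × Euc ν × (Euc m →L[ℝ] Euc ν)) (homPush (m := m) (n := n) ι) p :
      (Euc m × Euc n × (Euc m →L[ℝ] Euc n)) →L[ℝ] (Euc m × Euc ν × (Euc m →L[ℝ] Euc ν)))
      (a, b, η) =
    (a, fderiv ℝ (readInChart n ι p.2.1) (extChartAt (𝓡 n) p.2.1 p.2.1) b,
      (fderiv ℝ (fderiv ℝ (readInChart n ι p.2.1)) (extChartAt (𝓡 n) p.2.1 p.2.1) b) ∘L
        (p.2.2 : Euc m →L[ℝ] Euc n) +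
      fderiv ℝ (readInChart n ι p.2.1) (extChartAt (𝓡 n) p.2.1 p.2.1) ∘L η) := by
  have h0 : ContDiffAt ℝ 2 (readInChart n ι p.2.1) (extChartAt (𝓡 n) p.2.1 p.2.1) :=
    (hι.contDiffOn_readInChart p.2.1).contDiffAt (extChartAt_target_mem_nhds _)
  have h1 := hasFDerivAt_coord_homPush h0 p.1 (p.2.2 : Euc m →L[ℝ] Euc n)
  have h3 := extChartAt_hom_self p
  have h2 : DifferentiableAt ℝ (fun c : Euc m × Euc n × (Euc m →L[ℝ] Euc n) =>
      (c.1, readInChart n ι p.2.1 c.2.1, fderiv ℝ (readInChart n ι p.2.1) c.2.1 ∘L c.2.2))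
      (extChartAt (homModel m n) p p) := by
    rw [h3]; exact h1.1.differentiableAt (by simp)
  rw [(homPush_eventuallyEq hι p).mfderiv_eq, ← h1.2 a b η]
  rw [mfderiv_comp p h2.mdifferentiableAt
    (mdifferentiableAt_extChartAt (I := homModel m n) (mem_chart_source _ _)),
    mfderiv_extChartAt_self, mfderiv_eq_fderiv, h3]
  rfl

end Coordinates

/-! ### Christoffel symbols of the first kind. -/

noncomputable instance instNormedAddCommGroupBilin {n : ℕ} :
    NormedAddCommGroup (Euc n →L[ℝ] Euc n →L[ℝ] ℝ) :=
  ContinuousLinearMap.toNormedAddCommGroup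

noncomputable instance instNormedSpaceBilin {n : ℕ} : NormedSpace ℝ (Euc n →L[ℝ] Euc n →L[ℝ] ℝ) :=
  ContinuousLinearMap.toNormedSpace

section Christoffel

variable {n : ℕ} (g : Euc n → (Euc n →L[ℝ] Euc n →L[ℝ] ℝ)) (z v w : Euc n)

/-- The Christoffel symbols of the first kind as a linear form in the last argument. -/
noncomputable def christoffelFirstForm : Euc n →ₗ[ℝ] ℝ where
  toFun k := christoffelFirst g z v w k
  map_add' k k' := by
    have h := congrArg (fun A : Euc n →L[ℝ] Euc n →L[ℝ] ℝ => A v w)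
      (ContinuousLinearMap.map_add (fderiv ℝ g z) k k')
    have h' : fderiv ℝ g z (k + k') v w = fderiv ℝ g z k v w + fderiv ℝ g z k' v w := h
    rw [christoffelFirst, christoffelFirst, christoffelFirst, h',
      ContinuousLinearMap.map_add, ContinuousLinearMap.map_add]
    ring
  map_smul' c k := by
    have h := congrArg (fun A : Euc n →L[ℝ] Euc n →L[ℝ] ℝ => A v w)
      (ContinuousLinearMap.map_smul (fderiv ℝ g z) c k)
    have h' : fderiv ℝ g z (c • k) v w = c * fderiv ℝ g z k v w := h
    rw [christoffelFirst, christoffelFirst, h',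
      ContinuousLinearMap.map_smul, ContinuousLinearMap.map_smul, smul_eq_mul, smul_eq_mul,
      smul_eq_mul, RingHom.id_apply]
    ring

/-- Two of the three terms cancel. The factor 1/2 is what makes the speed of a geodesic constant. -/
lemma christoffelFirst_self : christoffelFirst g z v v v = fderiv ℝ g z v v v / 2 := by
  rw [christoffelFirst]; ring

end Christoffel

/-! ### The metric in charts, the Gauss formula and the speed of geodesics. -/

section Metric

variable {n : ℕ} {N : Type*} [TopologicalSpace N] [ChartedSpace (Euc n) N]
  [IsManifold (𝓡 n) 2 N]
variable {E' : Type*} [NormedAddCommGroup E'] [NormedSpace ℝ E']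

lemma contMDiffAt_tangent_mk {k : WithTop ℕ∞} {b : E' → N} {x₀ : E'}
    {ξ : ∀ x, TangentSpace (𝓡 n) (b x)}
    (hb : ContMDiffAt 𝓘(ℝ, E') (𝓡 n) k b x₀)
    {ζ : E' → Euc n} (hζ : ContDiffAt ℝ k ζ x₀)
    (hξ : ∀ᶠ x in 𝓝 x₀, (mfderiv (𝓡 n) (𝓡 n) (extChartAt (𝓡 n) (b x₀)) (b x)) (ξ x) = ζ x) :
    ContMDiffAt 𝓘(ℝ, E') ((𝓡 n).prod 𝓘(ℝ, Euc n)) k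
      (fun x => (⟨b x, ξ x⟩ : TangentBundle (𝓡 n) N)) x₀ := by
  rw [contMDiffAt_totalSpace]
  refine ⟨hb, hζ.contMDiffAt.congr_of_eventuallyEq ?_⟩
  filter_upwards [hξ, ContinuousAt.eventually_mem_chartAt_source (n := n) hb.continuousAt]
    with x hx hx'
  have h1 := congrArg (fun A : TangentSpace (𝓡 n) (b x) →L[ℝ] Euc n => A (ξ x))
    (TangentBundle.continuousLinearMapAt_trivializationAt (I := 𝓡 n) hx')
  simp only [Trivialization.continuousLinearMapAt_apply] at h1
  rw [Trivialization.linearMapAt_apply] at h1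
  have h2 : b x ∈ (trivializationAt (Euc n) (TangentSpace (𝓡 n)) (b x₀)).baseSet := hx'
  exact ((if_pos h2).symm.trans h1).trans hx

lemma ContMDiffAt.contMDiffAt_mfderiv_apply {b : E' → N} {x₀ : E'} (v : E')
    (hb : ContMDiffAt 𝓘(ℝ, E') (𝓡 n) 2 b x₀) :
    ContMDiffAt 𝓘(ℝ, E') ((𝓡 n).prod 𝓘(ℝ, Euc n)) 1
      (fun x => (⟨b x, mfderiv 𝓘(ℝ, E') (𝓡 n) b x v⟩ : TangentBundle (𝓡 n) N)) x₀ := by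
  have h1 : ContDiffAt ℝ 1 (fun x => fderiv ℝ (fun x => extChartAt (𝓡 n) (b x₀) (b x)) x v) x₀ :=
    (hb.contDiffAt_extChartAt.fderiv_right (m := 1) (by norm_num)).clm_apply contDiffAt_const
  have h3 : ∀ᶠ x in 𝓝 x₀, MDifferentiableAt 𝓘(ℝ, E') (𝓡 n) b x := by
    have h := (contMDiffAt_iff_contMDiffAt_nhds (n := 1) (by simp)).1 (hb.of_le (by norm_num))
    exact h.mono fun x hx => ContMDiffAt.mdifferentiableAt hx (by simp)
  refine contMDiffAt_tangent_mk (hb.of_le (by norm_num)) h1 ?_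
  filter_upwards [h3, ContinuousAt.eventually_mem_chartAt_source (n := n) hb.continuousAt]
    with x h5 h6
  exact congrArg (fun A : E' →L[ℝ] Euc n => A v) (mfderiv_extChartAt_comp_mfderiv h5 h6)

lemma fderiv_readInChart {ν : ℕ} {ι : N → Euc ν} (hι : ContMDiff (𝓡 n) (𝓡 ν) 2 ι) (y : N) {z : Euc n}
    (hz : z ∈ (extChartAt (𝓡 n) y).target) :
    fderiv ℝ (readInChart n ι y) z =
      (mfderiv (𝓡 n) (𝓡 ν) ι ((extChartAt (𝓡 n) y).symm z) :
        TangentSpace (𝓡 n) ((extChartAt (𝓡 n) y).symm z) →L[ℝ] Euc ν) ∘L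
      (mfderiv (𝓡 n) (𝓡 n) (extChartAt (𝓡 n) y).symm z :
        Euc n →L[ℝ] TangentSpace (𝓡 n) ((extChartAt (𝓡 n) y).symm z)) := by
  rw [← mfderiv_eq_fderiv]
  exact mfderiv_comp (I' := 𝓡 n) z (hι.mdifferentiable (by norm_num) _)
    (((contMDiffOn_extChartAt_symm (n := 2) y).contMDiffAt
      ((isOpen_extChartAt_target y).mem_nhds hz)).mdifferentiableAt (by norm_num))

lemma fderiv_readInChart_self {ν : ℕ} {ι : N → Euc ν} (hι : ContMDiff (𝓡 n) (𝓡 ν) 2 ι) (y : N) :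
    fderiv ℝ (readInChart n ι y) (extChartAt (𝓡 n) y y) =
      (mfderiv (𝓡 n) (𝓡 ν) ι y : TangentSpace (𝓡 n) y →L[ℝ] Euc ν) := by
  rw [mfderiv_eq_fderiv_readInChart_comp hι (mem_chart_source _ y), mfderiv_extChartAt_self]
  rfl

variable [RiemannianBundle (fun y : N => TangentSpace (𝓡 n) y)]
    [IsContMDiffRiemannianBundle (𝓡 n) 1 (Euc n) (fun y : N => TangentSpace (𝓡 n) y)]

lemma metricInChart_apply (y : N) (z v w : Euc n) :
    metricInChart y z v w = inner ℝ (mfderiv (𝓡 n) (𝓡 n) (extChartAt (𝓡 n) y).symm z v)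
      (mfderiv (𝓡 n) (𝓡 n) (extChartAt (𝓡 n) y).symm z w) := rfl

lemma contDiffOn_metricInChart (y : N) :
    ContDiffOn ℝ 1 (metricInChart (n := n) y) (extChartAt (𝓡 n) y).target := by
  refine contDiffOn_clm_apply.2 fun v => contDiffOn_clm_apply.2 fun w => ?_
  intro z hz
  have hb : ContMDiffAt 𝓘(ℝ, Euc n) (𝓡 n) 2 (extChartAt (𝓡 n) y).symm z :=
    (contMDiffOn_extChartAt_symm y).contMDiffAt ((isOpen_extChartAt_target y).mem_nhds hz)
  have h := (hb.contMDiffAt_mfderiv_apply v).inner_bundle (hb.contMDiffAt_mfderiv_apply w)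
  exact h.contDiffAt.contDiffWithinAt

lemma inner_tangentSpace_congr {y y' : N} (h : y = y') (v w : Euc n) :
    @inner ℝ (TangentSpace (𝓡 n) y) _ v w = @inner ℝ (TangentSpace (𝓡 n) y') _ v w := by
  subst h; rfl

/-- The differentials of the chart and of its inverse cancel. The metric tensor of a single chart
thus computes inner products at all nearby points, as is needed to differentiate them along a curve.
-/
lemma metricInChart_mfderiv {y y' : N} (hy : y' ∈ (chartAt (Euc n) y).source)
    (v w : TangentSpace (𝓡 n) y') :
    metricInChart y (extChartAt (𝓡 n) y y')
      (mfderiv (𝓡 n) (𝓡 n) (extChartAt (𝓡 n) y) y' v)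
      (mfderiv (𝓡 n) (𝓡 n) (extChartAt (𝓡 n) y) y' w) = inner ℝ v w := by
  have hy' : y' ∈ (extChartAt (𝓡 n) y).source := by rwa [extChartAt_source]
  have h1 := mfderivWithin_extChartAt_symm_comp_mfderiv_extChartAt' (I := 𝓡 n) hy'
  rw [ModelWithCorners.range_eq_univ, mfderivWithin_univ] at h1
  exact (inner_tangentSpace_congr (n := n) ((extChartAt (𝓡 n) y).left_inv hy') _ _).trans
    (congrArg₂ (fun a b : TangentSpace (𝓡 n) y' => (inner ℝ a b : ℝ))
      (congrArg (fun A : Euc n →L[ℝ] Euc n => A v) h1)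
      (congrArg (fun A : Euc n →L[ℝ] Euc n => A w) h1))

lemma metricInChart_self (y : N) (v w : TangentSpace (𝓡 n) y) :
    metricInChart y (extChartAt (𝓡 n) y y) v w = inner ℝ v w := by
  have h := metricInChart_mfderiv (mem_chart_source (Euc n) y) v w
  rwa [mfderiv_extChartAt_self] at h

lemma fderiv_metricInChart_apply (y : N) {z : Euc n} (hz : z ∈ (extChartAt (𝓡 n) y).target)
    (k v w : Euc n) :
    fderiv ℝ (metricInChart y) z k v w = fderiv ℝ (fun z => metricInChart y z v w) z k := by
  have h : DifferentiableAt ℝ (metricInChart (n := n) y) z :=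
    ((contDiffOn_metricInChart y).contDiffAt
      ((isOpen_extChartAt_target y).mem_nhds hz)).differentiableAt (by simp)
  have h2 : HasFDerivAt (fun z => metricInChart y z v w) _ z :=
    (h.hasFDerivAt.clm_apply (hasFDerivAt_const v z)).clm_apply (hasFDerivAt_const w z)
  rw [h2.fderiv]
  simp

lemma christoffel_eq_of_inner_eq (y : N) (v w X : TangentSpace (𝓡 n) y)
    (h : ∀ k : TangentSpace (𝓡 n) y, inner ℝ X k =
      christoffelFirst (metricInChart y) (extChartAt (𝓡 n) y y) v w k) :
    christoffel y v w = X := by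
  have : christoffel y v w = ∑ i, christoffelFirst (metricInChart y) (extChartAt (𝓡 n) y y) v w
      (stdOrthonormalBasis ℝ (TangentSpace (𝓡 n) y) i) •
      stdOrthonormalBasis ℝ (TangentSpace (𝓡 n) y) i := rfl
  rw [this, ← (stdOrthonormalBasis ℝ (TangentSpace (𝓡 n) y)).sum_repr' X]
  refine Finset.sum_congr rfl fun i _ => ?_
  rw [← h, real_inner_comm]

/-- The right side is linear in `k`, so the Riesz theorem represents it by a vector, and
`christoffel` is the expansion of that vector in an orthonormal basis. In particular it does not
depend on the basis. -/
lemma inner_christoffel (y : N) (v w k : TangentSpace (𝓡 n) y) :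
    inner ℝ (christoffel y v w) k =
      christoffelFirst (metricInChart y) (extChartAt (𝓡 n) y y) v w k := by
  set φ : TangentSpace (𝓡 n) y →ₗ[ℝ] ℝ :=
    christoffelFirstForm (metricInChart y) (extChartAt (𝓡 n) y y) v w
  have h := christoffel_eq_of_inner_eq y v w
    ((InnerProductSpace.toDual ℝ (TangentSpace (𝓡 n) y)).symm φ.toContinuousLinearMap) (fun k => by
      rw [InnerProductSpace.toDual_symm_apply]; rfl)
  rw [h, InnerProductSpace.toDual_symm_apply]
  rfl

section Isometric

variable {ν : ℕ} {ι : N → Euc ν}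

lemma IsIsometricEmbedding.metricInChart_eq (hι : IsIsometricEmbedding n ι) (y : N) {z : Euc n}
    (hz : z ∈ (extChartAt (𝓡 n) y).target) (v w : Euc n) :
    metricInChart y z v w =
      inner ℝ (fderiv ℝ (readInChart n ι y) z v) (fderiv ℝ (readInChart n ι y) z w) := by
  rw [fderiv_readInChart hι.contMDiff y hz, metricInChart_apply, ← hι.inner_eq]
  rfl

/-- The Gauss formula: the Christoffel symbols are the tangential part of the second derivative of
an isometric embedding. -/
lemma IsIsometricEmbedding.inner_fderiv_fderiv (hι : IsIsometricEmbedding n ι) (y : N)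
    (v w k : TangentSpace (𝓡 n) y) :
    inner ℝ (fderiv ℝ (fderiv ℝ (readInChart n ι y)) (extChartAt (𝓡 n) y y) v w : Euc ν)
      (mfderiv (𝓡 n) (𝓡 ν) ι y k : Euc ν) = inner ℝ (christoffel y v w) k := by
  set ψ := readInChart n ι y with hψdef
  set z := extChartAt (𝓡 n) y y
  have hzt : z ∈ (extChartAt (𝓡 n) y).target := mem_extChartAt_target y
  have htn : (extChartAt (𝓡 n) y).target ∈ 𝓝 z := (isOpen_extChartAt_target y).mem_nhds hzt
  have hψ : ContDiffAt ℝ 2 ψ z := (hι.contMDiff.contDiffOn_readInChart y).contDiffAt htn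
  have hψ1 : ContDiffAt ℝ 1 (fderiv ℝ ψ) z := hψ.fderiv_right (m := 1) (by norm_num)
  have hd := hψ1.differentiableAt (by simp)
  have key : ∀ a b c : Euc n, fderiv ℝ (metricInChart y) z a b c =
      inner ℝ (fderiv ℝ ψ z b) (fderiv ℝ (fderiv ℝ ψ) z a c) +
      inner ℝ (fderiv ℝ (fderiv ℝ ψ) z a b) (fderiv ℝ ψ z c) := fun a b c => by
    rw [fderiv_metricInChart_apply y hzt]
    have h1 : (fun z => metricInChart y z b c) =ᶠ[𝓝 z]
        fun z => inner ℝ (fderiv ℝ ψ z b) (fderiv ℝ ψ z c) := by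
      filter_upwards [htn] with z' hz'
      exact hι.metricInChart_eq y hz' b c
    have hb : HasFDerivAt (fun z => fderiv ℝ ψ z b) _ z :=
      hd.hasFDerivAt.clm_apply (hasFDerivAt_const b z)
    have hc : HasFDerivAt (fun z => fderiv ℝ ψ z c) _ z :=
      hd.hasFDerivAt.clm_apply (hasFDerivAt_const c z)
    rw [h1.fderiv_eq, fderiv_inner_apply ℝ hb.differentiableAt hc.differentiableAt, hb.fderiv,
      hc.fderiv]
    simp
  have hsymm : ∀ a b : Euc n, fderiv ℝ (fderiv ℝ ψ) z a b = fderiv ℝ (fderiv ℝ ψ) z b a :=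
    fun a b => (hψ.isSymmSndFDerivAt (by simp)) a b
  rw [inner_christoffel, ← fderiv_readInChart_self hι.contMDiff y]
  have goal : ∀ v w k : Euc n, (inner ℝ (fderiv ℝ (fderiv ℝ ψ) z v w) (fderiv ℝ ψ z k) : ℝ) =
      christoffelFirst (metricInChart y) z v w k := fun v w k => by
    -- By symmetry of D²ψ, four of the six products cancel and the two others equal ⟨D²ψ(v, w), dψ
    -- k⟩.
    rw [christoffelFirst, key, key, key, hsymm w v, hsymm k v, hsymm k w,
      real_inner_comm (fderiv ℝ (fderiv ℝ ψ) z v k) (fderiv ℝ ψ z w)]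
    ring
  exact goal v w k

end Isometric

/-- Geodesics have constant speed. -/
lemma IsGeodesic.exists_norm_mfderiv_eq {γ : ℝ → N} (hγ : IsGeodesic n γ) :
    ∃ l : ℝ, ∀ t, ‖(mfderiv 𝓘(ℝ, ℝ) (𝓡 n) γ t 1 : TangentSpace (𝓡 n) (γ t))‖ = l := by
  set s : ℝ → ℝ := fun t => inner ℝ (mfderiv 𝓘(ℝ, ℝ) (𝓡 n) γ t 1 : TangentSpace (𝓡 n) (γ t))
    (mfderiv 𝓘(ℝ, ℝ) (𝓡 n) γ t 1 : TangentSpace (𝓡 n) (γ t)) with hs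
  have hder : ∀ t, HasDerivAt s 0 t := fun t => by
    obtain ⟨hγ2, hgeo⟩ := hγ
    have hgeo := hgeo t
    set c : ℝ → Euc n := fun s => extChartAt (𝓡 n) (γ t) (γ s)
    set G := metricInChart (n := n) (γ t)
    have hc2 : ContDiffAt ℝ 2 c t := (hγ2 t).contDiffAt_extChartAt
    have hct : c t = extChartAt (𝓡 n) (γ t) (γ t) := rfl
    have hev : ∀ᶠ x in 𝓝 t, γ x ∈ (chartAt (Euc n) (γ t)).source :=
      ContinuousAt.eventually_mem_chartAt_source (n := n) (hγ2 t).continuousAt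
    have hsG : s =ᶠ[𝓝 t] fun x => G (c x) (deriv c x) (deriv c x) := by
      filter_upwards [hev] with x hx
      have h1 := mfderiv_extChartAt_comp_mfderiv ((hγ2 x).mdifferentiableAt (by norm_num)) hx
      have h2 : ∀ A : ℝ →L[ℝ] Euc n, A = fderiv ℝ c x → A 1 = deriv c x := by
        rintro A rfl; rfl
      exact (metricInChart_mfderiv hx _ _).symm.trans
        (congrArg₂ (fun a b => G (c x) a b) (h2 _ h1) (h2 _ h1))
    have hd1 : HasDerivAt c (deriv c t) t := (hc2.differentiableAt (by norm_num)).hasDerivAt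
    have hd2 : HasDerivAt (deriv c) (deriv (deriv c) t) t := by
      have h1 : ContDiffAt ℝ 1 (fun x => fderiv ℝ c x 1) t :=
        (hc2.fderiv_right (m := 1) (by norm_num)).clm_apply contDiffAt_const
      exact (h1.differentiableAt (by simp)).hasDerivAt
    have hGd : HasFDerivAt G (fderiv ℝ G (c t)) (c t) :=
      (((contDiffOn_metricInChart (γ t)).contDiffAt
        (extChartAt_target_mem_nhds _)).differentiableAt (by simp)).hasFDerivAt
    have hd3 : HasDerivAt (fun x => G (c x)) (fderiv ℝ G (c t) (deriv c t)) t :=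
      hGd.comp_hasDerivAt t hd1
    have hd4 := (hd3.clm_apply hd2).clm_apply hd2
    refine HasDerivAt.congr_of_eventuallyEq ?_ hsG
    have hsymm : ∀ a b : Euc n, G (c t) a b = G (c t) b a := fun a b =>
      (metricInChart_self (γ t) a b).trans
        ((real_inner_comm (F := TangentSpace (𝓡 n) (γ t)) b a).trans
          (metricInChart_self (γ t) b a).symm)
    -- The derivative of g(c', c') is ∂g(c')(c', c') + 2 g(c'', c'). The geodesic equation gives
    -- g(c'', c') = -∂g(c')(c', c')/2, so it vanishes.
    have h5 : G (c t) (deriv (deriv c) t) (deriv c t) =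
        - (fderiv ℝ G (c t) (deriv c t) (deriv c t) (deriv c t) / 2) := by
      have h6 := inner_christoffel (γ t) (deriv c t) (deriv c t) (deriv c t)
      have h6 := h6.trans (christoffelFirst_self _ _ _)
      have h7 : deriv (deriv c) t = - christoffel (γ t) (deriv c t) (deriv c t) :=
        eq_neg_of_add_eq_zero_left hgeo
      have h8 := metricInChart_self (γ t) (deriv (deriv c) t) (deriv c t)
      refine h8.trans ?_
      refine (congrArg (fun a : TangentSpace (𝓡 n) (γ t) =>
        @inner ℝ (TangentSpace (𝓡 n) (γ t)) _ a (deriv c t)) h7).trans ?_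
      exact (inner_neg_left (𝕜 := ℝ) _ _).trans (congrArg Neg.neg h6)
    have h9 : fderiv ℝ G (c t) (deriv c t) (deriv c t) (deriv c t) +
        G (c t) (deriv (deriv c) t) (deriv c t) + G (c t) (deriv c t) (deriv (deriv c) t) = 0 := by
      rw [hsymm (deriv c t) (deriv (deriv c) t), h5]; ring
    rw [← h9]
    exact hd4
  obtain ⟨l, hl⟩ : ∃ l, ∀ t, s t = l := ⟨s 0, fun t =>
    is_const_of_deriv_eq_zero (fun t => (hder t).differentiableAt) (fun t => (hder t).deriv) t 0⟩
  refine ⟨Real.sqrt l, fun t => ?_⟩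
  rw [← hl t, hs]
  simp only
  rw [real_inner_self_eq_norm_sq, Real.sqrt_sq (norm_nonneg _)]

end Metric

/-! ### Local retractions of an embedding and of its prolongations to bundles. -/

section Retractions

variable {m n : ℕ} {N : Type*} [TopologicalSpace N] [ChartedSpace (Euc n) N]
  [IsManifold (𝓡 n) 2 N]

lemma inCoordinates_bilin_tangent (y y' : N) (hy : y' ∈ (chartAt (Euc n) y).source)
    (B : Euc m →L[ℝ] Euc m →L[ℝ] TangentSpace (𝓡 n) y') (e : Euc m) :
    ContinuousLinearMap.inCoordinates (Euc m) (fun y : N => Bundle.Trivial N (Euc m) y)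
      (Euc m →L[ℝ] Euc n)
      (fun y : N => Bundle.Trivial N (Euc m) y →L[ℝ] TangentSpace (𝓡 n) y) y y' y y' B e =
    (mfderiv (𝓡 n) (𝓡 n) (extChartAt (𝓡 n) y) y') ∘L (B e) := by
  rw [← inCoordinates_hom_tangent y y' hy (B e), ContinuousLinearMap.inCoordinates]
  have hmem : y' ∈ (trivializationAt (Euc m →L[ℝ] Euc n)
      (fun y : N => Bundle.Trivial N (Euc m) y →L[ℝ] TangentSpace (𝓡 n) y) y).baseSet := by
    rw [hom_trivializationAt_baseSet]
    exact ⟨mem_univ _, hy⟩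
  simp only [Bundle.Trivial.fiberBundle_trivializationAt', Bundle.Trivial.symmL_trivialization,
    ContinuousLinearMap.comp_apply, ContinuousLinearMap.id_apply,
    Trivialization.continuousLinearMapAt_apply]
  rw [Trivialization.linearMapAt_apply]
  exact if_pos hmem

lemma continuousAt_bilinTangent_mk {X : Type*} [TopologicalSpace X] {b : X → N} {x₀ : X}
    {B : ∀ x, Euc m →L[ℝ] Euc m →L[ℝ] TangentSpace (𝓡 n) (b x)}
    (hb : ContinuousAt b x₀) {ζ : X → (Euc m →L[ℝ] Euc m →L[ℝ] Euc n)} (hζ : ContinuousAt ζ x₀)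
    (hB : ∀ᶠ x in 𝓝 x₀, ∀ e,
      (mfderiv (𝓡 n) (𝓡 n) (extChartAt (𝓡 n) (b x₀)) (b x)) ∘L B x e = ζ x e) :
    ContinuousAt (fun x => (⟨b x, B x⟩ : BilinTangent m n N)) x₀ := by
  rw [continuousAt_hom_bundle]
  refine ⟨hb, hζ.congr ?_⟩
  filter_upwards [hB, hb.eventually_mem ((chartAt (Euc n) (b x₀)).open_source.mem_nhds
    (mem_chart_source _ _))] with x hx hx'
  ext1 e
  rw [← hx]
  exact (inCoordinates_bilin_tangent _ _ hx' _ e).symm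

lemma homTangent_mk_congr {y y' : N} (h : y = y') {A B : Euc m →L[ℝ] Euc n} (hA : A = B) :
    (⟨y, A⟩ : HomTangent m n N) = ⟨y', B⟩ := by
  subst h hA; rfl

lemma bilinTangent_mk_congr {y y' : N} (h : y = y') {A B : Euc m →L[ℝ] Euc m →L[ℝ] Euc n}
    (hA : A = B) : (⟨y, A⟩ : BilinTangent m n N) = ⟨y', B⟩ := by
  subst h hA; rfl

variable {ν : ℕ} {ι : N → Euc ν}

/-- A `C²` injective immersion that is a topological embedding has local `C²` retractions. -/
lemma hasLocalRetractions_of_immersion (hι : ContMDiff (𝓡 n) (𝓡 ν) 2 ι)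
    (hemb : Topology.IsEmbedding ι)
    (hinj : ∀ (y : N) (v : TangentSpace (𝓡 n) y), (mfderiv (𝓡 n) (𝓡 ν) ι y v : Euc ν) = 0 → v = 0) :
    HasLocalRetractions (𝓡 n) 2 ι := by
  intro y
  set ψ := readInChart n ι y
  set z := extChartAt (𝓡 n) y y
  have htn : (extChartAt (𝓡 n) y).target ∈ 𝓝 z := extChartAt_target_mem_nhds _
  have hψ : ContDiffAt ℝ 2 ψ z := (hι.contDiffOn_readInChart y).contDiffAt htn
  have hψy : ψ z = ι y := congrArg ι (extChartAt_to_inv (I := 𝓡 n) y)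
  have hker : LinearMap.ker (fderiv ℝ ψ z : Euc n →ₗ[ℝ] Euc ν) = ⊥ := by
    rw [LinearMap.ker_eq_bot']
    intro v hv
    exact hinj y v ((congrArg (fun A : Euc n →L[ℝ] Euc ν => A v)
      (fderiv_readInChart_self hι y).symm).trans hv)
  -- With a linear left inverse B of dψ, the map B ∘ ψ has identity differential and is locally
  -- invertible. The retraction is B followed by this local inverse and by the inverse chart.
  obtain ⟨B', hB'⟩ := LinearMap.exists_leftInverse_of_injective _ hker
  set B : Euc ν →L[ℝ] Euc n := B'.toContinuousLinearMap
  have hB : ∀ v, B (fderiv ℝ ψ z v) = v := fun v => congrArg (fun A : Euc n →ₗ[ℝ] Euc n => A v) hB'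
  have hφ : ContDiffAt ℝ 2 (fun x => B (ψ x)) z := B.contDiff.contDiffAt.comp z hψ
  have hφ' : HasFDerivAt (fun x => B (ψ x))
      ((ContinuousLinearEquiv.refl ℝ (Euc n) : Euc n ≃L[ℝ] Euc n) : Euc n →L[ℝ] Euc n) z := by
    refine (B.hasFDerivAt.comp z (hψ.differentiableAt (by norm_num)).hasFDerivAt).congr_fderiv ?_
    ext1 v
    exact hB v
  set e := hφ.toOpenPartialHomeomorph _ hφ' (by norm_num) with he
  have hze : z ∈ e.source := hφ.mem_toOpenPartialHomeomorph_source hφ' (by norm_num)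
  have heφ : ∀ x, e x = B (ψ x) := fun x => rfl
  have hσ : ContDiffAt ℝ 2 e.symm (B (ψ z)) := hφ.to_localInverse hφ' (by norm_num)
  have hσz : e.symm (B (ψ z)) = z := by rw [← heφ, e.left_inv hze]
  set R : Euc ν → N := fun a => (extChartAt (𝓡 n) y).symm (e.symm (B a)) with hR
  have hRC : ContMDiffAt (𝓡 ν) (𝓡 n) 2 R (ι y) := by
    rw [← hψy]
    have h1 : ContMDiffAt (𝓡 n) (𝓡 n) 2 (extChartAt (𝓡 n) y).symm (e.symm (B (ψ z))) := by
      rw [hσz]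
      exact (contMDiffOn_extChartAt_symm y).contMDiffAt htn
    have h2 : ContDiffAt ℝ 2 (fun a => e.symm (B a)) (ψ z) :=
      ContDiffAt.comp (ψ z) (g := e.symm) (f := B) hσ B.contDiff.contDiffAt
    exact ContMDiffAt.comp (ψ z) (g := (extChartAt (𝓡 n) y).symm)
      (f := fun a => e.symm (B a)) h1 h2.contMDiffAt
  have hV : (extChartAt (𝓡 n) y).source ∩ extChartAt (𝓡 n) y ⁻¹' e.source ∈ 𝓝 y :=
    inter_mem (extChartAt_source_mem_nhds y)
      ((continuousAt_extChartAt y).preimage_mem_nhds (e.open_source.mem_nhds hze))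
  -- The embedding hypothesis serves here: a small ball around ι y meets no part of ι(N) coming from
  -- outside the chart domain.
  rw [hemb.isInducing.nhds_eq_comap, mem_comap] at hV
  obtain ⟨t, ht, htV⟩ := hV
  have hev := (contMDiffAt_iff_contMDiffAt_nhds (n := 2) (by simp)).1 hRC
  obtain ⟨O, hOsub, hO, hyO⟩ := mem_nhds_iff.1 (inter_mem ht hev)
  refine ⟨O, R, hO, hyO, fun a ha => (hOsub ha).2.contMDiffWithinAt, fun q hq => ?_⟩
  obtain ⟨hq1, hq2⟩ := htV (show q ∈ ι ⁻¹' t from (hOsub hq).1)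
  have h3 : ψ (extChartAt (𝓡 n) y q) = ι q :=
    congrArg ι ((extChartAt (𝓡 n) y).left_inv hq1)
  simp only [hR]
  rw [← h3, ← heφ, e.left_inv hq2, (extChartAt (𝓡 n) y).left_inv hq1]

/-- The differential of a local retraction is a left inverse of the differential. -/
lemma mfderiv_retraction_comp (hι : ContMDiff (𝓡 n) (𝓡 ν) 2 ι) {O : Set (Euc ν)}
    {R : Euc ν → N} (hO : IsOpen O) (hR : ContMDiffOn (𝓡 ν) (𝓡 n) 2 R O)
    (hRι : ∀ q, ι q ∈ O → R (ι q) = q) {y : N} (hy : ι y ∈ O) (v : Euc n) :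
    (mfderiv (𝓡 ν) (𝓡 n) R (ι y) : Euc ν →L[ℝ] Euc n)
      ((mfderiv (𝓡 n) (𝓡 ν) ι y : Euc n →L[ℝ] Euc ν) v) = v := by
  have h1 : R ∘ ι =ᶠ[𝓝 y] id := by
    filter_upwards [hι.continuous.continuousAt.preimage_mem_nhds (hO.mem_nhds hy)] with q hq
    exact hRι q hq
  have h2 := mfderiv_comp (I := 𝓡 n) (I' := 𝓡 ν) (I'' := 𝓡 n) y
    ((hR.contMDiffAt (hO.mem_nhds hy)).mdifferentiableAt (by norm_num))
    (hι.mdifferentiable (by norm_num) y)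
  have h3 : mfderiv (𝓡 n) (𝓡 n) (R ∘ ι) y = ContinuousLinearMap.id ℝ (TangentSpace (𝓡 n) y) :=
    h1.mfderiv_eq.trans mfderiv_id
  exact congrArg (fun A : Euc n →L[ℝ] Euc n => A v) (h2.symm.trans h3)

/-- A retraction R of ι lifts to (x, a, η) ↦ (x, R a, dR_a ∘ η), since dR is a left inverse of dι.
The differential costs one derivative, so C² becomes C¹. -/
lemma HasLocalRetractions.homPush (h : HasLocalRetractions (𝓡 n) 2 ι)
    (hι : ContMDiff (𝓡 n) (𝓡 ν) 2 ι) :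
    HasLocalRetractions (homModel m n) 1 (homPush (m := m) (n := n) ι) := by
  rintro ⟨x, y, ξ⟩
  obtain ⟨O, R, hO, hyO, hR, hRι⟩ := h y
  refine ⟨univ ×ˢ O ×ˢ univ, fun q => (q.1, ⟨R q.2.1, (mfderiv (𝓡 ν) (𝓡 n) R q.2.1 :
    Euc ν →L[ℝ] TangentSpace (𝓡 n) (R q.2.1)) ∘L q.2.2⟩),
    isOpen_univ.prod (hO.prod isOpen_univ), ⟨mem_univ _, hyO, mem_univ _⟩, ?_, ?_⟩
  · rintro ⟨x', a, η⟩ ⟨-, ha, -⟩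
    have h1 := (hR.contMDiffAt (hO.mem_nhds ha)).contMDiffAt_mfderiv_comp (ξ₀ := η)
    have h2 : ContMDiffAt 𝓘(ℝ, Euc m × Euc ν × (Euc m →L[ℝ] Euc ν))
        𝓘(ℝ, Euc ν × (Euc m →L[ℝ] Euc ν)) 1 Prod.snd (x', a, η) :=
      contDiffAt_snd.contMDiffAt
    refine (ContMDiffAt.prodMk (contDiffAt_fst.contMDiffAt) ?_).contMDiffWithinAt
    exact ContMDiffAt.comp (x', a, η) (f := Prod.snd) h1 h2
  · rintro ⟨x', y', ξ'⟩ ⟨-, hy', -⟩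
    refine Prod.ext rfl (homTangent_mk_congr (hRι y' hy') ?_)
    ext1 v
    exact mfderiv_retraction_comp hι hO hR hRι hy' (ξ' v)

/-- The map `(y, B) ↦ (ι y, dι_y ∘ B)`. -/
noncomputable def bilinPush (ι : N → Euc ν) (q : BilinTangent m n N) :
    Euc ν × (Euc m →L[ℝ] Euc m →L[ℝ] Euc ν) :=
  (ι q.1, ContinuousLinearMap.compL ℝ (Euc m) (Euc n) (Euc ν)
    (mfderiv (𝓡 n) (𝓡 ν) ι q.1 : Euc n →L[ℝ] Euc ν) ∘L (q.2 : Euc m →L[ℝ] Euc m →L[ℝ] Euc n))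

lemma ContMDiffAt.continuousAt_mfderiv_comp_bilin {R : Euc ν → N} {a : Euc ν}
    {C : Euc m →L[ℝ] Euc m →L[ℝ] Euc ν} (hR : ContMDiffAt (𝓡 ν) (𝓡 n) 2 R a) :
    ContinuousAt (fun q : Euc ν × (Euc m →L[ℝ] Euc m →L[ℝ] Euc ν) =>
      (⟨R q.1, ContinuousLinearMap.compL ℝ (Euc m) (Euc ν) (Euc n)
        (mfderiv (𝓡 ν) (𝓡 n) R q.1 : Euc ν →L[ℝ] Euc n) ∘L q.2⟩ : BilinTangent m n N)) (a, C) := by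
  have h1 : ContDiffAt ℝ 1 (fderiv ℝ (fun x => extChartAt (𝓡 n) (R a) (R x))) a :=
    hR.contDiffAt_extChartAt.fderiv_right (m := 1) (by norm_num)
  have h3 : ∀ᶠ x in 𝓝 a, MDifferentiableAt (𝓡 ν) (𝓡 n) R x := by
    have h := (contMDiffAt_iff_contMDiffAt_nhds (n := 1) (by simp)).1 (hR.of_le (by norm_num))
    exact h.mono fun x hx => ContMDiffAt.mdifferentiableAt hx (by simp)
  have h4 : Tendsto (fun q : Euc ν × (Euc m →L[ℝ] Euc m →L[ℝ] Euc ν) => q.1) (𝓝 (a, C)) (𝓝 a) :=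
    continuous_fst.tendsto' _ _ rfl
  refine continuousAt_bilinTangent_mk (ζ := fun q =>
    ContinuousLinearMap.compL ℝ (Euc m) (Euc ν) (Euc n)
      (fderiv ℝ (fun x => extChartAt (𝓡 n) (R a) (R x)) q.1) ∘L q.2)
    (ContinuousAt.comp (x := (a, C)) (g := R) hR.continuousAt continuousAt_fst) ?_ ?_
  · have h5 : ContinuousAt (fun q : Euc ν × (Euc m →L[ℝ] Euc m →L[ℝ] Euc ν) =>
        fderiv ℝ (fun x => extChartAt (𝓡 n) (R a) (R x)) q.1) (a, C) :=
      ContinuousAt.comp (x := (a, C)) (f := Prod.fst)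
        (g := fderiv ℝ (fun x => extChartAt (𝓡 n) (R a) (R x))) h1.continuousAt continuousAt_fst
    exact (((ContinuousLinearMap.compL ℝ (Euc m) (Euc ν) (Euc n)).continuous.continuousAt).comp
      h5).clm_comp continuousAt_snd
  · filter_upwards [h4.eventually h3, h4.eventually
      (ContinuousAt.eventually_mem_chartAt_source (n := n) hR.continuousAt)] with q h5 h6 e
    exact congrArg (fun A : Euc ν →L[ℝ] Euc n => A ∘L (q.2 e))
      (mfderiv_extChartAt_comp_mfderiv h5 h6)

/-- The same lift by dR. Continuity suffices, because it is only used for the measurability of the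
covariant derivative. -/
lemma HasLocalRetractions.bilinPush (h : HasLocalRetractions (𝓡 n) 2 ι)
    (hι : ContMDiff (𝓡 n) (𝓡 ν) 2 ι) :
    HasLocalRetractions ((𝓡 n).prod 𝓘(ℝ, Euc m →L[ℝ] Euc m →L[ℝ] Euc n)) 0
      (bilinPush (m := m) (n := n) ι) := by
  rintro ⟨y, B⟩
  obtain ⟨O, R, hO, hyO, hR, hRι⟩ := h y
  refine ⟨O ×ˢ univ, fun q => ⟨R q.1, ContinuousLinearMap.compL ℝ (Euc m) (Euc ν) (Euc n)
        (mfderiv (𝓡 ν) (𝓡 n) R q.1 : Euc ν →L[ℝ] Euc n) ∘L q.2⟩,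
    hO.prod isOpen_univ, ⟨hyO, mem_univ _⟩, ?_, ?_⟩
  · rw [contMDiffOn_zero_iff]
    rintro ⟨a, η⟩ ⟨ha, -⟩
    exact (hR.contMDiffAt (hO.mem_nhds ha)).continuousAt_mfderiv_comp_bilin.continuousWithinAt
  · rintro ⟨y', B'⟩ ⟨hy', -⟩
    refine bilinTangent_mk_congr (hRι y' hy') ?_
    ext1 e
    ext1 v
    exact mfderiv_retraction_comp hι hO hR hRι hy' (B' e v)

end Retractions

/-! ### Tangency of weak derivatives. -/

section Range

variable {m : ℕ} {E : Type*} [NormedAddCommGroup E] [NormedSpace ℝ E] [FiniteDimensional ℝ E]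
  {EM : Type*} [NormedAddCommGroup EM] [NormedSpace ℝ EM] {H : Type*} [TopologicalSpace H]
  {I : ModelWithCorners ℝ EM H} {M : Type*} [TopologicalSpace M] [ChartedSpace H M]
  {Φ : M → E}

/-- The weak derivative of a map that factors through `Φ` takes its values in the range of the
differential of `Φ`. -/
lemma HasLocalRetractions.ae_exists_mfderiv_eq (h : HasLocalRetractions I 1 Φ)
    (hΦ : ContMDiff I 𝓘(ℝ, E) 1 Φ) {Ω : Set (Euc m)} (hΩ : IsOpen Ω)
    {q : Euc m → M} {w : Euc m → E} {W : Euc m → (Euc m →L[ℝ] E)} (hw : HasWeakDerivOn Ω w W)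
    (hq : ∀ᵐ x ∂volume.restrict Ω, w x = Φ (q x)) :
    ∀ᵐ x ∂volume.restrict Ω, ∀ e, ∃ η : TangentSpace I (q x),
      W x e = (mfderiv I 𝓘(ℝ, E) Φ (q x) : TangentSpace I (q x) →L[ℝ] E) η := by
  have : CompleteSpace E := FiniteDimensional.complete ℝ E
  have : ProperSpace E := FiniteDimensional.proper_real E
  choose O R hO hpO hR hRΦ using h
  choose χ hχ hχc hχs hχ1 using fun p : M => exists_contDiff_cutoff (isCompact_singleton (x := Φ p))
    (hO p) (singleton_subset_iff.2 (hpO p))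
  choose V hVχ hV hpV using fun p : M => mem_nhds_iff.1 (hχ1 p (Φ p) rfl)
  -- Countably many of the neighbourhoods suffice, so the exceptional null sets have a null union.
  obtain ⟨T, hT, hTV⟩ := TopologicalSpace.isOpen_iUnion_countable V hV
  have key : ∀ p ∈ T, ∀ᵐ x ∂volume.restrict Ω, w x = Φ (q x) → Φ (q x) ∈ V p →
      ∀ e, ∃ η : TangentSpace I (q x),
        W x e = (mfderiv I 𝓘(ℝ, E) Φ (q x) : TangentSpace I (q x) →L[ℝ] E) η := by
    intro p _
    -- This function vanishes on the image of `Φ`, so F ∘ w = 0 and the chain rule gives dF(w) W =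
    -- 0. Where χ = 1 this says W = dΦ(dR(W)), which lies in the range of dΦ.
    set F : E → E := fun a => χ p a • (a - Φ (R p a)) with hF
    have hΦR : ContDiffOn ℝ 1 (fun a => Φ (R p a)) (O p) := (hΦ.comp_contMDiffOn (hR p)).contDiffOn
    have hFd : ContDiff ℝ 1 F := by
      rw [contDiff_iff_contDiffAt]
      intro a
      by_cases ha : a ∈ tsupport (χ p)
      · exact ((hχ p).of_le (by simp)).contDiffAt.smul (contDiffAt_id.sub
          (hΦR.contDiffAt ((hO p).mem_nhds (hχs p ha))))
      · refine contDiffAt_const (c := (0 : E)) |>.congr_of_eventuallyEq ?_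
        filter_upwards [(isClosed_tsupport _).isOpen_compl.mem_nhds ha] with b hb
        simp only [hF]
        rw [image_eq_zero_of_notMem_tsupport hb, zero_smul]
    have hFc : HasCompactSupport F := (hχc p).smul_right
    have hF0 : ∀ r : M, F (Φ r) = 0 := fun r => by
      simp only [hF]
      by_cases hr : Φ r ∈ O p
      · rw [hRΦ p r hr, sub_self, smul_zero]
      · rw [image_eq_zero_of_notMem_tsupport fun h => hr (hχs p h), zero_smul]
    have h1 := (hw.comp_contDiff hΩ hFd hFc).congr_ae hΩ.measurableSet
      (f' := fun _ => (0 : E)) (g' := fun x => fderiv ℝ F (w x) ∘L W x)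
      (by filter_upwards [hq] with x hx; rw [hx, hF0]) (EventuallyEq.refl _ _)
    have h2 : HasWeakDerivOn Ω (fun _ => (0 : E)) (fderiv ℝ fun _ => (0 : E)) :=
      ContDiffOn.hasWeakDerivOn hΩ contDiffOn_const
    filter_upwards [h1.ae_eq hΩ h2] with x hx hwx hxV e
    have hxO : w x ∈ O p := by
      rw [hwx]
      refine hχs p (subset_tsupport _ ?_)
      rw [Function.mem_support, (hVχ p hxV : χ p _ = _)]
      exact one_ne_zero
    have hd : DifferentiableAt ℝ (fun a => Φ (R p a)) (w x) :=
      (hΦR.contDiffAt ((hO p).mem_nhds hxO)).differentiableAt (by simp)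
    have hFe : F =ᶠ[𝓝 (w x)] fun a => a - Φ (R p a) := by
      filter_upwards [(hV p).mem_nhds (show w x ∈ V p by rwa [hwx])] with b hb
      simp only [hF]
      rw [(hVχ p hb : χ p b = _), Pi.one_apply, one_smul]
    have hFf : fderiv ℝ F (w x) = ContinuousLinearMap.id ℝ E - fderiv ℝ (fun a => Φ (R p a)) (w x) := by
      rw [hFe.fderiv_eq]
      exact ((hasFDerivAt_id _).sub hd.hasFDerivAt).fderiv
    have h3 : W x e = fderiv ℝ (fun a => Φ (R p a)) (w x) (W x e) := by
      have h4 := congrArg (fun A : Euc m →L[ℝ] E => A e) hx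
      simp only [hFf, fderiv_fun_const, Pi.zero_apply, ContinuousLinearMap.comp_apply,
        zero_apply] at h4
      exact sub_eq_zero.1 h4
    have hRq : R p (w x) = q x := by rw [hwx]; exact hRΦ p _ (hwx ▸ hxO)
    have h5 : fderiv ℝ (fun a => Φ (R p a)) (w x) =
        (mfderiv I 𝓘(ℝ, E) Φ (R p (w x)) : TangentSpace I (R p (w x)) →L[ℝ] E) ∘L
          (mfderiv 𝓘(ℝ, E) I (R p) (w x) : E →L[ℝ] TangentSpace I (R p (w x))) := by
      rw [← mfderiv_eq_fderiv]
      exact mfderiv_comp (I' := I) (w x) (hΦ.mdifferentiable (by simp) _)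
        (((hR p).contMDiffAt ((hO p).mem_nhds hxO)).mdifferentiableAt (by simp))
    rw [h5, hRq] at h3
    exact ⟨_, h3⟩
  have hall := (ae_ball_iff hT).2 key
  filter_upwards [hall, hq] with x hx hwx
  have : Φ (q x) ∈ ⋃ p ∈ T, V p := by
    rw [hTV]
    exact mem_iUnion.2 ⟨q x, hpV (q x)⟩
  obtain ⟨p, hp, hpx⟩ := mem_iUnion₂.1 this
  exact hx p hp hwx hpx

end Range

/-! ### The orthogonal projection onto the tangent space. -/

section Projection

/-- From ⟨L*Lv, v⟩ = |Lv|² the map L*L is injective, hence invertible in finite dimension. -/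
lemma isUnit_adjoint_comp {n ν : ℕ} (L : Euc n →L[ℝ] Euc ν) (h : ∀ v, L v = 0 → v = 0) :
    IsUnit (ContinuousLinearMap.adjoint L ∘L L) := by
  have h1 : Function.Injective ((ContinuousLinearMap.adjoint L ∘L L : Euc n →L[ℝ] Euc n) :
      Euc n →ₗ[ℝ] Euc n) := by
    rw [← LinearMap.ker_eq_bot, LinearMap.ker_eq_bot']
    intro v hv
    have h2 : inner ℝ (ContinuousLinearMap.adjoint L (L v)) v = inner ℝ (L v) (L v) :=
      ContinuousLinearMap.adjoint_inner_left _ _ _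
    have hv' : ContinuousLinearMap.adjoint L (L v) = 0 := hv
    rw [hv', inner_zero_left] at h2
    exact h v (inner_self_eq_zero.1 h2.symm)
  rw [ContinuousLinearMap.isUnit_iff_bijective]
  exact ⟨h1, LinearMap.surjective_of_injective h1⟩

/-- L(L*L)⁻¹L* is the orthogonal projection onto the range of L, and inversion is continuous at
units. The formula involves only Euclidean adjoints and not the varying inner products of the
tangent spaces. -/
lemma ContinuousAt.inverse_adjoint_comp {n ν : ℕ} {X : Type*} [TopologicalSpace X]
    {L : X → (Euc n →L[ℝ] Euc ν)} {x₀ : X} (hL : ContinuousAt L x₀)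
    (h : ∀ v, L x₀ v = 0 → v = 0) :
    ContinuousAt (fun x => L x ∘L (Ring.inverse (ContinuousLinearMap.adjoint (L x) ∘L L x)) ∘L
      ContinuousLinearMap.adjoint (L x)) x₀ ∧
    ∀ᶠ x in 𝓝 x₀, IsUnit (ContinuousLinearMap.adjoint (L x) ∘L L x) := by
  have hadj : ContinuousAt (fun x => ContinuousLinearMap.adjoint (L x)) x₀ :=
    ContinuousLinearMap.adjoint.continuous.continuousAt.comp hL
  have hS : ContinuousAt (fun x => ContinuousLinearMap.adjoint (L x) ∘L L x) x₀ :=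
    hadj.clm_comp hL
  have hunit := isUnit_adjoint_comp (L x₀) h
  refine ⟨hL.clm_comp (ContinuousAt.clm_comp ?_ hadj),
    hS.eventually_mem (Units.isOpen.mem_nhds hunit)⟩
  obtain ⟨s, hs⟩ := hunit
  have := NormedRing.inverse_continuousAt s
  rw [hs] at this
  exact ContinuousAt.comp (g := Ring.inverse) this hS

variable {m n : ℕ} {N : Type*} [TopologicalSpace N] [ChartedSpace (Euc n) N]
  [IsManifold (𝓡 n) 2 N] [RiemannianBundle (fun y : N => TangentSpace (𝓡 n) y)]
  {ν : ℕ}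

/-- The differential of `ι` at `y`, as a linear map into `ℝ^ν`. -/
noncomputable def differential (n : ℕ) {N : Type*} [TopologicalSpace N] [ChartedSpace (Euc n) N]
    {ν : ℕ} (ι : N → Euc ν) (y : N) : TangentSpace (𝓡 n) y →L[ℝ] Euc ν :=
  mfderiv (𝓡 n) (𝓡 ν) ι y

/-- The adjoint `ℝ^ν → T_y N` of the differential of `ι` at `y`. -/
noncomputable def tangentialPart (n : ℕ) {N : Type*} [TopologicalSpace N] [ChartedSpace (Euc n) N]
    [RiemannianBundle (fun y : N => TangentSpace (𝓡 n) y)] {ν : ℕ} (ι : N → Euc ν) (y : N) :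
    Euc ν →L[ℝ] TangentSpace (𝓡 n) y :=
  have : CompleteSpace (TangentSpace (𝓡 n) y) := FiniteDimensional.complete ℝ _
  ContinuousLinearMap.adjoint (differential n ι y)

lemma inner_tangentialPart (ι : N → Euc ν) (y : N) (a : Euc ν) (k : TangentSpace (𝓡 n) y) :
    inner ℝ (tangentialPart n ι y a) k = inner ℝ a (differential n ι y k) :=
  have : CompleteSpace (TangentSpace (𝓡 n) y) := FiniteDimensional.complete ℝ _
  ContinuousLinearMap.adjoint_inner_left _ _ _

variable {ι : N → Euc ν}

lemma IsIsometricEmbedding.norm_differential (hι : IsIsometricEmbedding n ι) (y : N)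
    (k : TangentSpace (𝓡 n) y) : ‖(differential n ι y k)‖ = ‖k‖ := by
  have h : inner ℝ (differential n ι y k) (differential n ι y k) = inner ℝ k k := hι.inner_eq y k k
  rw [real_inner_self_eq_norm_sq, real_inner_self_eq_norm_sq] at h
  exact (sq_eq_sq₀ (norm_nonneg _) (norm_nonneg _)).1 h

lemma IsIsometricEmbedding.tangentialPart_differential (hι : IsIsometricEmbedding n ι) (y : N)
    (k : TangentSpace (𝓡 n) y) : tangentialPart n ι y (differential n ι y k) = k := by
  refine ext_inner_right ℝ fun k' => ?_
  rw [inner_tangentialPart]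
  exact hι.inner_eq y k k'

/-- Writing A for the adjoint of dι, |Aa|² = ⟨a, dι(Aa)⟩ ≤ |a| |Aa|. -/
lemma IsIsometricEmbedding.norm_tangentialPart_le (hι : IsIsometricEmbedding n ι) (y : N)
    (a : Euc ν) : ‖tangentialPart n ι y a‖ ≤ ‖a‖ := by
  have h1 := inner_tangentialPart ι y a (tangentialPart n ι y a)
  rw [real_inner_self_eq_norm_sq] at h1
  have h2 := real_inner_le_norm a (differential n ι y (tangentialPart n ι y a))
  rw [hι.norm_differential, ← h1, sq] at h2
  by_contra! h3
  have h4 : 0 < ‖tangentialPart n ι y a‖ := (norm_nonneg a).trans_lt h3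
  exact absurd h2 (not_le.2 (mul_lt_mul_of_pos_right h3 h4))

lemma IsIsometricEmbedding.eq_zero_of_differential (hι : IsIsometricEmbedding n ι) (y : N)
    (v : TangentSpace (𝓡 n) y) (hv : differential n ι y v = 0) : v = 0 := by
  have h := hι.norm_differential y v
  rw [hv, norm_zero] at h
  exact norm_eq_zero.1 h.symm

lemma IsIsometricEmbedding.hasLocalRetractions (hι : IsIsometricEmbedding n ι) :
    HasLocalRetractions (𝓡 n) 2 ι := by
  refine hasLocalRetractions_of_immersion hι.contMDiff hι.isEmbedding hι.eq_zero_of_differential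

/-- The projection onto the tangent space depends continuously on the point. -/
lemma IsIsometricEmbedding.continuous_projection (hι : IsIsometricEmbedding n ι) :
    Continuous (fun y => (differential n ι y) ∘L
      tangentialPart n ι y) := by
  rw [continuous_iff_continuousAt]
  intro y₀
  set ψ := readInChart n ι y₀
  set z₀ := extChartAt (𝓡 n) y₀ y₀
  have hψ : ContDiffAt ℝ 2 ψ z₀ := (hι.contMDiff.contDiffOn_readInChart y₀).contDiffAt
    (extChartAt_target_mem_nhds _)
  have hL : ContinuousAt (fun y => fderiv ℝ ψ (extChartAt (𝓡 n) y₀ y)) y₀ :=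
    ContinuousAt.comp (g := fderiv ℝ ψ) (hψ.fderiv_right (m := 1) (by norm_num)).continuousAt
      (continuousAt_extChartAt y₀)
  have hinj : ∀ v, fderiv ℝ ψ z₀ v = 0 → v = 0 := fun v hv =>
    hι.eq_zero_of_differential y₀ v ((congrArg (fun A : Euc n →L[ℝ] Euc ν => A v)
        (fderiv_readInChart_self hι.contMDiff y₀)).symm.trans hv)
  obtain ⟨hcont, hSunit⟩ := hL.inverse_adjoint_comp hinj
  refine ContinuousAt.congr hcont ?_
  filter_upwards [hSunit, extChartAt_source_mem_nhds (I := 𝓡 n) y₀] with y hy hys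
  set z := extChartAt (𝓡 n) y₀ y
  have hzt : z ∈ (extChartAt (𝓡 n) y₀).target := (extChartAt (𝓡 n) y₀).map_source hys
  have hzy : (extChartAt (𝓡 n) y₀).symm z = y := (extChartAt (𝓡 n) y₀).left_inv hys
  ext1 a
  -- `c` solves the normal equations L*Lc = L*a with L = dψ, so a - Lc is orthogonal to the tangent
  -- space and Lc is the projection of `a`.
  set c : Euc n := Ring.inverse
    (ContinuousLinearMap.adjoint (fderiv ℝ ψ z) ∘L fderiv ℝ ψ z) (ContinuousLinearMap.adjoint (fderiv ℝ ψ z) a)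
  have hc : ContinuousLinearMap.adjoint (fderiv ℝ ψ z) (fderiv ℝ ψ z c) =
      ContinuousLinearMap.adjoint (fderiv ℝ ψ z) a :=
    congrArg (fun A : Euc n →L[ℝ] Euc n => A (ContinuousLinearMap.adjoint (fderiv ℝ ψ z) a))
      (Ring.mul_inverse_cancel _ hy)
  have h1 := fderiv_readInChart hι.contMDiff y₀ hzt
  rw [hzy] at h1
  obtain ⟨c', hc'⟩ : ∃ c' : TangentSpace (𝓡 n) y,
      fderiv ℝ ψ z c = (differential n ι y c') :=
    ⟨(mfderiv (𝓡 n) (𝓡 n) (extChartAt (𝓡 n) y₀).symm z : Euc n →L[ℝ] Euc n) c,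
      congrArg (fun A : Euc n →L[ℝ] Euc ν => A c) h1⟩
  have hys' : y ∈ (chartAt (Euc n) y₀).source := by rwa [extChartAt_source] at hys
  have h2 := mfderiv_eq_fderiv_readInChart_comp hι.contMDiff hys'
  have h3 : tangentialPart n ι y (a - fderiv ℝ ψ z c) = 0 := by
    refine ext_inner_right ℝ fun k => ?_
    rw [inner_tangentialPart, inner_zero_left]
    have h4 : (differential n ι y k) =
      fderiv ℝ ψ z ((mfderiv (𝓡 n) (𝓡 n) (extChartAt (𝓡 n) y₀) y : Euc n →L[ℝ] Euc n) k) :=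
      congrArg (fun A : Euc n →L[ℝ] Euc ν => A k) h2
    have h5 : ∀ k' : Euc n, inner ℝ (a - fderiv ℝ ψ z c) (fderiv ℝ ψ z k') = 0 := fun k' => by
      rw [← ContinuousLinearMap.adjoint_inner_left, map_sub, hc, sub_self, inner_zero_left]
    exact (congrArg (fun b : Euc ν => inner ℝ (a - fderiv ℝ ψ z c) b) h4).trans (h5 _)
  rw [map_sub, sub_eq_zero] at h3
  show fderiv ℝ ψ z c = (differential n ι y (tangentialPart n ι y a))
  rw [h3, hc', hι.tangentialPart_differential]

end Projection

/-! ### Inclusion of the embedded Sobolev space in the intrinsic one. -/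

section EmbeddedSobolev

variable {m n : ℕ} {N : Type*} [TopologicalSpace N] [ChartedSpace (Euc n) N]
  [IsManifold (𝓡 n) 2 N] [RiemannianBundle (fun y : N => TangentSpace (𝓡 n) y)]

lemma hasWeakDerivOn_id {Ω : Set (Euc m)} (hΩ : IsOpen Ω) :
    HasWeakDerivOn Ω (fun x : Euc m => x) (fun _ => ContinuousLinearMap.id ℝ (Euc m)) := by
  have h : HasWeakDerivOn Ω (fun x : Euc m => x) (fderiv ℝ fun x => x) :=
    ContDiffOn.hasWeakDerivOn hΩ contDiffOn_id
  convert h using 2 with x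
  exact fderiv_id.symm

lemma hsNorm₂_le {V W : Type*} [NormedAddCommGroup V] [NormedAddCommGroup W]
    {B : Euc m → Euc m → V} {B' : Euc m → Euc m → W} (h : ∀ e e', ‖B e e'‖ ≤ ‖B' e e'‖) :
    hsNorm₂ B ≤ hsNorm₂ B' :=
  Real.sqrt_le_sqrt (Finset.sum_le_sum fun _ _ => Finset.sum_le_sum fun _ _ =>
    pow_le_pow_left₀ (norm_nonneg _) (h _ _) 2)

lemma LebesgueMeasurableOn.comp_continuous {Y Z : Type*} [TopologicalSpace Y] [TopologicalSpace Z]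
    {Ω : Set (Euc m)} {u : Euc m → Y} (hu : LebesgueMeasurableOn Ω u) {g : Y → Z}
    (hg : Continuous g) : LebesgueMeasurableOn Ω (g ∘ u) :=
  fun O hO => hu (g ⁻¹' O) (hO.preimage hg)

lemma LebesgueMeasurableOn.aestronglyMeasurable {F : Type*} [NormedAddCommGroup F]
    [SecondCountableTopology F] {Ω : Set (Euc m)} (hΩ : MeasurableSet Ω) {f : Euc m → F}
    (hf : LebesgueMeasurableOn Ω f) : AEStronglyMeasurable f (volume.restrict Ω) := by
  borelize F
  have h : NullMeasurable f (volume.restrict Ω) := by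
    have h1 : ∀ t : Set F, MeasurableSet t →
        NullMeasurableSet (f ⁻¹' t) (volume.restrict Ω) := by
      intro t ht
      induction t, ht using MeasurableSpace.generateFrom_induction with
      | hC t ht _ =>
        have := hf t ht
        rw [nullMeasurableSet_restrict hΩ.nullMeasurableSet, inter_comm]
        exact this
      | empty => simp
      | compl t _ ih => exact ih.compl
      | iUnion s _ ih => rw [preimage_iUnion]; exact .iUnion ih
    exact fun t ht => h1 t ht
  exact h.aemeasurable.aestronglyMeasurable

variable {ν : ℕ} {ι : N → Euc ν}

lemma IsIsometricEmbedding.tangentialPart_fderiv_fderiv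
    [IsContMDiffRiemannianBundle (𝓡 n) 1 (Euc n) (fun y : N => TangentSpace (𝓡 n) y)]
    (hι : IsIsometricEmbedding n ι) (y : N) (v w : TangentSpace (𝓡 n) y) :
    tangentialPart n ι y
      (fderiv ℝ (fderiv ℝ (readInChart n ι y)) (extChartAt (𝓡 n) y y) v w : Euc ν) =
      christoffel y v w := by
  refine ext_inner_right ℝ fun k => ?_
  rw [inner_tangentialPart]
  exact hι.inner_fderiv_fderiv y v w k

/-- The Christoffel symbols at `y`, as a bilinear map on `ℝⁿ`. -/
noncomputable def christoffelCoord (y : N) : Euc n →L[ℝ] Euc n →L[ℝ] Euc n := christoffel y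

/-- The adjoint of the differential of `ι`, as a linear map into `ℝⁿ`. -/
noncomputable def tangentialCoord (ι : N → Euc ν) (y : N) : Euc ν →L[ℝ] Euc n :=
  tangentialPart n ι y

lemma vertLift_add_horLift_apply (x : Euc m) (y : N) (ξ : Euc m →L[ℝ] Euc n)
    (B : Euc m →L[ℝ] Euc m →L[ℝ] Euc n) (e : Euc m) :
    ((vertLift x y ξ B + horLift x y ξ) e : Euc m × Euc n × (Euc m →L[ℝ] Euc n)) =
      (e, ξ e, B e - christoffelCoord y (ξ e) ∘L ξ) :=
  Prod.ext (zero_add e) (Prod.ext (zero_add (ξ e)) (sub_eq_add_neg (B e)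
    (christoffelCoord y (ξ e) ∘L ξ)).symm)

/-- The vertical component of a tangent vector to `T*Ω ⊗ TN` in terms of its push-forward. -/
lemma IsIsometricEmbedding.eq_of_homPush_eq
    [IsContMDiffRiemannianBundle (𝓡 n) 1 (Euc n) (fun y : N => TangentSpace (𝓡 n) y)]
    (hι : IsIsometricEmbedding n ι) (y : N) (ξ η : Euc m →L[ℝ] Euc n) (b : Euc n)
    (g : Euc ν) (h : Euc m →L[ℝ] Euc ν)
    (hg : g = fderiv ℝ (readInChart n ι y) (extChartAt (𝓡 n) y y) b)
    (hh : h = (fderiv ℝ (fderiv ℝ (readInChart n ι y)) (extChartAt (𝓡 n) y y) b) ∘L ξ +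
      fderiv ℝ (readInChart n ι y) (extChartAt (𝓡 n) y y) ∘L η) :
    b = tangentialCoord ι y g ∧
    ∀ e, η e = tangentialCoord ι y (h e) -
      christoffelCoord y (tangentialCoord ι y g) (ξ e) := by
  have h1 : ∀ v, tangentialCoord ι y (fderiv ℝ (readInChart n ι y) (extChartAt (𝓡 n) y y) v) = v :=
    fun v => (congrArg (fun A : Euc n →L[ℝ] Euc ν => tangentialCoord ι y (A v))
      (fderiv_readInChart_self hι.contMDiff y)).trans (hι.tangentialPart_differential y v)
  have hb : b = tangentialCoord ι y g := by rw [hg]; exact (h1 b).symm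
  refine ⟨hb, fun e => ?_⟩
  have h2 : h e = fderiv ℝ (fderiv ℝ (readInChart n ι y)) (extChartAt (𝓡 n) y y) b (ξ e) +
      fderiv ℝ (readInChart n ι y) (extChartAt (𝓡 n) y y) (η e) := by rw [hh]; rfl
  have h3 : tangentialCoord ι y (h e) =
      christoffelCoord y b (ξ e) + η e := by
    refine (congrArg (tangentialCoord ι y) h2).trans ?_
    exact ((tangentialPart n ι y).map_add _ _).trans (congrArg₂ (fun v w : Euc n => v + w)
      (hι.tangentialPart_fderiv_fderiv y b (ξ e)) (h1 (η e)))
  have h4 : christoffelCoord y b (ξ e) =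
      christoffelCoord y (tangentialCoord ι y g) (ξ e) :=
    congrArg (fun v : Euc n => christoffelCoord y v (ξ e)) hb
  rw [h3, ← h4, add_sub_cancel_left]

lemma aestronglyMeasurable_compL_comp {μ : Measure (Euc m)} {P : Euc m → (Euc ν →L[ℝ] Euc ν)}
    {H : Euc m → (Euc m →L[ℝ] Euc m →L[ℝ] Euc ν)} (hP : AEStronglyMeasurable P μ)
    (hH : AEStronglyMeasurable H μ) :
    AEStronglyMeasurable (fun x => ContinuousLinearMap.compL ℝ (Euc m) (Euc ν) (Euc ν) (P x) ∘L H x)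
      μ := by
  have h2 : Continuous fun q : (Euc ν →L[ℝ] Euc ν) × (Euc m →L[ℝ] Euc m →L[ℝ] Euc ν) =>
      ContinuousLinearMap.compL ℝ (Euc m) (Euc ν) (Euc ν) q.1 ∘L q.2 :=
    ((ContinuousLinearMap.compL ℝ (Euc m) (Euc ν) (Euc ν)).continuous.comp
      continuous_fst).clm_comp continuous_snd
  exact h2.comp_aestronglyMeasurable (hP.prodMk hH)

/-- Maps that are Sobolev through an isometric embedding are intrinsically Sobolev. -/
theorem IsIsometricEmbedding.sobolevEmb2_subset
    [IsContMDiffRiemannianBundle (𝓡 n) 1 (Euc n) (fun y : N => TangentSpace (𝓡 n) y)]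
    (hι : IsIsometricEmbedding n ι) {Ω : Set (Euc m)} (hΩ : IsOpen Ω) {p : ℝ} (hp : 0 ≤ p) :
    SobolevEmb2 ι Ω p ⊆ Sobolev2 n N Ω p := by
  rintro u ⟨hu, G, H, hG, hH, hHp⟩
  have hret := hι.hasLocalRetractions
  have hι2 := hι.contMDiff
  have hret1 : HasLocalRetractions (𝓡 n) 1 ι := fun y => by
    obtain ⟨O, R, hO, hy, hR, hRι⟩ := hret y
    exact ⟨O, R, hO, hy, hR.of_le (by norm_num), hRι⟩
  have hι1 : ContMDiff (𝓡 n) (𝓡 ν) 1 ι := hι2.of_le (by norm_num)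
  -- The candidates are the tangential parts of `G` and `H`. Nothing is lost for `G`, which is
  -- already tangent; for `H` the normal component is discarded.
  set U : ∀ x, Euc m →L[ℝ] TangentSpace (𝓡 n) (u x) := fun x => tangentialPart n ι (u x) ∘L G x
  set D : ∀ x, Euc m →L[ℝ] Euc m →L[ℝ] TangentSpace (𝓡 n) (u x) := fun x =>
    ContinuousLinearMap.compL ℝ (Euc m) (Euc ν) (Euc n)
      (tangentialPart n ι (u x) : Euc ν →L[ℝ] Euc n) ∘L H x
  have hD : ∀ x e e', D x e e' = tangentialPart n ι (u x) (H x e e') := fun x e e' => rfl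
  have hGU : ∀ᵐ x ∂volume.restrict Ω, G x = differential n ι (u x) ∘L U x := by
    filter_upwards [hret1.ae_exists_mfderiv_eq hι1 hΩ hG (Eventually.of_forall fun _ => rfl)]
      with x hx
    ext1 e
    obtain ⟨η, hη⟩ := hx e
    have hη' : G x e = differential n ι (u x) η := hη
    show G x e = differential n ι (u x) (tangentialPart n ι (u x) (G x e))
    rw [hη', hι.tangentialPart_differential]
  set w : Euc m → Euc m × Euc ν × (Euc m →L[ℝ] Euc ν) := fun x => (x, ι (u x), G x)
  set W : Euc m → (Euc m →L[ℝ] Euc m × Euc ν × (Euc m →L[ℝ] Euc ν)) := fun x =>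
    (ContinuousLinearMap.id ℝ (Euc m)).prod ((G x).prod (H x))
  have hwW : HasWeakDerivOn Ω w W := (hasWeakDerivOn_id hΩ).prodMk (hG.prodMk hH)
  have hret2 := hret.homPush (m := m) hι2
  have hpush := contMDiff_homPush (m := m) hι2
  have hwq : ∀ᵐ x ∂volume.restrict Ω, w x = homPush ι (bundleMap u U x) := by
    filter_upwards [hGU] with x hx
    exact Prod.ext rfl (Prod.ext rfl hx)
  have hW : ∀ᵐ x ∂volume.restrict Ω, W x =
      (mfderiv (homModel m n) 𝓘(ℝ, Euc m × Euc ν × (Euc m →L[ℝ] Euc ν)) (homPush ι)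
        (bundleMap u U x) : TangentSpace (homModel m n) (bundleMap u U x) →L[ℝ]
          Euc m × Euc ν × (Euc m →L[ℝ] Euc ν)) ∘L
        (vertLift x (u x) (U x) (D x) + horLift x (u x) (U x)) := by
    -- Tangency, applied to the prolonged map (x, ι u, G), provides a tangent vector (a, b, η) with
    -- image W e. Its components are then determined by projecting, and the Gauss formula turns η
    -- into the vertical component of `vertLift + horLift`.
    filter_upwards [hret2.ae_exists_mfderiv_eq hpush hΩ hwW hwq, hGU] with x hx hGx
    ext1 e
    obtain ⟨⟨a, b, η⟩, hη⟩ := hx e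
    have h1 := hη.trans (mfderiv_homPush hι2 (bundleMap u U x) a b η)
    have ha : a = e := (congrArg Prod.fst h1).symm
    obtain ⟨hb, hη'⟩ := hι.eq_of_homPush_eq (u x) (U x) η b (G x e) (H x e)
      (congrArg (fun q => q.2.1) h1) (congrArg (fun q => q.2.2) h1)
    have h2 : ((a, b, η) : Euc m × Euc n × (Euc m →L[ℝ] Euc n)) =
        (vertLift x (u x) (U x) (D x) + horLift x (u x) (U x)) e := by
      refine Eq.trans ?_ (vertLift_add_horLift_apply x (u x) (U x) (D x) e).symm
      exact Prod.ext ha (Prod.ext hb (ContinuousLinearMap.ext hη'))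
    exact hη.trans (congrArg (fun v : Euc m × Euc n × (Euc m →L[ℝ] Euc n) =>
      (mfderiv (homModel m n) 𝓘(ℝ, Euc m × Euc ν × (Euc m →L[ℝ] Euc ν)) (homPush ι)
        (bundleMap u U x) : (Euc m × Euc n × (Euc m →L[ℝ] Euc n)) →L[ℝ]
          (Euc m × Euc ν × (Euc m →L[ℝ] Euc ν))) v) h2)
  have hdiff : ColocallyWeaklyDifferentiableOn (𝓡 n) Ω univ u :=
    ⟨hu, mapsTo_univ _ _, fun f hf hfc _ => ⟨_, hret1.hasWeakDerivOn_comp hι1 hΩ hG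
      (Eventually.of_forall fun _ => rfl) hGU hf hfc⟩⟩
  have hmeas : LebesgueMeasurableOn Ω (bundleMap u U) :=
    hret2.lebesgueMeasurableOn hΩ.measurableSet hwW.locallyIntegrable.aestronglyMeasurable hwq
  refine ⟨U, D, ⟨hdiff, hmeas.comp_continuous continuous_snd, fun f hf hfc =>
    hret1.hasWeakDerivOn_comp hι1 hΩ hG (Eventually.of_forall fun _ => rfl) hGU hf hfc⟩,
    ⟨⟨hmeas, fun x hx => ⟨hx, mem_univ _⟩, fun f hf hfc _ => ⟨_,
      hret2.hasWeakDerivOn_comp hpush hΩ hwW hwq hW hf hfc⟩⟩, ?_, fun f hf hfc _ =>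
      hret2.hasWeakDerivOn_comp hpush hΩ hwW hwq hW hf hfc⟩, ?_⟩
  -- The image of (u, D) under `bilinPush` is (ι u, PH) with P the tangential projection; it is
  -- measurable because P is continuous in the point.
  · have hP : AEStronglyMeasurable (fun x =>
        (differential n ι (u x) ∘L tangentialPart n ι (u x) : Euc ν →L[ℝ] Euc ν)) (volume.restrict Ω) :=
      (hu.comp_continuous hι.continuous_projection).aestronglyMeasurable hΩ.measurableSet
    have hHm : AEStronglyMeasurable H (volume.restrict Ω) :=
      hH.locallyIntegrable_deriv.aestronglyMeasurable
    refine (hret.bilinPush hι2).lebesgueMeasurableOn hΩ.measurableSet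
      (w := fun x => (ι (u x), ContinuousLinearMap.compL ℝ (Euc m) (Euc ν) (Euc ν)
        (differential n ι (u x) ∘L tangentialPart n ι (u x)) ∘L H x))
      (hG.locallyIntegrable.aestronglyMeasurable.prodMk ?_) (Eventually.of_forall fun x => rfl)
    exact aestronglyMeasurable_compL_comp hP hHm
  · refine lt_of_le_of_lt (lintegral_mono fun x => ?_) hHp
    refine ENNReal.rpow_le_rpow (ENNReal.ofReal_le_ofReal (hsNorm₂_le fun e e' => ?_)) hp
    rw [hD]
    exact hι.norm_tangentialPart_le _ _

end EmbeddedSobolev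

/-! ### Derivatives of powers of the norm. -/

section NormPower

variable {m : ℕ}

lemma hasFDerivAt_norm_rpow_of_ne_zero {x : Euc m} (hx : x ≠ 0) (β : ℝ) :
    HasFDerivAt (fun x : Euc m => ‖x‖ ^ β) ((β * ‖x‖ ^ (β - 2)) • innerSL ℝ x) x := by
  have hx' : ‖x‖ ≠ 0 := norm_ne_zero_iff.2 hx
  -- Write |x|^β as (|x|²)^(β/2), whose base is smooth and nonzero off the origin.
  have h := (hasStrictFDerivAt_norm_sq x).hasFDerivAt.rpow_const (p := β / 2)
    (Or.inl (pow_ne_zero 2 hx'))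
  have e1 : ∀ (y : Euc m) (s : ℝ), (‖y‖ ^ 2) ^ (s / 2) = ‖y‖ ^ s := fun y s => by
    rw [← Real.rpow_natCast, ← Real.rpow_mul (norm_nonneg _)]
    congr 1
    push_cast
    ring
  have e2 : β / 2 - 1 = (β - 2) / 2 := by ring
  simp only [e2, e1] at h
  refine h.congr_fderiv ?_
  ext v
  simp
  ring

lemma contDiffAt_norm_rpow {x : Euc m} (hx : x ≠ 0) (β : ℝ) {k : ℕ∞} :
    ContDiffAt ℝ k (fun x : Euc m => ‖x‖ ^ β) x :=
  (contDiffAt_norm ℝ hx).rpow_const_of_ne (norm_ne_zero_iff.2 hx)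

lemma fderiv_norm_rpow_of_ne_zero {x : Euc m} (hx : x ≠ 0) (β : ℝ) (e : Euc m) :
    fderiv ℝ (fun x : Euc m => ‖x‖ ^ β) x e = β * ‖x‖ ^ (β - 2) * inner ℝ x e := by
  rw [(hasFDerivAt_norm_rpow_of_ne_zero hx β).fderiv]
  simp

lemma fderiv_fderiv_norm_rpow_of_ne_zero {x : Euc m} (hx : x ≠ 0) (β : ℝ) (e e' : Euc m) :
    fderiv ℝ (fderiv ℝ fun x : Euc m => ‖x‖ ^ β) x e e' =
      β * ‖x‖ ^ (β - 2) * inner ℝ e e' +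
        β * (β - 2) * ‖x‖ ^ (β - 4) * inner ℝ x e * inner ℝ x e' := by
  have h1 : fderiv ℝ (fun x : Euc m => ‖x‖ ^ β) =ᶠ[𝓝 x]
      fun y => (β * ‖y‖ ^ (β - 2)) • (innerSL ℝ : Euc m →L[ℝ] Euc m →L[ℝ] ℝ) y := by
    filter_upwards [isOpen_ne.mem_nhds hx] with y hy
    exact (hasFDerivAt_norm_rpow_of_ne_zero hy β).fderiv
  have h2 := ((hasFDerivAt_norm_rpow_of_ne_zero hx (β - 2)).const_mul β).smul
    ((innerSL ℝ : Euc m →L[ℝ] Euc m →L[ℝ] ℝ).hasFDerivAt (x := x))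
  rw [h1.fderiv_eq, HasFDerivAt.fderiv (f := fun y =>
    (β * ‖y‖ ^ (β - 2)) • (innerSL ℝ : Euc m →L[ℝ] Euc m →L[ℝ] ℝ) y) h2]
  have e2 : β - 2 - 2 = β - 4 := by ring
  have e3 : ∀ a b : Euc m, (innerSL ℝ : Euc m →L[ℝ] Euc m →L[ℝ] ℝ) a b = inner ℝ a b :=
    fun a b => rfl
  simp [e2]
  rw [e3, e3]
  ring

lemma abs_fderiv_norm_rpow_le {x : Euc m} (hx : x ≠ 0) (β : ℝ) (e : Euc m) :
    |fderiv ℝ (fun x : Euc m => ‖x‖ ^ β) x e| ≤ |β| * ‖x‖ ^ (β - 1) * ‖e‖ := by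
  have hx' : 0 < ‖x‖ := norm_pos_iff.2 hx
  rw [fderiv_norm_rpow_of_ne_zero hx, abs_mul, abs_mul, abs_of_nonneg (Real.rpow_nonneg hx'.le _)]
  have h1 : ‖x‖ ^ (β - 1) = ‖x‖ ^ (β - 2) * ‖x‖ := by
    rw [← Real.rpow_add_one hx'.ne']; congr 1; ring
  rw [h1]
  calc |β| * ‖x‖ ^ (β - 2) * |inner ℝ x e| ≤ |β| * ‖x‖ ^ (β - 2) * (‖x‖ * ‖e‖) := by
        gcongr; exact abs_real_inner_le_norm x e
    _ = _ := by ring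

lemma abs_fderiv_fderiv_norm_rpow_le {x : Euc m} (hx : x ≠ 0) (β : ℝ) (e e' : Euc m) :
    |fderiv ℝ (fderiv ℝ fun x : Euc m => ‖x‖ ^ β) x e e'| ≤
      (|β| + |β * (β - 2)|) * ‖x‖ ^ (β - 2) * ‖e‖ * ‖e'‖ := by
  have hx' : 0 < ‖x‖ := norm_pos_iff.2 hx
  have h0 : ∀ s : ℝ, |‖x‖ ^ s| = ‖x‖ ^ s := fun s => abs_of_nonneg (Real.rpow_nonneg hx'.le _)
  have h1 : ‖x‖ ^ (β - 2) = ‖x‖ ^ (β - 4) * ‖x‖ ^ 2 := by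
    rw [← Real.rpow_natCast, ← Real.rpow_add hx']; congr 1; push_cast; ring
  rw [fderiv_fderiv_norm_rpow_of_ne_zero hx]
  refine (abs_add_le _ _).trans ?_
  have h2 : |β * ‖x‖ ^ (β - 2) * inner ℝ e e'| ≤ |β| * ‖x‖ ^ (β - 2) * (‖e‖ * ‖e'‖) := by
    rw [abs_mul, abs_mul, h0]
    gcongr
    exact abs_real_inner_le_norm e e'
  have h3 : |β * (β - 2) * ‖x‖ ^ (β - 4) * inner ℝ x e * inner ℝ x e'| ≤
      |β * (β - 2)| * ‖x‖ ^ (β - 4) * (‖x‖ * ‖e‖) * (‖x‖ * ‖e'‖) := by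
    rw [abs_mul, abs_mul, abs_mul (β * (β - 2)), h0]
    gcongr
    · exact abs_real_inner_le_norm x e
    · exact abs_real_inner_le_norm x e'
  refine (add_le_add h2 h3).trans (le_of_eq ?_)
  rw [h1]; ring

end NormPower

/-! ### Uniform bounds on compact sets. -/

section CompactBounds

/-- Boundedness passes to subsets and to finite unions. No continuity of `φ` is required, which
suits norms taken in varying fibres. -/
lemma IsCompact.exists_forall_le_of_eventually {X : Type*} [TopologicalSpace X] {K : Set X}
    (hK : IsCompact K) {φ : X → ℝ} (h : ∀ p ∈ K, ∃ C, ∀ᶠ q in 𝓝 p, φ q ≤ C) :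
    ∃ C, ∀ q ∈ K, φ q ≤ C := by
  refine hK.induction_on (p := fun s => ∃ C, ∀ q ∈ s, φ q ≤ C) ⟨0, by simp⟩ ?_ ?_ ?_
  · rintro s t hst ⟨C, hC⟩
    exact ⟨C, fun q hq => hC q (hst hq)⟩
  · rintro s t ⟨C, hC⟩ ⟨C', hC'⟩
    refine ⟨max C C', fun q hq => ?_⟩
    rcases hq with hq | hq
    · exact (hC q hq).trans (le_max_left _ _)
    · exact (hC' q hq).trans (le_max_right _ _)
  · intro x hx
    obtain ⟨C, hC⟩ := h x hx
    exact ⟨_, mem_nhdsWithin_of_mem_nhds hC, C, fun q hq => hq⟩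

variable {m n : ℕ} {N : Type*} [TopologicalSpace N] [ChartedSpace (Euc n) N]
  [IsManifold (𝓡 n) 2 N] [RiemannianBundle (fun y : N => TangentSpace (𝓡 n) y)]
  [IsContMDiffRiemannianBundle (𝓡 n) 1 (Euc n) (fun y : N => TangentSpace (𝓡 n) y)]

lemma isContinuousRiemannianBundle_of_contMDiff :
    IsContinuousRiemannianBundle (Euc n) (fun y : N => TangentSpace (𝓡 n) y) := by
  obtain ⟨g, hg, hg'⟩ := IsContMDiffRiemannianBundle.exists_contMDiff (IB := 𝓡 n) (n := 1)
    (F := Euc n) (E := fun y : N => TangentSpace (𝓡 n) y)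
  exact ⟨g, hg.continuous, hg'⟩

/-- A compactly supported `C¹` function is Lipschitz for the Riemannian metric. -/
lemma ContMDiff.exists_forall_abs_mfderiv_le {f : N → ℝ} (hf : ContMDiff (𝓡 n) 𝓘(ℝ, ℝ) 1 f)
    (hfc : HasCompactSupport f) {A : ∀ y : N, TangentSpace (𝓡 n) y →L[ℝ] ℝ}
    (hA : ∀ y, A y = mfderiv (𝓡 n) 𝓘(ℝ, ℝ) f y) :
    ∃ C : ℝ, 0 ≤ C ∧ ∀ (y : N) (v : TangentSpace (𝓡 n) y), |A y v| ≤ C * ‖v‖ := by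
  have := isContinuousRiemannianBundle_of_contMDiff (n := n) (N := N)
  obtain ⟨C, hC⟩ := hfc.isCompact.exists_forall_le_of_eventually (φ := fun y => ‖A y‖) (fun y _ => by
      -- The chart differential is locally bounded from the Riemannian norm to the Euclidean one, so
      -- a local bound on the coordinate derivative of `f` gives an intrinsic bound.
      obtain ⟨C₁, hC₁, h1⟩ := eventually_norm_mfderiv_extChartAt_lt (𝓡 n) y
      have hc : ContinuousAt (fun y' => ‖fderiv ℝ (readInChart n f y) (extChartAt (𝓡 n) y y')‖) y :=
        (ContinuousAt.comp (g := fderiv ℝ (readInChart n f y))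
          (((hf.contDiffOn_readInChart y).contDiffAt (extChartAt_target_mem_nhds _)).fderiv_right
            (m := 0) (by norm_num)).continuousAt (continuousAt_extChartAt y)).norm
      refine ⟨(‖fderiv ℝ (readInChart n f y) (extChartAt (𝓡 n) y y)‖ + 1) * C₁, ?_⟩
      filter_upwards [h1, hc.eventually_lt continuousAt_const (lt_add_one _),
        chart_source_mem_nhds (Euc n) y] with y' h2 h3 h4
      obtain ⟨B, hB, hBC⟩ : ∃ B : TangentSpace (𝓡 n) y' →L[ℝ] Euc n,
          B = mfderiv (𝓡 n) (𝓡 n) (extChartAt (𝓡 n) y) y' ∧ ‖B‖ < C₁ := ⟨_, rfl, h2⟩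
      have h5 : A y' = fderiv ℝ (readInChart n f y) (extChartAt (𝓡 n) y y') ∘L B := by
        rw [hB]
        exact (hA y').trans (hf.mfderiv_eq_fderiv_readInChart_comp h4)
      rw [h5]
      exact (ContinuousLinearMap.opNorm_comp_le _ _).trans
        (mul_le_mul h3.le hBC.le (norm_nonneg _) (by positivity)))
  refine ⟨max C 0, le_max_right _ _, fun y v => ?_⟩
  by_cases hy : y ∈ tsupport f
  · refine ((A y).le_opNorm v).trans ?_
    gcongr
    exact (hC y hy).trans (le_max_left _ _)
  · have h0 : f =ᶠ[𝓝 y] fun _ => (0 : ℝ) := by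
      filter_upwards [(isClosed_tsupport f).isOpen_compl.mem_nhds hy] with z hz
      exact image_eq_zero_of_notMem_tsupport hz
    have h1 : A y = 0 := (hA y).trans (h0.mfderiv_eq.trans mfderiv_const)
    rw [h1, zero_apply, abs_zero]
    positivity

/-- The norm is bounded on compact sets of `T*Ω ⊗ TN`. -/
lemma IsCompact.exists_forall_hsNorm_le {K : Set (Euc m × HomTangent m n N)}
    (hK : IsCompact K) : ∃ C : ℝ, ∀ q ∈ K,
      hsNorm (fun e => (q.2.2 e : TangentSpace (𝓡 n) q.2.1)) ≤ C := by
  refine hK.exists_forall_le_of_eventually fun p _ => ?_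
  have hproj : ContinuousAt (fun q : Euc m × HomTangent m n N => q.2.1) p :=
    ((FiberBundle.continuous_proj (Euc m →L[ℝ] Euc n)
      (fun y : N => Bundle.Trivial N (Euc m) y →L[ℝ] TangentSpace (𝓡 n) y)).comp
      continuous_snd).continuousAt
  have hG : ContinuousAt (fun q : Euc m × HomTangent m n N =>
      metricInChart p.2.1 (extChartAt (𝓡 n) p.2.1 q.2.1)) p := by
    have h1 : ContinuousAt (metricInChart p.2.1) (extChartAt (𝓡 n) p.2.1 p.2.1) :=
      ((contDiffOn_metricInChart p.2.1).contDiffAt (extChartAt_target_mem_nhds _)).continuousAt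
    have h2 : ContinuousAt (fun q : Euc m × HomTangent m n N => extChartAt (𝓡 n) p.2.1 q.2.1) p :=
      ContinuousAt.comp (g := extChartAt (𝓡 n) p.2.1) (continuousAt_extChartAt p.2.1) hproj
    exact ContinuousAt.comp (g := metricInChart p.2.1) h1 h2
  have ha : ∀ e : Euc m, ContinuousAt (fun q => (extChartAt (homModel m n) p q).2.2 e) p :=
    fun e => (continuousAt_extChartAt (I := homModel m n) p).snd.snd.clm_apply continuousAt_const
  -- Near `p` this function of the coordinates equals the Hilbert–Schmidt norm, and it is continuous
  -- at `p`, hence locally bounded.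
  set Ψ : Euc m × HomTangent m n N → ℝ := fun q => Real.sqrt (∑ i,
    metricInChart p.2.1 (extChartAt (𝓡 n) p.2.1 q.2.1)
      ((extChartAt (homModel m n) p q).2.2 (EuclideanSpace.single i 1))
      ((extChartAt (homModel m n) p q).2.2 (EuclideanSpace.single i 1)))
  have hΨ : ContinuousAt Ψ p :=
    (tendsto_finsetSum _ fun i _ => (hG.clm_apply (ha _)).clm_apply (ha _)).sqrt
  refine ⟨Ψ p + 1, ?_⟩
  filter_upwards [hΨ.eventually_lt continuousAt_const (lt_add_one _),
    hproj.eventually (chart_source_mem_nhds (Euc n) p.2.1)] with q h3 h4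
  refine le_trans (le_of_eq ?_) h3.le
  refine congrArg Real.sqrt (Finset.sum_congr rfl fun i _ => ?_)
  rw [extChartAt_hom p q h4, ← real_inner_self_eq_norm_sq]
  exact (metricInChart_mfderiv h4 _ _).symm

end CompactBounds

/-! ### The tangent map of a C² map, as a map into the bundle. -/

section BundleMap

variable {m n : ℕ} {N : Type*} [TopologicalSpace N] [ChartedSpace (Euc n) N]
  [IsManifold (𝓡 n) 2 N] {b : Euc m → N} {x₀ : Euc m}
  {U : ∀ x, Euc m →L[ℝ] TangentSpace (𝓡 n) (b x)}

lemma ContMDiffAt.eventually_comp_eq (hb : ContMDiffAt (𝓡 m) (𝓡 n) 2 b x₀)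
    (hU : ∀ᶠ x in 𝓝 x₀, U x = mfderiv (𝓡 m) (𝓡 n) b x) :
    ∀ᶠ x in 𝓝 x₀, (mfderiv (𝓡 n) (𝓡 n) (extChartAt (𝓡 n) (b x₀)) (b x)) ∘L U x =
      fderiv ℝ (fun x => extChartAt (𝓡 n) (b x₀) (b x)) x := by
  have h3 : ∀ᶠ x in 𝓝 x₀, MDifferentiableAt (𝓡 m) (𝓡 n) b x := by
    have h := (contMDiffAt_iff_contMDiffAt_nhds (n := 1) (by simp)).1 (hb.of_le (by norm_num))
    exact h.mono fun x hx => ContMDiffAt.mdifferentiableAt hx (by simp)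
  filter_upwards [h3, ContinuousAt.eventually_mem_chartAt_source (n := n) hb.continuousAt, hU]
    with x h5 h6 h7
  rw [h7]
  exact mfderiv_extChartAt_comp_mfderiv h5 h6

lemma ContMDiffAt.contMDiffAt_bundleMap (hb : ContMDiffAt (𝓡 m) (𝓡 n) 2 b x₀)
    (hU : ∀ᶠ x in 𝓝 x₀, U x = mfderiv (𝓡 m) (𝓡 n) b x) :
    ContMDiffAt (𝓡 m) (homModel m n) 1 (bundleMap b U) x₀ := by
  have h1 : ContDiffAt ℝ 1 (fderiv ℝ (fun x => extChartAt (𝓡 n) (b x₀) (b x))) x₀ :=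
    hb.contDiffAt_extChartAt.fderiv_right (m := 1) (by norm_num)
  exact contMDiffAt_id.prodMk (contMDiffAt_homTangent_mk (hb.of_le (by norm_num)) h1
    (hb.eventually_comp_eq hU))

/-- In the bundle chart preferred at x₀ the map reads x ↦ (x, c x, Dc x), with c the coordinate
expression of `b`, and this is differentiated directly. -/
lemma ContMDiffAt.mfderiv_bundleMap (hb : ContMDiffAt (𝓡 m) (𝓡 n) 2 b x₀)
    (hU : ∀ᶠ x in 𝓝 x₀, U x = mfderiv (𝓡 m) (𝓡 n) b x) (e : Euc m) :
    (mfderiv (𝓡 m) (homModel m n) (bundleMap b U) x₀ e : Euc m × Euc n × (Euc m →L[ℝ] Euc n)) =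
      (e, fderiv ℝ (fun x => extChartAt (𝓡 n) (b x₀) (b x)) x₀ e,
        fderiv ℝ (fderiv ℝ (fun x => extChartAt (𝓡 n) (b x₀) (b x))) x₀ e) := by
  set c : Euc m → Euc n := fun x => extChartAt (𝓡 n) (b x₀) (b x)
  have hc : ContDiffAt ℝ 2 c x₀ := hb.contDiffAt_extChartAt
  have h1 : ContDiffAt ℝ 1 (fderiv ℝ c) x₀ := hc.fderiv_right (m := 1) (by norm_num)
  set p := bundleMap b U x₀ with hp
  have h2 : extChartAt (homModel m n) p ∘ bundleMap b U =ᶠ[𝓝 x₀]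
      fun x => (x, c x, fderiv ℝ c x) := by
    filter_upwards [hb.eventually_comp_eq hU,
      ContinuousAt.eventually_mem_chartAt_source (n := n) hb.continuousAt] with x hx hx'
    rw [Function.comp_apply, extChartAt_hom p (bundleMap b U x) hx']
    exact Prod.ext rfl (Prod.ext rfl hx)
  have h3 : HasFDerivAt (fun x => (x, c x, fderiv ℝ c x)) ((ContinuousLinearMap.id ℝ (Euc m)).prod
      ((fderiv ℝ c x₀).prod (fderiv ℝ (fderiv ℝ c) x₀))) x₀ :=
    (hasFDerivAt_id x₀).prodMk ((hc.differentiableAt (by norm_num)).hasFDerivAt.prodMk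
      (h1.differentiableAt (by simp)).hasFDerivAt)
  have h4 := mfderiv_comp x₀ (mdifferentiableAt_extChartAt (I := homModel m n)
    (mem_chart_source _ p)) ((hb.contMDiffAt_bundleMap hU).mdifferentiableAt (by simp))
  rw [mfderiv_extChartAt_self] at h4
  have h5 := congrArg (fun A : Euc m →L[ℝ] Euc m × Euc n × (Euc m →L[ℝ] Euc n) => A e)
    (h4.symm.trans h2.mfderiv_eq)
  refine Eq.trans h5 ?_
  rw [mfderiv_eq_fderiv, h3.fderiv]
  rfl

end BundleMap

/-! ### The map γ(|x|^β) and its derivatives away from the origin. -/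

section RadialCurve

variable {m n : ℕ} {N : Type*} [TopologicalSpace N] [ChartedSpace (Euc n) N]
  [IsManifold (𝓡 n) 2 N]

/-- The velocity of a curve. -/
noncomputable def velocity (n : ℕ) {N : Type*} [TopologicalSpace N] [ChartedSpace (Euc n) N]
    (γ : ℝ → N) (t : ℝ) : TangentSpace (𝓡 n) (γ t) :=
  mfderiv 𝓘(ℝ, ℝ) (𝓡 n) γ t 1

/-- The map `x ↦ γ (|x|^β)`. -/
noncomputable def radialCurve (γ : ℝ → N) (β : ℝ) (x : Euc m) : N := γ (‖x‖ ^ β)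

/-- The differential of `x ↦ γ (|x|^β)`. -/
noncomputable def radialDeriv (n : ℕ) {N : Type*} [TopologicalSpace N] [ChartedSpace (Euc n) N]
    (γ : ℝ → N) (β : ℝ) (x : Euc m) : Euc m →L[ℝ] TangentSpace (𝓡 n) (radialCurve γ β x) :=
  ((fderiv ℝ (fun x : Euc m => ‖x‖ ^ β) x).smulRight (velocity n γ (‖x‖ ^ β) : Euc n) :
    Euc m →L[ℝ] Euc n)

/-- The covariant second derivative of `x ↦ γ (|x|^β)`, when `γ` is a geodesic. -/
noncomputable def radialHess (n : ℕ) {N : Type*} [TopologicalSpace N] [ChartedSpace (Euc n) N]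
    (γ : ℝ → N) (β : ℝ) (x : Euc m) :
    Euc m →L[ℝ] Euc m →L[ℝ] TangentSpace (𝓡 n) (radialCurve γ β x) :=
  (ContinuousLinearMap.compL ℝ (Euc m) ℝ (Euc n)
    (ContinuousLinearMap.toSpanSingleton ℝ (velocity n γ (‖x‖ ^ β) : Euc n)) ∘L
      fderiv ℝ (fderiv ℝ (fun x : Euc m => ‖x‖ ^ β)) x : Euc m →L[ℝ] Euc m →L[ℝ] Euc n)

variable {γ : ℝ → N} {β : ℝ}

lemma contMDiffAt_radialCurve (hγ : ContMDiff 𝓘(ℝ, ℝ) (𝓡 n) 2 γ) {x : Euc m} (hx : x ≠ 0) :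
    ContMDiffAt (𝓡 m) (𝓡 n) 2 (radialCurve γ β) x :=
  ContMDiffAt.comp x (g := γ) (f := fun x : Euc m => ‖x‖ ^ β) (hγ _)
    (contDiffAt_norm_rpow hx β (k := 2)).contMDiffAt

lemma radialDeriv_eq_mfderiv (hγ : ContMDiff 𝓘(ℝ, ℝ) (𝓡 n) 2 γ) {x : Euc m} (hx : x ≠ 0) :
    radialDeriv n γ β x = mfderiv (𝓡 m) (𝓡 n) (radialCurve γ β) x := by
  have hρ : DifferentiableAt ℝ (fun x : Euc m => ‖x‖ ^ β) x :=
    (contDiffAt_norm_rpow hx β (k := 1)).differentiableAt (by simp)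
  have h : mfderiv (𝓡 m) (𝓡 n) (radialCurve γ β) x = _ :=
    mfderiv_comp (I' := 𝓘(ℝ, ℝ)) x (hγ.mdifferentiable (by norm_num) (‖x‖ ^ β))
    hρ.mdifferentiableAt
  rw [h, mfderiv_eq_fderiv]
  ext1 e
  have h2 : ∀ (A : ℝ →L[ℝ] Euc n) (s : ℝ), s • A 1 = A s := fun A s => by
    rw [← A.map_smul, smul_eq_mul, mul_one]
  exact h2 (mfderiv 𝓘(ℝ, ℝ) (𝓡 n) γ (‖x‖ ^ β)) _

lemma eventually_radialDeriv_eq_mfderiv (hγ : ContMDiff 𝓘(ℝ, ℝ) (𝓡 n) 2 γ) {x : Euc m}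
    (hx : x ≠ 0) :
    ∀ᶠ x in 𝓝 x, radialDeriv n γ β x = mfderiv (𝓡 m) (𝓡 n) (radialCurve γ β) x := by
  filter_upwards [isOpen_ne.mem_nhds hx] with y hy
  exact radialDeriv_eq_mfderiv hγ hy

/-- The velocity in coordinates. -/
lemma mfderiv_extChartAt_velocity (hγ : ContMDiff 𝓘(ℝ, ℝ) (𝓡 n) 2 γ) {t t₀ : ℝ}
    (h : γ t ∈ (chartAt (Euc n) (γ t₀)).source) :
    (mfderiv (𝓡 n) (𝓡 n) (extChartAt (𝓡 n) (γ t₀)) (γ t) : Euc n →L[ℝ] Euc n) (velocity n γ t) =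
      deriv (fun s => extChartAt (𝓡 n) (γ t₀) (γ s)) t :=
  congrArg (fun A : ℝ →L[ℝ] Euc n => A 1)
    (mfderiv_extChartAt_comp_mfderiv (hγ.mdifferentiable (by norm_num) t) h)

lemma velocity_eq_deriv (hγ : ContMDiff 𝓘(ℝ, ℝ) (𝓡 n) 2 γ) (t : ℝ) :
    (velocity n γ t : Euc n) = deriv (fun s => extChartAt (𝓡 n) (γ t) (γ s)) t := by
  refine Eq.trans ?_ (mfderiv_extChartAt_velocity hγ (mem_chart_source _ _))
  exact (congrArg (fun A : Euc n →L[ℝ] Euc n => A (velocity n γ t))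
    (mfderiv_extChartAt_self (I := 𝓡 n) (x := γ t))).symm

/-- The first two derivatives of `x ↦ c (|x|^β)`. -/
lemma fderiv_comp_norm_rpow {c : ℝ → Euc n} {x : Euc m} (hx : x ≠ 0)
    (hc : ContDiffAt ℝ 2 c (‖x‖ ^ β)) :
    (∀ e, fderiv ℝ (fun x => c (‖x‖ ^ β)) x e =
      fderiv ℝ (fun x : Euc m => ‖x‖ ^ β) x e • deriv c (‖x‖ ^ β)) ∧
    ∀ e e', fderiv ℝ (fderiv ℝ (fun x => c (‖x‖ ^ β))) x e e' =
      fderiv ℝ (fderiv ℝ (fun x : Euc m => ‖x‖ ^ β)) x e e' • deriv c (‖x‖ ^ β) +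
      (fderiv ℝ (fun x : Euc m => ‖x‖ ^ β) x e * fderiv ℝ (fun x : Euc m => ‖x‖ ^ β) x e') •
        deriv (deriv c) (‖x‖ ^ β) := by
  set ρ : Euc m → ℝ := fun x => ‖x‖ ^ β
  have hρ : ContDiffAt ℝ 2 ρ x := contDiffAt_norm_rpow hx β (k := 2)
  have hρ1 : ContDiffAt ℝ 1 (fderiv ℝ ρ) x := hρ.fderiv_right (m := 1) (by norm_num)
  have hcd : ∀ᶠ y in 𝓝 x, DifferentiableAt ℝ c (ρ y) := by
    have h1 : ∀ᶠ t in 𝓝 (ρ x), ContDiffAt ℝ 2 c t := hc.eventually (by simp)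
    exact hρ.continuousAt.eventually (h1.mono fun t ht => ht.differentiableAt (by norm_num))
  have hρd : ∀ᶠ y in 𝓝 x, DifferentiableAt ℝ ρ y :=
    (hρ.eventually (by simp)).mono fun y hy => hy.differentiableAt (by norm_num)
  have h1 : fderiv ℝ (fun y => c (ρ y)) =ᶠ[𝓝 x]
      fun y => (fderiv ℝ ρ y).smulRight (deriv c (ρ y)) := by
    filter_upwards [hcd, hρd] with y h2 h3
    rw [HasFDerivAt.fderiv (f := fun y => c (ρ y))
      (h2.hasDerivAt.hasFDerivAt.comp y h3.hasFDerivAt)]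
    ext1 v
    simp
  refine ⟨fun e => by rw [h1.self_of_nhds]; rfl, fun e e' => ?_⟩
  have hc1 : ContDiffAt ℝ 1 (deriv c) (ρ x) := by
    have h : ContDiffAt ℝ 1 (fun t => fderiv ℝ c t 1) (ρ x) :=
      (hc.fderiv_right (m := 1) (by norm_num)).clm_apply contDiffAt_const
    exact h
  have h2 : HasFDerivAt (fun y => deriv c (ρ y)) _ x :=
    (hc1.differentiableAt (by simp)).hasDerivAt.hasFDerivAt.comp x
      (hρ.differentiableAt (by norm_num)).hasFDerivAt
  have h3 := ((ContinuousLinearMap.smulRightL ℝ (Euc m) (Euc n)).isBoundedBilinearMap.hasFDerivAt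
    (fderiv ℝ ρ x, deriv c (ρ x))).comp x
      ((hρ1.differentiableAt (by simp)).hasFDerivAt.prodMk h2)
  have h4 : HasFDerivAt (fun y => (fderiv ℝ ρ y).smulRight (deriv c (ρ y))) _ x := h3
  rw [h1.fderiv_eq, h4.fderiv]
  show fderiv ℝ ρ x e' • fderiv ℝ ρ x e • deriv (deriv c) (ρ x) +
    fderiv ℝ (fderiv ℝ ρ) x e e' • deriv c (ρ x) = _
  rw [smul_smul, add_comm, mul_comm]

variable [RiemannianBundle (fun y : N => TangentSpace (𝓡 n) y)]

/-- The tangent map of `Tu` for `u = γ(|x|^β)` is the sum of the vertical lift of the covariant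
derivative and of the horizontal lift. -/
lemma IsGeodesic.mfderiv_bundleMap_radialCurve (hγ : IsGeodesic n γ) {x : Euc m} (hx : x ≠ 0) :
    (mfderiv (𝓡 m) (homModel m n) (bundleMap (radialCurve γ β) (radialDeriv n γ β)) x :
      Euc m →L[ℝ] TangentSpace (homModel m n) _) =
    vertLift x (radialCurve γ β x) (radialDeriv n γ β x) (radialHess n γ β x) +
      horLift x (radialCurve γ β x) (radialDeriv n γ β x) := by
  have hγ2 := hγ.1
  have hgeo := hγ.2 (‖x‖ ^ β)
  ext1 e
  refine Eq.trans ((contMDiffAt_radialCurve hγ2 hx).mfderiv_bundleMap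
    (eventually_radialDeriv_eq_mfderiv hγ2 hx) e) (Eq.trans ?_
    (vertLift_add_horLift_apply x (radialCurve γ β x) (radialDeriv n γ β x)
      (radialHess n γ β x) e).symm)
  set c : ℝ → Euc n := fun s => extChartAt (𝓡 n) (γ (‖x‖ ^ β)) (γ s)
  have hc : ContDiffAt ℝ 2 c (‖x‖ ^ β) := (hγ2 _).contDiffAt_extChartAt
  obtain ⟨h1, h2⟩ := fderiv_comp_norm_rpow hx hc
  have hv : (velocity n γ (‖x‖ ^ β) : Euc n) = deriv c (‖x‖ ^ β) := velocity_eq_deriv hγ2 _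
  refine Prod.ext rfl (Prod.ext ?_ ?_)
  · refine (h1 e).trans ?_
    rw [← hv]
    rfl
  · ext1 e'
    refine (h2 e e').trans ?_
    -- With ρ = |x|^β, the second derivative of c ∘ ρ is D²ρ c' + (Dρ ⊗ Dρ) c''. The geodesic
    -- equation c'' = -Γ(c', c') turns the last term into the vertical component of the horizontal
    -- lift, and D²ρ c' remains as covariant derivative.
    have hg : deriv (deriv c) (‖x‖ ^ β) = - christoffelCoord (γ (‖x‖ ^ β))
        (velocity n γ (‖x‖ ^ β)) (velocity n γ (‖x‖ ^ β)) := by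
      rw [hv]
      exact eq_neg_of_add_eq_zero_left hgeo
    rw [hg, ← hv]
    let v : Euc n := velocity n γ (‖x‖ ^ β)
    show fderiv ℝ (fderiv ℝ fun x : Euc m => ‖x‖ ^ β) x e e' • v +
      (fderiv ℝ (fun x : Euc m => ‖x‖ ^ β) x e * fderiv ℝ (fun x : Euc m => ‖x‖ ^ β) x e') •
        -christoffelCoord (γ (‖x‖ ^ β)) v v =
      fderiv ℝ (fderiv ℝ fun x : Euc m => ‖x‖ ^ β) x e e' • v - christoffelCoord (γ (‖x‖ ^ β))
        (fderiv ℝ (fun x : Euc m => ‖x‖ ^ β) x e • v)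
        (fderiv ℝ (fun x : Euc m => ‖x‖ ^ β) x e' • v)
    rw [map_smul, map_smul, smul_apply, smul_smul, smul_neg, sub_eq_add_neg,
      mul_comm (fderiv ℝ (fun x : Euc m => ‖x‖ ^ β) x e)]

end RadialCurve

/-! ### Colocal weak differentiability of the radial map across the origin. -/

section RadialSobolev

variable {m n : ℕ} {N : Type*} [TopologicalSpace N] [ChartedSpace (Euc n) N]
  [IsManifold (𝓡 n) 2 N] {Ω : Set (Euc m)}

lemma volume_singleton_zero (hm : 1 ≤ m) : volume ({0} : Set (Euc m)) = 0 := by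
  have := nontrivial_euc hm
  exact measure_singleton 0

/-- Away from the origin preimages of open sets are open, and the origin is a null set. -/
lemma lebesgueMeasurableOn_of_continuousAt (hm : 1 ≤ m) (hΩ : IsOpen Ω) {Y : Type*}
    [TopologicalSpace Y] {q : Euc m → Y} (hq : ∀ x ≠ 0, ContinuousAt q x) :
    LebesgueMeasurableOn Ω q := by
  intro O hO
  have h1 : IsOpen ((Ω \ {0}) ∩ q ⁻¹' O) := ContinuousOn.isOpen_inter_preimage
    (fun x hx => (hq x hx.2).continuousWithinAt) (hΩ.sdiff isClosed_singleton) hO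
  have h2 : Ω ∩ q ⁻¹' O = ((Ω \ {0}) ∩ q ⁻¹' O) ∪ (Ω ∩ q ⁻¹' O ∩ {0}) := by
    ext x
    by_cases hx : x = 0 <;> simp [hx]
  rw [h2]
  exact h1.measurableSet.nullMeasurableSet.union
    (NullMeasurableSet.of_null (measure_mono_null inter_subset_right (volume_singleton_zero hm)))

lemma integrableOn_norm_rpow (hm : 1 ≤ m) {s : ℝ} (hs : s < m) (R : ℝ) :
    IntegrableOn (fun x : Euc m => ‖x‖ ^ (-s)) (Metric.ball 0 R) := by
  refine integrableOn_ball_of_norm_le_rpow (by simpa using hm) (C := 1) (α := s) (by simpa using hs)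
    (Eventually.of_forall fun x => ?_)
    (measurable_norm.pow_const _).aestronglyMeasurable
  rw [one_mul, Real.norm_of_nonneg (Real.rpow_nonneg (norm_nonneg _) _)]

lemma ae_restrict_ne_zero (hm : 1 ≤ m) (Ω : Set (Euc m)) : ∀ᵐ x ∂volume.restrict Ω, x ≠ 0 := by
  refine ae_restrict_of_ae ?_
  rw [ae_iff]
  simpa using volume_singleton_zero hm

/-- Local integrability of `g` up to the origin is automatic here: a compact subset of `Ω` with the
small ball removed is a compact subset of `Ω \ {0}`. -/
lemma HasWeakDerivOn.of_diff_zero_of_eq_zero (hm : 2 ≤ m) (hΩ : IsOpen Ω) {F : Euc m → ℝ}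
    {g : Euc m → (Euc m →L[ℝ] ℝ)} (h : HasWeakDerivOn (Ω \ {0}) F g) {M : ℝ}
    (hM : ∀ x, ‖F x‖ ≤ M) {δ : ℝ} (hδ : 0 < δ)
    (hg : ∀ x ∈ Metric.ball (0 : Euc m) δ, x ≠ 0 → g x = 0) : HasWeakDerivOn Ω F g := by
  refine h.of_diff_zero hm hΩ (M := M) (fun x _ => hM x) ?_
  refine (locallyIntegrableOn_iff hΩ.isLocallyClosed).2 fun k hk hkc => ?_
  rw [← inter_union_sdiff k (Metric.ball (0 : Euc m) δ)]
  refine IntegrableOn.union ?_ ?_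
  · refine Integrable.congr (integrable_zero (Euc m) (Euc m →L[ℝ] ℝ) _) ?_
    filter_upwards [ae_restrict_ne_zero (by omega) (k ∩ Metric.ball (0 : Euc m) δ),
      ae_restrict_mem (hkc.measurableSet.inter measurableSet_ball)] with x hx0 hx
    exact (hg x hx.2 hx0).symm
  · refine h.locallyIntegrable_deriv.integrableOn_compact_subset (fun x hx => ⟨hk hx.1, ?_⟩)
      (hkc.diff Metric.isOpen_ball)
    rintro rfl
    exact hx.2 (Metric.mem_ball_self hδ)

variable [RiemannianBundle (fun y : N => TangentSpace (𝓡 n) y)] {γ : ℝ → N} {β l : ℝ}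

lemma norm_radialDeriv (hl : ∀ t, ‖velocity n γ t‖ = l) (x e : Euc m) :
    ‖radialDeriv n γ β x e‖ = |fderiv ℝ (fun x : Euc m => ‖x‖ ^ β) x e| * l := by
  rw [← hl (‖x‖ ^ β)]
  exact norm_smul (α := ℝ) (β := TangentSpace (𝓡 n) (γ (‖x‖ ^ β)))
    (fderiv ℝ (fun x : Euc m => ‖x‖ ^ β) x e) (velocity n γ (‖x‖ ^ β))

lemma norm_radialHess (hl : ∀ t, ‖velocity n γ t‖ = l) (x e e' : Euc m) :
    ‖radialHess n γ β x e e'‖ =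
      |fderiv ℝ (fderiv ℝ (fun x : Euc m => ‖x‖ ^ β)) x e e'| * l := by
  rw [← hl (‖x‖ ^ β)]
  exact norm_smul (α := ℝ) (β := TangentSpace (𝓡 n) (γ (‖x‖ ^ β)))
    (fderiv ℝ (fderiv ℝ (fun x : Euc m => ‖x‖ ^ β)) x e e') (velocity n γ (‖x‖ ^ β))

/-- The gradient of |x|^β is radial of length |β||x|^(β-1), and the speed is constant. An equality
is needed, since the divergence of the first energy and the failure of membership in the embedded
space use it from below. -/
lemma hsNorm_radialDeriv (hl : ∀ t, ‖velocity n γ t‖ = l) {x : Euc m} (hx : x ≠ 0) :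
    hsNorm (fun e => radialDeriv n γ β x e) = |β| * l * ‖x‖ ^ (β - 1) := by
  have hx' : 0 < ‖x‖ := norm_pos_iff.2 hx
  have hl0 : 0 ≤ l := by rw [← hl 0]; exact norm_nonneg _
  have h1 : ∀ i : Fin m, ‖radialDeriv n γ β x (EuclideanSpace.single i 1)‖ ^ 2 =
      (β * ‖x‖ ^ (β - 2) * l) ^ 2 * (x i) ^ 2 := fun i => by
    rw [norm_radialDeriv hl, mul_pow, sq_abs,
      fderiv_norm_rpow_of_ne_zero hx]
    have : inner ℝ x (EuclideanSpace.single i (1 : ℝ)) = x i := by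
      simp [EuclideanSpace.inner_single_right]
    rw [this]
    ring
  have h2 : ‖x‖ ^ (β - 1) = ‖x‖ ^ (β - 2) * ‖x‖ := by
    rw [← Real.rpow_add_one hx'.ne']; congr 1; ring
  rw [hsNorm, Finset.sum_congr rfl fun i _ => h1 i, ← Finset.mul_sum,
    ← EuclideanSpace.real_norm_sq_eq, ← mul_pow, Real.sqrt_sq_eq_abs, abs_mul, abs_mul, abs_mul,
    abs_norm, abs_of_nonneg (Real.rpow_nonneg hx'.le _), abs_of_nonneg hl0, h2]
  ring

/-- The factor m is the square root of the number m² of entries, each bounded by the same quantity.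
-/
lemma hsNorm₂_radialHess_le (hl : ∀ t, ‖velocity n γ t‖ = l) {x : Euc m} (hx : x ≠ 0) :
    hsNorm₂ (fun e e' => radialHess n γ β x e e') ≤
      m * ((|β| + |β * (β - 2)|) * l) * ‖x‖ ^ (β - 2) := by
  have hx' : 0 < ‖x‖ := norm_pos_iff.2 hx
  have hl0 : 0 ≤ l := by rw [← hl 0]; exact norm_nonneg _
  have h1 : ∀ i j : Fin m,
      ‖radialHess n γ β x (EuclideanSpace.single i 1) (EuclideanSpace.single j 1)‖ ^ 2 ≤
        ((|β| + |β * (β - 2)|) * ‖x‖ ^ (β - 2) * l) ^ 2 := fun i j => by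
    refine pow_le_pow_left₀ (norm_nonneg _) ?_ 2
    rw [norm_radialHess hl]
    gcongr
    simpa using abs_fderiv_fderiv_norm_rpow_le hx β (EuclideanSpace.single i 1)
      (EuclideanSpace.single j 1)
  rw [hsNorm₂]
  refine Real.sqrt_le_iff.2 ⟨by positivity, ?_⟩
  refine (Finset.sum_le_sum fun i _ => Finset.sum_le_sum fun j _ => h1 i j).trans (le_of_eq ?_)
  simp only [Finset.sum_const, Finset.card_univ, Fintype.card_fin, nsmul_eq_mul]
  ring

lemma continuousAt_radialHess (hγ : ContMDiff 𝓘(ℝ, ℝ) (𝓡 n) 2 γ) {x : Euc m} (hx : x ≠ 0) :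
    ContinuousAt (fun x => (⟨radialCurve γ β x, radialHess n γ β x⟩ : BilinTangent m n N)) x := by
  have hu := (contMDiffAt_radialCurve (β := β) hγ hx).continuousAt
  have hρ := contDiffAt_norm_rpow hx β (k := 2)
  set c : ℝ → Euc n := fun s => extChartAt (𝓡 n) (γ (‖x‖ ^ β)) (γ s)
  have hc : ContDiffAt ℝ 2 c (‖x‖ ^ β) := (hγ _).contDiffAt_extChartAt
  have hc1 : ContinuousAt (deriv c) (‖x‖ ^ β) := by
    have h : ContDiffAt ℝ 1 (fun t => fderiv ℝ c t 1) (‖x‖ ^ β) :=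
      (hc.fderiv_right (m := 1) (by norm_num)).clm_apply contDiffAt_const
    exact h.continuousAt
  have hρ2 : ContinuousAt (fderiv ℝ (fderiv ℝ fun x : Euc m => ‖x‖ ^ β)) x :=
    ((hρ.fderiv_right (m := 1) (by norm_num)).fderiv_right (m := 0) (by norm_num)).continuousAt
  refine continuousAt_bilinTangent_mk (ζ := fun x =>
    ContinuousLinearMap.compL ℝ (Euc m) ℝ (Euc n)
    (ContinuousLinearMap.toSpanSingletonCLE (𝕜 := ℝ) (deriv c (‖x‖ ^ β))) ∘L
      fderiv ℝ (fderiv ℝ (fun x : Euc m => ‖x‖ ^ β)) x) hu ?_ ?_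
  · refine ContinuousAt.clm_comp ?_ hρ2
    refine ((ContinuousLinearMap.compL ℝ (Euc m) ℝ (Euc n)).continuous.continuousAt).comp ?_
    refine (ContinuousLinearMap.toSpanSingletonCLE (𝕜 := ℝ) (E := Euc n)).continuous.continuousAt.comp ?_
    exact ContinuousAt.comp (g := deriv c) hc1 hρ.continuousAt
  · filter_upwards [hu.eventually_mem ((chartAt (Euc n) (radialCurve γ β x)).open_source.mem_nhds
      (mem_chart_source _ _))] with y hy e
    ext1 e'
    have h1 := mfderiv_extChartAt_velocity hγ (t := ‖y‖ ^ β) (t₀ := ‖x‖ ^ β) hy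
    refine Eq.trans ?_ (congrArg (fun v : Euc n =>
      fderiv ℝ (fderiv ℝ (fun x : Euc m => ‖x‖ ^ β)) y e e' • v) h1)
    exact ContinuousLinearMap.map_smul (mfderiv (𝓡 n) (𝓡 n) (extChartAt (𝓡 n) (γ (‖x‖ ^ β)))
      (γ (‖y‖ ^ β)) : Euc n →L[ℝ] Euc n) _ _

variable [IsContMDiffRiemannianBundle (𝓡 n) 1 (Euc n) (fun y : N => TangentSpace (𝓡 n) y)]

/-- f ∘ u is bounded and C¹ off the origin. As `f` is Lipschitz, its derivative is at most a
multiple of |x|^(-(1-β)), locally integrable because 1 - β < m, so the origin is removable. -/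
lemma hasWeakDerivOn_comp_radialCurve (hm : 2 ≤ m) (hΩ : IsOpen Ω)
    (hγ : ContMDiff 𝓘(ℝ, ℝ) (𝓡 n) 2 γ) (hl : ∀ t, ‖velocity n γ t‖ = l) (hβ : 1 - β < m)
    {f : N → ℝ} (hf : ContMDiff (𝓡 n) 𝓘(ℝ, ℝ) 1 f) (hfc : HasCompactSupport f) :
    HasWeakDerivOn Ω (f ∘ radialCurve γ β)
      (fun x => (mfderiv (𝓡 n) 𝓘(ℝ, ℝ) f (radialCurve γ β x) :
        TangentSpace (𝓡 n) (radialCurve γ β x) →L[ℝ] ℝ) ∘L radialDeriv n γ β x) := by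
  have hm1 : 1 ≤ m := by omega
  have hΩ0 : IsOpen (Ω \ {0}) := hΩ.sdiff isClosed_singleton
  obtain ⟨A, hA⟩ : ∃ A : ∀ y : N, TangentSpace (𝓡 n) y →L[ℝ] ℝ,
    ∀ y, A y = mfderiv (𝓡 n) 𝓘(ℝ, ℝ) f y := ⟨_, fun _ => rfl⟩
  obtain ⟨C, hC0, hC⟩ := hf.exists_forall_abs_mfderiv_le hfc hA
  obtain ⟨M, hM⟩ := hfc.exists_bound_of_continuous hf.continuous
  have hd : ContDiffOn ℝ 1 (f ∘ radialCurve γ β) (Ω \ {0}) := fun x hx =>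
    (ContMDiffAt.comp x (g := f) (hf _)
      ((contMDiffAt_radialCurve hγ hx.2).of_le (by norm_num))).contDiffAt.contDiffWithinAt
  have hg : ∀ x ∈ Ω \ {0}, fderiv ℝ (f ∘ radialCurve γ β) x =
      A (radialCurve γ β x) ∘L radialDeriv n γ β x := fun x hx => by
    rw [radialDeriv_eq_mfderiv hγ hx.2, hA, ← mfderiv_eq_fderiv]
    exact mfderiv_comp x (hf.mdifferentiable (by simp) _)
      ((contMDiffAt_radialCurve hγ hx.2).mdifferentiableAt (by norm_num))
  have h1 : HasWeakDerivOn (Ω \ {0}) (f ∘ radialCurve γ β)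
      (fun x => A (radialCurve γ β x) ∘L radialDeriv n γ β x) :=
    (ContDiffOn.hasWeakDerivOn hΩ0 hd).congr_ae hΩ0.measurableSet (EventuallyEq.refl _ _)
      ((ae_restrict_mem hΩ0.measurableSet).mono hg)
  have h2 : HasWeakDerivOn Ω (f ∘ radialCurve γ β)
      (fun x => A (radialCurve γ β x) ∘L radialDeriv n γ β x) := by
    refine h1.of_diff_zero hm hΩ (M := M) (fun x _ => hM _) ?_
    refine (locallyIntegrableOn_iff hΩ.isLocallyClosed).2 fun k hk hkc => ?_
    obtain ⟨R, hR⟩ := hkc.isBounded.subset_ball 0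
    have hmeas : AEStronglyMeasurable (fun x => A (radialCurve γ β x) ∘L radialDeriv n γ β x)
        (volume.restrict Ω) := by
      rw [← restrict_diff_zero hm1]
      exact h1.locallyIntegrable_deriv.aestronglyMeasurable
    refine Integrable.mono' (((integrableOn_norm_rpow hm1 hβ R).mono_set hR).const_mul (C * |β| * l))
      (hmeas.mono_measure (Measure.restrict_mono_set _ hk)) ?_
    have hl0 : 0 ≤ l := by rw [← hl 0]; exact norm_nonneg _
    filter_upwards [ae_restrict_ne_zero hm1 k] with x hx
    refine ContinuousLinearMap.opNorm_le_bound _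
      (by have := Real.rpow_nonneg (norm_nonneg x) (-(1 - β)); positivity) fun e => ?_
    refine (hC _ (radialDeriv n γ β x e)).trans ?_
    rw [norm_radialDeriv hl, neg_sub]
    have := abs_fderiv_norm_rpow_le hx β e
    calc C * (|fderiv ℝ (fun x : Euc m => ‖x‖ ^ β) x e| * l)
        ≤ C * ((|β| * ‖x‖ ^ (β - 1) * ‖e‖) * l) := by gcongr
      _ = _ := by ring
  refine h2.congr_ae hΩ.measurableSet (EventuallyEq.refl _ _) (Eventually.of_forall fun x => ?_)
  simp only
  rw [hA]

/-- For β < 0 the norm of Tu tends to infinity at the origin, so Tu leaves the support of `f` and f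
∘ Tu vanishes near the origin. No integrability of the second derivative is involved. -/
lemma IsGeodesic.hasWeakDerivOn_comp_bundleMap (hm : 2 ≤ m) (hΩ : IsOpen Ω)
    (hγ : IsGeodesic n γ) (hl : ∀ t, ‖velocity n γ t‖ = l) (hl0 : 0 < l) (hβ : β < 0)
    {f : Euc m × HomTangent m n N → ℝ} (hf : ContMDiff (homModel m n) 𝓘(ℝ, ℝ) 1 f)
    (hfc : HasCompactSupport f) :
    HasWeakDerivOn Ω (f ∘ bundleMap (radialCurve γ β) (radialDeriv n γ β))
      (fun x => (mfderiv (homModel m n) 𝓘(ℝ, ℝ) f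
          (bundleMap (radialCurve γ β) (radialDeriv n γ β) x) :
          TangentSpace (homModel m n) (bundleMap (radialCurve γ β) (radialDeriv n γ β) x) →L[ℝ] ℝ) ∘L
        (vertLift x (radialCurve γ β x) (radialDeriv n γ β x) (radialHess n γ β x) +
          horLift x (radialCurve γ β x) (radialDeriv n γ β x))) := by
  have hm1 : 1 ≤ m := by omega
  have hγ2 := hγ.1
  have hΩ0 : IsOpen (Ω \ {0}) := hΩ.sdiff isClosed_singleton
  set q := bundleMap (radialCurve (m := m) γ β) (radialDeriv n γ β) with hq
  have hqd : ∀ x : Euc m, x ≠ 0 → ContMDiffAt (𝓡 m) (homModel m n) 1 q x := fun x hx =>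
    (contMDiffAt_radialCurve hγ2 hx).contMDiffAt_bundleMap
      (eventually_radialDeriv_eq_mfderiv hγ2 hx)
  obtain ⟨M, hM⟩ := hfc.exists_bound_of_continuous hf.continuous
  have hd : ContDiffOn ℝ 1 (f ∘ q) (Ω \ {0}) := fun x hx =>
    (ContMDiffAt.comp x (g := f) (hf _) (hqd x hx.2)).contDiffAt.contDiffWithinAt
  set g : Euc m → (Euc m →L[ℝ] ℝ) := fun x => (mfderiv (homModel m n) 𝓘(ℝ, ℝ) f (q x) :
          TangentSpace (homModel m n) (q x) →L[ℝ] ℝ) ∘L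
        (vertLift x (radialCurve γ β x) (radialDeriv n γ β x) (radialHess n γ β x) +
          horLift x (radialCurve γ β x) (radialDeriv n γ β x)) with hgdef
  have hg : ∀ x : Euc m, x ≠ 0 → fderiv ℝ (f ∘ q) x = g x := fun x hx => by
    rw [hgdef]
    simp only
    rw [← hγ.mfderiv_bundleMap_radialCurve hx, ← mfderiv_eq_fderiv]
    exact mfderiv_comp x (hf.mdifferentiable (by simp) _)
      ((hqd x hx).mdifferentiableAt (by norm_num))
  have h1 : HasWeakDerivOn (Ω \ {0}) (f ∘ q) g :=
    (ContDiffOn.hasWeakDerivOn hΩ0 hd).congr_ae hΩ0.measurableSet (EventuallyEq.refl _ _)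
      ((ae_restrict_mem hΩ0.measurableSet).mono fun x hx => hg x hx.2)
  -- `C` bounds the fibre norm on the support of `f`; `δ` is then chosen so that |Tu| > C on the
  -- punctured ball of radius `δ`.
  obtain ⟨C, hC⟩ := hfc.isCompact.exists_forall_hsNorm_le
  have hlim : Tendsto (fun t : ℝ => |β| * l * t ^ (β - 1)) (𝓝[>] 0) atTop :=
    (tendsto_rpow_neg_nhdsGT_zero (by linarith)).const_mul_atTop
      (mul_pos (abs_pos.2 hβ.ne) hl0)
  obtain ⟨δ, hδ, hδC⟩ : ∃ δ > 0, ∀ t ∈ Ioo (0 : ℝ) δ, C < |β| * l * t ^ (β - 1) := by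
    have := hlim.eventually_gt_atTop C
    obtain ⟨δ, hδ, h⟩ := mem_nhdsGT_iff_exists_Ioo_subset.1 this
    exact ⟨δ, hδ, fun t ht => h ht⟩
  have hzero : ∀ x ∈ Metric.ball (0 : Euc m) δ, x ≠ 0 → (f ∘ q) x = 0 := fun x hx hx0 => by
    by_contra hne
    have h3 := hC (q x) (subset_tsupport f hne)
    have h4 : hsNorm (fun e => radialDeriv n γ β x e) ≤ C := h3
    rw [hsNorm_radialDeriv hl hx0] at h4
    exact absurd (hδC ‖x‖ ⟨norm_pos_iff.2 hx0, by simpa using hx⟩) (not_lt.2 h4)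
  have hgzero : ∀ x ∈ Metric.ball (0 : Euc m) δ, x ≠ 0 → g x = 0 := fun x hx hx0 => by
    have h3 : f ∘ q =ᶠ[𝓝 x] fun _ => (0 : ℝ) := by
      filter_upwards [Metric.isOpen_ball.mem_nhds hx, isOpen_ne.mem_nhds hx0] with y hy hy0
      exact hzero y hy hy0
    rw [← hg x hx0, h3.fderiv_eq, fderiv_fun_const, Pi.zero_apply]
  exact h1.of_diff_zero_of_eq_zero hm hΩ (fun x => hM _) hδ hgzero

end RadialSobolev

/-! ### Energies and oscillation of the radial map. -/

section RadialEnergy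

variable {m n : ℕ} {N : Type*} [TopologicalSpace N] [ChartedSpace (Euc n) N]
  [IsManifold (𝓡 n) 2 N] {Ω : Set (Euc m)}

/-- In a chart the curve has zero derivative on an interval, so it is locally constant, and ℝ is
connected. Hence the speed of a nonconstant geodesic is positive. -/
lemma ContMDiff.eq_of_velocity_eq_zero {γ : ℝ → N} (hγ : ContMDiff 𝓘(ℝ, ℝ) (𝓡 n) 2 γ)
    (h0 : ∀ t, (velocity n γ t : Euc n) = 0) (s t : ℝ) : γ s = γ t := by
  have hloc : IsLocallyConstant γ := by
    rw [IsLocallyConstant.iff_eventually_eq]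
    intro t₀
    have hev : ∀ᶠ s in 𝓝 t₀, γ s ∈ (chartAt (Euc n) (γ t₀)).source :=
      hγ.continuous.continuousAt.eventually_mem
        ((chartAt (Euc n) (γ t₀)).open_source.mem_nhds (mem_chart_source _ _))
    obtain ⟨ε, hε, hb⟩ := Metric.eventually_nhds_iff_ball.1 hev
    filter_upwards [Metric.ball_mem_nhds t₀ hε] with s hs
    have hd : ∀ s ∈ Metric.ball t₀ ε, HasDerivAt (fun s => extChartAt (𝓡 n) (γ t₀) (γ s)) 0 s := by
      intro s hs
      have h1 := mfderiv_extChartAt_velocity hγ (hb s hs)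
      have h2 : DifferentiableAt ℝ (fun s => extChartAt (𝓡 n) (γ t₀) (γ s)) s := by
        have h3 : MDifferentiableAt (𝓡 n) (𝓡 n) (extChartAt (𝓡 n) (γ t₀)) (γ s) :=
          mdifferentiableAt_extChartAt (hb s hs)
        exact (h3.comp s (hγ.mdifferentiable (by norm_num) s)).differentiableAt
      have h4 : deriv (fun s => extChartAt (𝓡 n) (γ t₀) (γ s)) s = 0 := by
        refine h1.symm.trans ?_
        refine (congrArg (mfderiv (𝓡 n) (𝓡 n) (extChartAt (𝓡 n) (γ t₀)) (γ s) :
          Euc n →L[ℝ] Euc n) (h0 s)).trans (map_zero _)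
      rw [← h4]
      exact h2.hasDerivAt
    have h5 := Metric.isOpen_ball.is_const_of_deriv_eq_zero (convex_ball t₀ ε).isPreconnected
      (fun s hs => (hd s hs).differentiableAt.differentiableWithinAt) (fun s hs => (hd s hs).deriv)
      hs (Metric.mem_ball_self hε)
    exact (extChartAt (𝓡 n) (γ t₀)).injOn (by simpa using hb s hs)
      (mem_extChartAt_source _) h5
  exact hloc.apply_eq_of_preconnectedSpace _ _

variable [RiemannianBundle (fun y : N => TangentSpace (𝓡 n) y)] {γ : ℝ → N} {β l : ℝ}

variable [IsContMDiffRiemannianBundle (𝓡 n) 1 (Euc n) (fun y : N => TangentSpace (𝓡 n) y)]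

lemma IsGeodesic.exists_speed (hγ : IsGeodesic n γ) (h : ∃ s t, γ s ≠ γ t) :
    ∃ l : ℝ, 0 < l ∧ ∀ t, ‖velocity n γ t‖ = l := by
  obtain ⟨l, hl⟩ := hγ.exists_norm_mfderiv_eq
  refine ⟨l, lt_of_le_of_ne (by rw [← hl 0]; exact norm_nonneg _) ?_, hl⟩
  rintro rfl
  obtain ⟨s, t, hst⟩ := h
  exact hst (hγ.1.eq_of_velocity_eq_zero
    (fun t => (norm_eq_zero (E := TangentSpace (𝓡 n) (γ t))).1 (hl t)) s t)

lemma lebesgueMeasurableOn_radialCurve (hm : 1 ≤ m) (hΩ : IsOpen Ω)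
    (hγ : ContMDiff 𝓘(ℝ, ℝ) (𝓡 n) 2 γ) : LebesgueMeasurableOn Ω (radialCurve γ β) :=
  lebesgueMeasurableOn_of_continuousAt hm hΩ fun _ hx => (contMDiffAt_radialCurve hγ hx).continuousAt

lemma continuousAt_bundleMap_radialCurve (hγ : ContMDiff 𝓘(ℝ, ℝ) (𝓡 n) 2 γ) {x : Euc m}
    (hx : x ≠ 0) : ContinuousAt (bundleMap (radialCurve γ β) (radialDeriv n γ β)) x :=
  ((contMDiffAt_radialCurve hγ hx).contMDiffAt_bundleMap
      (eventually_radialDeriv_eq_mfderiv hγ hx)).continuousAt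

lemma hasColocalWeakDerivOn_radialCurve (hm : 2 ≤ m) (hΩ : IsOpen Ω)
    (hγ : ContMDiff 𝓘(ℝ, ℝ) (𝓡 n) 2 γ) (hl : ∀ t, ‖velocity n γ t‖ = l) (hβ : 1 - β < m) :
    HasColocalWeakDerivOn Ω (radialCurve γ β) (radialDeriv n γ β) where
  differentiable :=
    { measurable := lebesgueMeasurableOn_radialCurve (by omega) hΩ hγ
      mapsTo := fun _ _ => mem_univ _
      comp := fun _ hf hfc _ => ⟨_, hasWeakDerivOn_comp_radialCurve hm hΩ hγ hl hβ hf hfc⟩ }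
  measurable := lebesgueMeasurableOn_of_continuousAt (by omega) hΩ fun _ hx =>
    (continuousAt_bundleMap_radialCurve hγ hx).snd
  chain_rule := fun _ hf hfc => hasWeakDerivOn_comp_radialCurve hm hΩ hγ hl hβ hf hfc

lemma IsGeodesic.hasColocalWeakCovDerivOn_radialCurve (hm : 2 ≤ m) (hΩ : IsOpen Ω)
    (hγ : IsGeodesic n γ) (hl : ∀ t, ‖velocity n γ t‖ = l) (hl0 : 0 < l) (hβ : β < 0) :
    HasColocalWeakCovDerivOn Ω (radialCurve γ β) (radialDeriv n γ β) (radialHess n γ β) where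
  differentiable :=
    { measurable := lebesgueMeasurableOn_of_continuousAt (by omega) hΩ fun _ hx =>
        continuousAt_bundleMap_radialCurve hγ.1 hx
      mapsTo := fun _ hx => ⟨hx, mem_univ _⟩
      comp := fun _ hf hfc _ => ⟨_, hγ.hasWeakDerivOn_comp_bundleMap hm hΩ hl hl0 hβ hf hfc⟩ }
  measurable := lebesgueMeasurableOn_of_continuousAt (by omega) hΩ fun _ hx =>
    continuousAt_radialHess hγ.1 hx
  chain_rule := fun _ hf hfc _ => hγ.hasWeakDerivOn_comp_bundleMap hm hΩ hl hl0 hβ hf hfc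

/-- The integrand is at most a multiple of |x|^(-(2-β)p), whose exponent is below the dimension. -/
lemma secondEnergy_radialHess_lt_top (hm : 1 ≤ m) (hl : ∀ t, ‖velocity n γ t‖ = l)
    {p r : ℝ} (hp : 0 ≤ p) (hβ : (2 - β) * p < m) :
    secondEnergy (Metric.ball (0 : Euc m) r) (radialCurve γ β) (radialHess n γ β) p < ⊤ := by
  have hl0 : 0 ≤ l := by rw [← hl 0]; exact norm_nonneg _
  have h1 := ((integrableOn_norm_rpow hm hβ r).const_mul
    ((m * ((|β| + |β * (β - 2)|) * l)) ^ p)).lintegral_lt_top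
  refine lt_of_le_of_lt (lintegral_mono_ae ?_) h1
  filter_upwards [ae_restrict_ne_zero hm (Metric.ball (0 : Euc m) r)] with x hx
  rw [ENNReal.ofReal_rpow_of_nonneg (by unfold hsNorm₂; positivity) hp]
  refine ENNReal.ofReal_le_ofReal ?_
  refine (Real.rpow_le_rpow (by unfold hsNorm₂; positivity) (hsNorm₂_radialHess_le hl hx) hp).trans
    (le_of_eq ?_)
  rw [Real.mul_rpow (by positivity) (Real.rpow_nonneg (norm_nonneg _) _),
    ← Real.rpow_mul (norm_nonneg _)]
  congr 2
  ring

/-- In polar coordinates the integrand becomes t^(m-1) t^(-m) = 1/t on (0, r). -/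
lemma not_integrableOn_norm_rpow (hm : 1 ≤ m) {r : ℝ} (hr : 0 < r) :
    ¬ IntegrableOn (fun x : Euc m => ‖x‖ ^ (-(m : ℝ))) (Metric.ball 0 r) := by
  have := nontrivial_euc hm
  intro h
  have h1 := (integrableOn_fun_norm_addHaar (volume : Measure (Euc m))
    (f := fun t : ℝ => t ^ (-(m : ℝ)))).1 h
  have h2 : IntegrableOn (fun t : ℝ => t ^ (-1 : ℝ)) (Ioo 0 r) := by
    refine h1.congr_fun (fun t ht => ?_) measurableSet_Ioo
    simp only [finrank_euclideanSpace_fin, smul_eq_mul]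
    rw [← Real.rpow_natCast, ← Real.rpow_add ht.1]
    congr 1
    push_cast [Nat.cast_sub hm]
    ring
  exact absurd ((intervalIntegral.integrableOn_Ioo_rpow_iff hr).1 h2) (lt_irrefl _)

/-- The condition (1-β)q = m is the borderline case, in which the integrand is a positive multiple
of |x|^(-m). -/
lemma firstEnergy_radialDeriv (hm : 1 ≤ m) (hl : ∀ t, ‖velocity n γ t‖ = l) (hl0 : 0 < l)
    {q r : ℝ} (hr : 0 < r) (hq : 0 ≤ q) (hβ0 : β ≠ 0) (hβ : (1 - β) * q = m) :
    firstEnergy (Metric.ball (0 : Euc m) r) (radialCurve γ β) (radialDeriv n γ β) q = ⊤ := by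
  by_contra hne
  refine not_integrableOn_norm_rpow hm hr ?_
  have hc : 0 < (|β| * l) ^ q := by positivity
  have hmeas : AEStronglyMeasurable (fun x : Euc m => (|β| * l) ^ q * ‖x‖ ^ (-(m : ℝ)))
      (volume.restrict (Metric.ball 0 r)) :=
    ((measurable_norm.pow_const _).const_mul _).aestronglyMeasurable
  have h1 : IntegrableOn (fun x : Euc m => (|β| * l) ^ q * ‖x‖ ^ (-(m : ℝ)))
      (Metric.ball 0 r) := by
    refine (lintegral_ofReal_ne_top_iff_integrable hmeas (Eventually.of_forall fun x =>
      mul_nonneg hc.le (Real.rpow_nonneg (norm_nonneg _) _))).1 ?_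
    refine ne_of_eq_of_ne (lintegral_congr_ae ?_) hne
    filter_upwards [ae_restrict_ne_zero hm (Metric.ball (0 : Euc m) r)] with x hx
    rw [ENNReal.ofReal_rpow_of_nonneg (by unfold hsNorm; positivity) hq, hsNorm_radialDeriv hl hx,
      Real.mul_rpow (by positivity) (Real.rpow_nonneg (norm_nonneg _) _),
      ← Real.rpow_mul (norm_nonneg _), ← hβ]
    congr 3
    ring
  refine (h1.const_mul ((|β| * l) ^ q)⁻¹).congr (Eventually.of_forall fun x => ?_)
  simp only
  rw [inv_mul_cancel_left₀ hc.ne']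

lemma essOsc_radialCurve_lt_top {C : ℝ≥0}
    (hC : ∀ s t, riemannianEDist (𝓡 n) (γ s) (γ t) ≤ C) :
    essOsc n Ω (radialCurve γ β) < ⊤ :=
  (essSup_le_of_ae_le (C : ℝ≥0∞) (Eventually.of_forall fun _ => hC _ _)).trans_lt
    ENNReal.coe_lt_top

/-- A `C²` isometric embedding does not increase the Riemannian distance. -/
lemma IsIsometricEmbedding.edist_le_riemannianEDist {ν : ℕ} {ι : N → Euc ν}
    (hι : IsIsometricEmbedding n ι) (y z : N) :
    edist (ι y) (ι z) ≤ riemannianEDist (𝓡 n) y z := by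
  refine le_of_forall_gt fun c hc => ?_
  obtain ⟨η, h0, h1, hη, hlen⟩ := exists_lt_of_riemannianEDist_lt hc
  refine lt_of_le_of_lt ?_ hlen
  have hιη : ContMDiffOn 𝓘(ℝ, ℝ) (𝓡 ν) 1 (ι ∘ η) (Icc 0 1) :=
    (hι.contMDiff.of_le (by norm_num)).comp_contMDiffOn hη
  -- The Euclidean distance is at most the length of ι ∘ η, and this equals the length of η because
  -- dι preserves norms.
  rw [← h0, ← h1, IsRiemannianManifold.out (I := 𝓡 ν) (ι (η 0)) (ι (η 1))]
  refine (riemannianEDist_le_pathELength hιη rfl rfl zero_le_one).trans (le_of_eq ?_)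
  rw [pathELength_eq_lintegral_mfderiv_Ioo, pathELength_eq_lintegral_mfderiv_Ioo]
  refine setLIntegral_congr_fun measurableSet_Ioo fun t ht => ?_
  have hd : MDifferentiableAt 𝓘(ℝ, ℝ) (𝓡 n) η t :=
    ((hη t (Ioo_subset_Icc_self ht)).contMDiffAt (Icc_mem_nhds ht.1 ht.2)).mdifferentiableAt
      (by norm_num)
  have h2 : mfderiv 𝓘(ℝ, ℝ) (𝓡 ν) (ι ∘ η) t =
      (differential n ι (η t)) ∘L (mfderiv 𝓘(ℝ, ℝ) (𝓡 n) η t) :=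
    mfderiv_comp t (hι.contMDiff.mdifferentiable (by norm_num) _) hd
  have h3 : ∀ w : TangentSpace (𝓡 n) (η t), ‖differential n ι (η t) w‖ₑ = ‖w‖ₑ := fun w => by
    rw [← ofReal_norm, ← ofReal_norm, hι.norm_differential]
  exact enorm_tangentSpace_vectorSpace.trans
    ((congrArg (fun A : ℝ →L[ℝ] Euc ν => ‖A 1‖ₑ) h2).trans (h3 _))

lemma IsIsometricEmbedding.exists_norm_le {ν : ℕ} {ι : N → Euc ν}
    (hι : IsIsometricEmbedding n ι) {C : ℝ≥0}
    (hC : ∀ s t, riemannianEDist (𝓡 n) (γ s) (γ t) ≤ C) : ∃ B, 0 ≤ B ∧ ∀ t, ‖ι (γ t)‖ ≤ B := by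
  refine ⟨‖ι (γ 0)‖ + C, by positivity, fun t => ?_⟩
  have h1 := (hι.edist_le_riemannianEDist (γ t) (γ 0)).trans (hC t 0)
  rw [edist_nndist, ENNReal.coe_le_coe, ← NNReal.coe_le_coe, coe_nndist, dist_eq_norm] at h1
  have := norm_le_norm_add_norm_sub' (ι (γ t)) (ι (γ 0))
  linarith

end RadialEnergy

/-! ### Failure of L^p integrability of the Euclidean second derivative. -/

section Nonintegrability

variable {m ν : ℕ}

/-- A Young inequality that includes p = 1: either t ≤ c, or t = t^(1-p) t^p ≤ c^(1-p) t^p. -/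
lemma le_add_rpow_mul {p t c : ℝ} (hp : 1 ≤ p) (ht : 0 ≤ t) (hc : 0 < c) :
    t ≤ c + c ^ (1 - p) * t ^ p := by
  rcases le_total t c with h | h
  · have := mul_nonneg (Real.rpow_nonneg hc.le (1 - p)) (Real.rpow_nonneg ht p)
    linarith
  · have ht' := hc.trans_le h
    have h1 : c ^ (p - 1) ≤ t ^ (p - 1) := Real.rpow_le_rpow hc.le h (by linarith)
    have h2 : t ^ p = t ^ (p - 1) * t := by
      rw [← Real.rpow_add_one ht'.ne']; congr 1; ring
    have h3 : c ^ (1 - p) * c ^ (p - 1) = 1 := by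
      rw [← Real.rpow_add hc]; simp
    have h4 : 0 < c ^ (1 - p) := Real.rpow_pos_of_pos hc _
    calc t = c ^ (1 - p) * c ^ (p - 1) * t := by rw [h3, one_mul]
      _ ≤ c ^ (1 - p) * t ^ (p - 1) * t := by gcongr
      _ = c ^ (1 - p) * t ^ p := by rw [h2]; ring
      _ ≤ c + c ^ (1 - p) * t ^ p := by linarith

/-- Integration by parts for the Dirichlet energy density, with a cut-off function. -/
lemma integral_cutoff_norm_fderiv_sq {O : Set (Euc m)} (hO : IsOpen O)
    {v : Euc m → Euc ν} (hv : ContDiffOn ℝ 2 v O) {φ : Euc m → ℝ} (hφ : ContDiff ℝ ∞ φ)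
    (hc : HasCompactSupport φ) (hs : tsupport φ ⊆ O) (e : Euc m) :
    Integrable (fun x => φ x * ‖fderiv ℝ v x e‖ ^ 2 +
      fderiv ℝ φ x e * inner ℝ (v x) (fderiv ℝ v x e) +
      φ x * inner ℝ (v x) (fderiv ℝ (fderiv ℝ v) x e e)) ∧
    ∫ x, (φ x * ‖fderiv ℝ v x e‖ ^ 2 + fderiv ℝ φ x e * inner ℝ (v x) (fderiv ℝ v x e) +
      φ x * inner ℝ (v x) (fderiv ℝ (fderiv ℝ v) x e e)) = 0 := by
  have hv1 : ContDiffOn ℝ 1 (fderiv ℝ v) O := hv.fderiv_of_isOpen hO (by norm_num)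
  have hve : ContDiffOn ℝ 1 (fun x => fderiv ℝ v x e) O := hv1.clm_apply contDiffOn_const
  have hW : ContDiffOn ℝ 1 (fun x => inner ℝ (v x) (fderiv ℝ v x e)) O :=
    (hv.of_le (by norm_num)).inner ℝ hve
  have hder : ∀ x ∈ O, fderiv ℝ (fun x => inner ℝ (v x) (fderiv ℝ v x e)) x e =
      inner ℝ (v x) (fderiv ℝ (fderiv ℝ v) x e e) + ‖fderiv ℝ v x e‖ ^ 2 := fun x hx => by
    have hx' := hO.mem_nhds hx
    have h1 : DifferentiableAt ℝ v x := (hv.contDiffAt hx').differentiableAt (by norm_num)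
    have h2 : DifferentiableAt ℝ (fderiv ℝ v) x :=
      (hv1.contDiffAt hx').differentiableAt (by norm_num)
    rw [fderiv_inner_apply ℝ h1 (h2.clm_apply (differentiableAt_const e)),
      real_inner_self_eq_norm_sq, fderiv_clm_apply h2 (differentiableAt_const e)]
    simp
  have hWd := hW.hasWeakDerivOn hO
  have h := hWd.integral_eq φ hφ hc hs e
  have i1 : Integrable (fun x => φ x • fderiv ℝ (fun x => inner ℝ (v x) (fderiv ℝ v x e)) x e) :=
    (((hW.continuousOn_fderiv_of_isOpen hO le_rfl).clm_apply
      continuousOn_const).locallyIntegrableOn hO.measurableSet).integrable_smul_of_tsupport_subset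
      hφ.continuous hc hs
  have i2 : Integrable (fun x => fderiv ℝ φ x e • inner ℝ (v x) (fderiv ℝ v x e)) :=
    hWd.locallyIntegrable.integrable_smul_of_tsupport_subset
      ((hφ.continuous_fderiv (by simp)).clm_apply continuous_const) (hc.fderiv_apply ℝ e)
      ((tsupport_fderiv_apply_subset_tsupport φ e).trans hs)
  -- The integrand is the derivative along `e` of φ⟨v, ∂_e v⟩; outside `O` all terms vanish.
  have heq : (fun x => fderiv ℝ φ x e • inner ℝ (v x) (fderiv ℝ v x e) +
      φ x • fderiv ℝ (fun x => inner ℝ (v x) (fderiv ℝ v x e)) x e) =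
      fun x => φ x * ‖fderiv ℝ v x e‖ ^ 2 + fderiv ℝ φ x e * inner ℝ (v x) (fderiv ℝ v x e) +
      φ x * inner ℝ (v x) (fderiv ℝ (fderiv ℝ v) x e e) := by
    funext x
    by_cases hx : x ∈ O
    · simp only [hder x hx, smul_eq_mul]; ring
    · have : φ x = 0 := image_eq_zero_of_notMem_tsupport fun h => hx (hs h)
      simp [this]
  rw [← heq]
  refine ⟨i2.add i1, ?_⟩
  rw [integral_add i2 i1, h, neg_add_cancel]

lemma norm_apply_le_hsNorm₂ {V : Type*} [NormedAddCommGroup V] (B : Euc m → Euc m → V)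
    (i j : Fin m) : ‖B (EuclideanSpace.single i 1) (EuclideanSpace.single j 1)‖ ≤ hsNorm₂ B := by
  refine Real.le_sqrt_of_sq_le ?_
  refine le_trans ?_ (Finset.single_le_sum (f := fun i => ∑ j,
    ‖B (EuclideanSpace.single i 1) (EuclideanSpace.single j 1)‖ ^ 2)
    (fun i _ => Finset.sum_nonneg fun j _ => sq_nonneg _) (Finset.mem_univ i))
  exact Finset.single_le_sum (f := fun j =>
    ‖B (EuclideanSpace.single i 1) (EuclideanSpace.single j 1)‖ ^ 2)
    (fun j _ => sq_nonneg _) (Finset.mem_univ j)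

/-- The energy inequality on a ball at distance `2s` from the origin. -/
lemma energy_le_of_cutoff {v : Euc m → Euc ν} {r B K a p M s c : ℝ} (hs : 0 < s) (hsr : 3 * s < r)
    (hp : 1 ≤ p) (hc : 0 < c) (hK : 0 ≤ K) (ha : 0 ≤ a) (hB0 : 0 ≤ B)
    (hv : ContDiffOn ℝ 2 v (Metric.ball 0 r \ {0})) (hB : ∀ x, ‖v x‖ ≤ B)
    (hD : ∀ x ≠ 0, ∑ i, ‖fderiv ℝ v x (EuclideanSpace.single i 1)‖ ^ 2 = (K * ‖x‖ ^ (-a)) ^ 2)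
    (hI : IntegrableOn (fun x => hsNorm₂ (fun e e' => fderiv ℝ (fderiv ℝ v) x e e') ^ p)
      (Metric.ball 0 r)) {e₀ : Euc m} (he₀ : ‖e₀‖ = 1) (η : ContDiffBump ((2 : ℝ) • e₀))
    (hη1 : η.rIn = 1 / 2) (hη2 : η.rOut = 1) (hM : ∀ x, ‖fderiv ℝ η x‖ ≤ M) :
    (K * (3 * s) ^ (-a)) ^ 2 * ((s / 2) ^ m * volume.real (Metric.ball (0 : Euc m) 1)) ≤
      (m * (s⁻¹ * M) * (B * (K * s ^ (-a))) + m * B * c) *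
        (s ^ m * volume.real (Metric.ball (0 : Euc m) 1)) +
      m * B * c ^ (1 - p) * ∫ x in Metric.closedBall 0 (3 * s),
        hsNorm₂ (fun e e' => fderiv ℝ (fderiv ℝ v) x e e') ^ p ∂(volume.restrict (Metric.ball 0 r)) := by
  have hm : 1 ≤ m := by
    rcases Nat.eq_zero_or_pos m with rfl | h
    · have : e₀ = 0 := Subsingleton.elim _ _
      simp [this] at he₀
    · exact h
  have hnt := nontrivial_euc hm
  have hO : IsOpen (Metric.ball (0 : Euc m) r \ {0}) := Metric.isOpen_ball.sdiff isClosed_singleton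
  set h : Euc m → ℝ := fun x => hsNorm₂ (fun e e' => fderiv ℝ (fderiv ℝ v) x e e') with hh
  have hh0 : ∀ x, 0 ≤ h x := fun x => Real.sqrt_nonneg _
  set φ : Euc m → ℝ := fun x => η (s⁻¹ • x) with hφ
  set S : Set (Euc m) := Metric.closedBall ((2 * s) • e₀) s with hS
  have hφc : ContDiff ℝ ∞ φ := η.contDiff.comp (contDiff_const_smul _)
  have hmem : ∀ x, dist (s⁻¹ • x) ((2 : ℝ) • e₀) = s⁻¹ * dist x ((2 * s) • e₀) := fun x => by
    rw [dist_eq_norm, dist_eq_norm, ← Real.norm_of_nonneg (inv_nonneg.2 hs.le), ← norm_smul,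
      smul_sub, smul_smul, Real.norm_of_nonneg (inv_nonneg.2 hs.le)]
    congr 3
    field_simp
  have hφS : ∀ x, x ∉ S → φ x = 0 := fun x hx => by
    refine η.zero_of_le_dist ?_
    rw [hη2, hmem, le_inv_mul_iff₀ hs, mul_one]
    exact (not_le.1 hx).le
  have hts : tsupport φ ⊆ S := by
    refine closure_minimal (fun x hx => ?_) Metric.isClosed_closedBall
    by_contra h
    exact hx (hφS x h)
  have hφcs : HasCompactSupport φ := HasCompactSupport.of_support_subset_isCompact
    (isCompact_closedBall _ _) ((subset_tsupport φ).trans hts)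
  have hne₀ : ‖(2 * s) • e₀‖ = 2 * s := by
    rw [norm_smul, he₀, mul_one, Real.norm_of_nonneg (by positivity)]
  -- The support of the cutoff lies where |x| is comparable to `s`, so |Dv| is bounded above and
  -- below there by multiples of s^(-a).
  have hSn : ∀ x ∈ S, s ≤ ‖x‖ ∧ ‖x‖ ≤ 3 * s := fun x hx => by
    have h1 : ‖x - (2 * s) • e₀‖ ≤ s := by rw [← dist_eq_norm]; exact hx
    have h2 := norm_sub_norm_le x ((2 * s) • e₀)
    have h3 := norm_sub_norm_le ((2 * s) • e₀) x
    rw [norm_sub_rev] at h3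
    constructor <;> linarith
  have hSO : S ⊆ Metric.ball (0 : Euc m) r \ {0} := fun x hx => by
    obtain ⟨h1, h2⟩ := hSn x hx
    refine ⟨by rw [mem_ball_zero_iff]; linarith, ?_⟩
    rintro rfl
    rw [norm_zero] at h1
    linarith
  set F : Fin m → Euc m → ℝ := fun i x =>
    φ x * ‖fderiv ℝ v x (EuclideanSpace.single i 1)‖ ^ 2 +
      fderiv ℝ φ x (EuclideanSpace.single i 1) *
        inner ℝ (v x) (fderiv ℝ v x (EuclideanSpace.single i 1)) +
      φ x * inner ℝ (v x) (fderiv ℝ (fderiv ℝ v) x (EuclideanSpace.single i 1)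
        (EuclideanSpace.single i 1)) with hF
  have hFi : ∀ i, Integrable (F i) ∧ ∫ x, F i x = 0 := fun i =>
    integral_cutoff_norm_fderiv_sq hO hv hφc hφcs (hts.trans hSO) _
  -- `R` adds over the m directions the bounds for the two terms other than φ|Dv|²: the cutoff
  -- gradient is at most M/s, |v| ≤ B, |Dv| ≤ K s^(-a), and |D²v| is split by Young's inequality
  -- with parameter `c`.
  set R : Euc m → ℝ := fun x => m * (s⁻¹ * M) * (B * (K * s ^ (-a))) + m * B * c +
    m * B * c ^ (1 - p) * h x ^ p with hR
  have hRi : IntegrableOn R S := by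
    refine Integrable.add (integrableOn_const (measure_closedBall_lt_top).ne) ?_
    exact (hI.mono_set (hSO.trans sdiff_subset)).const_mul _
  have hdφ : ∀ x, ‖fderiv ℝ φ x‖ ≤ s⁻¹ * M := fun x => by
    rw [hφ, fderiv_comp_smul, norm_smul, Real.norm_of_nonneg (inv_nonneg.2 hs.le)]
    exact mul_le_mul_of_nonneg_left (hM _) (inv_nonneg.2 hs.le)
  -- Pointwise form of the estimate. On integration the `F i` disappear, since each has integral
  -- zero.
  have hpt : ∀ x, (Metric.ball ((2 * s) • e₀) (s / 2)).indicator
      (fun _ => (K * (3 * s) ^ (-a)) ^ 2) x ≤ ∑ i, F i x + S.indicator R x := fun x => by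
    by_cases hx : x ∈ S
    · obtain ⟨h1, h2⟩ := hSn x hx
      have hx0 : x ≠ 0 := (hSO hx).2
      have hxp : 0 < ‖x‖ := norm_pos_iff.2 hx0
      have hφ0 : 0 ≤ φ x := η.nonneg
      have hφ1 : φ x ≤ 1 := η.le_one
      have b1 : (Metric.ball ((2 * s) • e₀) (s / 2)).indicator
          (fun _ => (K * (3 * s) ^ (-a)) ^ 2) x ≤
          ∑ i, φ x * ‖fderiv ℝ v x (EuclideanSpace.single i 1)‖ ^ 2 := by
        rw [← Finset.mul_sum, hD x hx0]
        by_cases hxb : x ∈ Metric.ball ((2 * s) • e₀) (s / 2)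
        · have : φ x = 1 := η.one_of_mem_closedBall (by
            rw [Metric.mem_closedBall, hη1, hmem, inv_mul_le_iff₀ hs]
            have := Metric.mem_ball.1 hxb
            linarith)
          rw [indicator_of_mem hxb, this, one_mul]
          have := Real.rpow_le_rpow_of_nonpos hxp h2 (neg_nonpos.2 ha)
          gcongr
        · rw [indicator_of_notMem hxb]
          positivity
      have b2 : ∀ i : Fin m, -((s⁻¹ * M) * (B * (K * s ^ (-a)))) ≤
          fderiv ℝ φ x (EuclideanSpace.single i 1) *
          inner ℝ (v x) (fderiv ℝ v x (EuclideanSpace.single i 1)) := fun i => by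
        refine (abs_le.1 ?_).1
        rw [abs_mul]
        have c1 : |fderiv ℝ φ x (EuclideanSpace.single i 1)| ≤ s⁻¹ * M := by
          refine ((fderiv ℝ φ x).le_opNorm _).trans ?_
          simpa using hdφ x
        have c2 : ‖fderiv ℝ v x (EuclideanSpace.single i 1)‖ ≤ K * ‖x‖ ^ (-a) := by
          refine le_of_sq_le_sq ?_ (by positivity)
          rw [← hD x hx0]
          exact Finset.single_le_sum (f := fun i =>
            ‖fderiv ℝ v x (EuclideanSpace.single i 1)‖ ^ 2) (fun _ _ => sq_nonneg _)
            (Finset.mem_univ i)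
        have c3 := Real.rpow_le_rpow_of_nonpos hs h1 (neg_nonpos.2 ha)
        have c4 : |inner ℝ (v x) (fderiv ℝ v x (EuclideanSpace.single i 1))| ≤
            B * (K * s ^ (-a)) := by
          refine (abs_real_inner_le_norm _ _).trans ?_
          have := c2.trans (mul_le_mul_of_nonneg_left c3 hK)
          exact mul_le_mul (hB x) this (norm_nonneg _) hB0
        exact mul_le_mul c1 c4 (abs_nonneg _) ((abs_nonneg _).trans c1)
      have b3 : ∀ i : Fin m, -(B * (c + c ^ (1 - p) * h x ^ p)) ≤ φ x * inner ℝ (v x)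
          (fderiv ℝ (fderiv ℝ v) x (EuclideanSpace.single i 1) (EuclideanSpace.single i 1)) :=
          fun i => by
        refine (abs_le.1 ?_).1
        rw [abs_mul, abs_of_nonneg hφ0]
        have c1 := norm_apply_le_hsNorm₂ (fun e e' => fderiv ℝ (fderiv ℝ v) x e e') i i
        have c2 := le_add_rpow_mul hp (hh0 x) hc
        refine (mul_le_of_le_one_left (abs_nonneg _) hφ1).trans ?_
        refine (abs_real_inner_le_norm _ _).trans ?_
        exact mul_le_mul (hB x) (c1.trans c2) (norm_nonneg _) hB0
      rw [indicator_of_mem hx]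
      have b4 := Finset.sum_le_sum fun i (_ : i ∈ Finset.univ) => b2 i
      have b5 := Finset.sum_le_sum fun i (_ : i ∈ Finset.univ) => b3 i
      simp only [Finset.sum_const, Finset.card_univ, Fintype.card_fin, nsmul_eq_mul] at b4 b5
      simp only [hF, hR, Finset.sum_add_distrib]
      linarith
    · have hxb : x ∉ Metric.ball ((2 * s) • e₀) (s / 2) := fun hxb =>
        hx (Metric.ball_subset_closedBall (Metric.ball_subset_ball (by linarith) hxb))
      rw [indicator_of_notMem hx, indicator_of_notMem hxb, add_zero]
      refine le_of_eq (Finset.sum_eq_zero fun i _ => ?_).symm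
      have h1 : fderiv ℝ φ x (EuclideanSpace.single i 1) = 0 :=
        image_eq_zero_of_notMem_tsupport (f := fun x => fderiv ℝ φ x (EuclideanSpace.single i 1))
          fun h => hx (hts (tsupport_fderiv_apply_subset_tsupport φ _ h))
      simp only [hF, hφS x hx, h1]
      ring
  have i1 : Integrable ((Metric.ball ((2 * s) • e₀) (s / 2)).indicator
      (fun _ => (K * (3 * s) ^ (-a)) ^ 2)) :=
    (integrable_indicator_iff measurableSet_ball).2
      (integrableOn_const measure_ball_lt_top.ne)
  have i2 : Integrable (fun x => ∑ i, F i x) := integrable_finsetSum _ fun i _ => (hFi i).1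
  have i3 : Integrable (S.indicator R) :=
    (integrable_indicator_iff Metric.isClosed_closedBall.measurableSet).2 hRi
  have key := integral_mono i1 (i2.add i3) hpt
  rw [integral_indicator measurableSet_ball, setIntegral_const] at key
  have e1 : ∫ x, (∑ i, F i x + S.indicator R x) = ∫ x in S, R x := by
    rw [integral_add i2 i3, integral_finsetSum _ fun i _ => (hFi i).1,
      Finset.sum_eq_zero fun i _ => (hFi i).2, zero_add,
      integral_indicator Metric.isClosed_closedBall.measurableSet]
  have e2 : ∫ x in S, R x = (m * (s⁻¹ * M) * (B * (K * s ^ (-a))) + m * B * c) *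
      volume.real S + m * B * c ^ (1 - p) * ∫ x in S, h x ^ p := by
    have k1 : IntegrableOn (fun _ => m * (s⁻¹ * M) * (B * (K * s ^ (-a))) + m * B * c) S :=
      integrableOn_const (measure_closedBall_lt_top).ne
    have k2 : IntegrableOn (fun x => m * B * c ^ (1 - p) * h x ^ p) S :=
      (hI.mono_set (hSO.trans sdiff_subset)).const_mul _
    rw [hR, integral_add k1 k2, integral_const_mul, setIntegral_const,
      smul_eq_mul, mul_comm (volume.real S)]
  have e3 : ∫ x in S, h x ^ p ≤ ∫ x in Metric.closedBall 0 (3 * s), h x ^ p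
      ∂(volume.restrict (Metric.ball 0 r)) := by
    have hsub : Metric.closedBall (0 : Euc m) (3 * s) ⊆ Metric.ball 0 r :=
      Metric.closedBall_subset_ball hsr
    rw [Measure.restrict_restrict_of_subset hsub]
    refine setIntegral_mono_set (hI.mono_set hsub)
      (Eventually.of_forall fun x => Real.rpow_nonneg (hh0 x) _)
      (Eventually.of_forall fun x hx => ?_)
    exact mem_closedBall_zero_iff.2 (hSn x hx).2
  have v1 : volume.real S = s ^ m * volume.real (Metric.ball (0 : Euc m) 1) := by
    rw [hS, Measure.addHaar_real_closedBall _ _ hs.le, finrank_euclideanSpace_fin]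
  have v2 : volume.real (Metric.ball ((2 * s) • e₀) (s / 2)) =
      (s / 2) ^ m * volume.real (Metric.ball (0 : Euc m) 1) := by
    rw [measureReal_def, Measure.addHaar_ball _ _ (by positivity), ENNReal.toReal_mul,
      ENNReal.toReal_ofReal (by positivity), ← measureReal_def, finrank_euclideanSpace_fin]
  have key2 := key.trans_eq (e1.trans e2)
  rw [v1, v2, smul_eq_mul, mul_comm] at key2
  refine key2.trans ?_
  have : 0 ≤ m * B * c ^ (1 - p) := by have := Real.rpow_nonneg hc.le (1 - p); positivity
  gcongr

/-- A bounded function whose gradient has the length `K |x|^(-a)`, with `2 a p = m`, does not have a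
second derivative in `L^p` near the origin. -/
lemma not_integrableOn_hsNorm₂_fderiv_fderiv {v : Euc m → Euc ν} {r B K a p : ℝ} (hm : 1 ≤ m)
    (hr : 0 < r) (hp : 1 ≤ p) (hK : 0 < K) (ha : 1 < a) (hap : 2 * a * p = m)
    (hv : ContDiffOn ℝ 2 v (Metric.ball 0 r \ {0})) (hB : ∀ x, ‖v x‖ ≤ B)
    (hD : ∀ x ≠ 0, ∑ i, ‖fderiv ℝ v x (EuclideanSpace.single i 1)‖ ^ 2 = (K * ‖x‖ ^ (-a)) ^ 2) :
    ¬ IntegrableOn (fun x => hsNorm₂ (fun e e' => fderiv ℝ (fderiv ℝ v) x e e') ^ p)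
      (Metric.ball 0 r) := by
  intro hI
  have hnt := nontrivial_euc hm
  have hB0 : 0 ≤ B := (norm_nonneg _).trans (hB 0)
  obtain ⟨e₀, he₀⟩ := exists_norm_eq (Euc m) zero_le_one
  let η : ContDiffBump ((2 : ℝ) • e₀) := ⟨1 / 2, 1, by norm_num, by norm_num⟩
  obtain ⟨M, hM⟩ := (η.hasCompactSupport.fderiv ℝ).exists_bound_of_continuous
    (η.contDiff.continuous_fderiv (n := 1) (by simp))
  set κ : ℝ := volume.real (Metric.ball (0 : Euc m) 1) with hκ
  have hκ0 : 0 < κ := ENNReal.toReal_pos (Metric.measure_ball_pos volume _ one_pos).ne'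
    measure_ball_lt_top.ne
  set E : ℝ → ℝ := fun s => ∫ x in Metric.closedBall 0 (3 * s),
    hsNorm₂ (fun e e' => fderiv ℝ (fderiv ℝ v) x e e') ^ p ∂(volume.restrict (Metric.ball 0 r)) with hE
  -- Absolute continuity of the integral; this is the only place where integrability of |D²v|^p
  -- gives smallness.
  have hE0 : Tendsto E (𝓝[>] 0) (𝓝 0) := by
    refine hI.2.tendsto_setIntegral_nhds_zero ?_
    have h1 : Tendsto (fun s : ℝ => ENNReal.ofReal ((3 * s) ^ m) * volume (Metric.ball (0 : Euc m) 1))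
        (𝓝[>] 0) (𝓝 0) := by
      have h2 : Tendsto (fun s : ℝ => (3 * s) ^ m) (𝓝[>] 0) (𝓝 0) := by
        have : Continuous fun s : ℝ => (3 * s) ^ m := by fun_prop
        have h3 := this.tendsto 0
        simp only [mul_zero, zero_pow (by omega : m ≠ 0)] at h3
        exact h3.mono_left nhdsWithin_le_nhds
      have h3 := ENNReal.Tendsto.mul_const (ENNReal.tendsto_ofReal h2)
        (b := volume (Metric.ball (0 : Euc m) 1)) (Or.inr measure_ball_lt_top.ne)
      simpa using h3
    refine tendsto_of_tendsto_of_tendsto_of_le_of_le' tendsto_const_nhds h1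
      (Eventually.of_forall fun _ => zero_le) ?_
    filter_upwards [self_mem_nhdsWithin] with s hs
    have hs' : (0 : ℝ) < s := hs
    refine (Measure.restrict_apply_le _ _).trans (le_of_eq ?_)
    rw [Measure.addHaar_closedBall _ _ (by positivity), finrank_euclideanSpace_fin]
  set c₀ : ℝ := (K * 3 ^ (-a)) ^ 2 * ((1 / 2) ^ m * κ) with hc₀
  have hc₀0 : 0 < c₀ := by positivity
  have hlim : ∀ δ > 0, c₀ ≤ m * B * δ * κ := fun δ hδ => by
    have hle : ∀ᶠ s in 𝓝[>] (0 : ℝ), c₀ ≤ m * M * B * K * κ * s ^ (a - 1) + m * B * δ * κ +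
        m * B * δ ^ (1 - p) * E s := by
      filter_upwards [self_mem_nhdsWithin, mem_nhdsWithin_of_mem_nhds
        (Iio_mem_nhds (show (0 : ℝ) < r / 3 by positivity))] with s hs hsr
      have hs' : (0 : ℝ) < s := hs
      have hsr' : 3 * s < r := by have : s < r / 3 := hsr; linarith
      -- With c = δ s^(-2a), the relation 2ap = m gives c^(1-p) = δ^(1-p) s^(m-2a). Hence every term
      -- carries the factor s^(m-2a) of the left side, which can be divided out.
      have h := energy_le_of_cutoff hs' hsr' hp (c := δ * s ^ (-(2 * a))) (by positivity) hK.le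
        (by linarith) hB0 hv hB hD hI he₀ η rfl rfl hM
      have t1 : (K * (3 * s) ^ (-a)) ^ 2 * ((s / 2) ^ m * κ) =
          c₀ * (s ^ (-(2 * a)) * s ^ m) := by
        rw [Real.mul_rpow (by norm_num) hs'.le, hc₀, div_pow, one_div, inv_pow,
          show -(2 * a) = -a + -a by ring, Real.rpow_add hs']
        ring
      have t2 : s⁻¹ * s ^ (-a) = s ^ (-(2 * a)) * s ^ (a - 1) := by
        rw [← Real.rpow_neg_one, ← Real.rpow_add hs', ← Real.rpow_add hs']
        congr 1; ring
      have t3 : (δ * s ^ (-(2 * a))) ^ (1 - p) = δ ^ (1 - p) * (s ^ (-(2 * a)) * s ^ m) := by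
        rw [Real.mul_rpow hδ.le (Real.rpow_nonneg hs'.le _), ← Real.rpow_mul hs'.le,
          ← Real.rpow_natCast s m, ← Real.rpow_add hs', ← hap]
        congr 2; ring
      have hpos : 0 < s ^ (-(2 * a)) * s ^ m := by positivity
      refine le_of_mul_le_mul_right ?_ hpos
      rw [← t1]
      refine h.trans (le_of_eq ?_)
      rw [t3, show (m : ℝ) * (s⁻¹ * M) * (B * (K * s ^ (-a))) = m * M * B * K * (s⁻¹ * s ^ (-a)) by
        ring, t2]
      ring
    have h1 : Tendsto (fun s : ℝ => s ^ (a - 1)) (𝓝[>] 0) (𝓝 0) := by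
      have h2 := (Real.continuousAt_rpow_const 0 (a - 1) (Or.inr (by linarith))).tendsto
      rw [Real.zero_rpow (by linarith)] at h2
      exact h2.mono_left nhdsWithin_le_nhds
    have h2 := ((h1.const_mul (m * M * B * K * κ)).add_const (m * B * δ * κ)).add
      (hE0.const_mul (m * B * δ ^ (1 - p)))
    simp only [mul_zero, zero_add, add_zero] at h2
    exact ge_of_tendsto h2 hle
  -- This `δ` makes the right side at most c₀/2; the summand 1 allows B = 0.
  have h1 := hlim (c₀ / (2 * (m * B * κ + 1))) (by positivity)
  have h2 : (m : ℝ) * B * (c₀ / (2 * (m * B * κ + 1))) * κ ≤ c₀ / 2 := by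
    rw [show (m : ℝ) * B * (c₀ / (2 * (m * B * κ + 1))) * κ =
      c₀ * (m * B * κ) / (2 * (m * B * κ + 1)) by ring,
      div_le_div_iff₀ (by positivity) (by norm_num)]
    nlinarith
  linarith

end Nonintegrability

/-! ### The radial map is not in the embedded Sobolev space. -/

section RadialNotMem

variable {m n ν : ℕ} {N : Type*} [TopologicalSpace N] [ChartedSpace (Euc n) N]
  [IsManifold (𝓡 n) 2 N] [RiemannianBundle (fun y : N => TangentSpace (𝓡 n) y)]
  [IsContMDiffRiemannianBundle (𝓡 n) 1 (Euc n) (fun y : N => TangentSpace (𝓡 n) y)]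
  {γ : ℝ → N} {β l : ℝ} {ι : N → Euc ν}

lemma IsIsometricEmbedding.sum_norm_fderiv_comp_radialCurve (hι : IsIsometricEmbedding n ι)
    (hγ : ContMDiff 𝓘(ℝ, ℝ) (𝓡 n) 2 γ) (hl : ∀ t, ‖velocity n γ t‖ = l) {x : Euc m} (hx : x ≠ 0) :
    ∑ i, ‖fderiv ℝ (ι ∘ radialCurve γ β) x (EuclideanSpace.single i 1)‖ ^ 2 =
      (|β| * l * ‖x‖ ^ (β - 1)) ^ 2 := by
  rw [← hsNorm_radialDeriv hl hx, hsNorm, Real.sq_sqrt (by positivity)]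
  refine Finset.sum_congr rfl fun i _ => ?_
  rw [← hι.norm_differential]
  congr 2
  rw [radialDeriv_eq_mfderiv hγ hx, ← mfderiv_eq_fderiv]
  exact congrArg (fun A : Euc m →L[ℝ] Euc ν => A (EuclideanSpace.single i 1))
    (mfderiv_comp x (hι.contMDiff.mdifferentiable (by norm_num) _)
      ((contMDiffAt_radialCurve hγ hx).mdifferentiableAt (by norm_num)))

lemma continuous_hsNorm₂ :
    Continuous fun B : Euc m →L[ℝ] Euc m →L[ℝ] Euc ν => hsNorm₂ (fun e e' => B e e') := by
  unfold hsNorm₂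
  fun_prop

/-- Off the origin ι ∘ u is C², so by uniqueness the weak derivatives are the classical ones almost
everywhere. It is bounded because ι does not increase distances, and |D(ι ∘ u)| = |Tu|, so the
nonintegrability result applies with a = 1 - β. -/
lemma IsIsometricEmbedding.radialCurve_notMem_sobolevEmb2 (hι : IsIsometricEmbedding n ι)
    (hm : 1 ≤ m) {p r : ℝ} (hr : 0 < r) (hp : 1 ≤ p) (hγ : ContMDiff 𝓘(ℝ, ℝ) (𝓡 n) 2 γ)
    (hl : ∀ t, ‖velocity n γ t‖ = l) (hl0 : 0 < l) (hβ : β < 0) (hβp : 2 * (1 - β) * p = m)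
    {C : ℝ≥0} (hC : ∀ s t, riemannianEDist (𝓡 n) (γ s) (γ t) ≤ C) :
    radialCurve γ β ∉ SobolevEmb2 ι (Metric.ball (0 : Euc m) r) p := by
  rintro ⟨-, G, H, hG, hH, hE⟩
  obtain ⟨B, -, hB⟩ := hι.exists_norm_le hC
  set v : Euc m → Euc ν := ι ∘ radialCurve γ β with hvdef
  set O : Set (Euc m) := Metric.ball 0 r \ {0} with hOdef
  have hO : IsOpen O := Metric.isOpen_ball.sdiff isClosed_singleton
  have hv : ContDiffOn ℝ 2 v O := fun x hx =>
    (ContMDiffAt.comp x (g := ι) (hι.contMDiff _)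
      (contMDiffAt_radialCurve hγ hx.2)).contDiffAt.contDiffWithinAt
  have hv1 : ContDiffOn ℝ 1 (fderiv ℝ v) O := hv.fderiv_of_isOpen hO (by norm_num)
  have hG' := (hG.mono sdiff_subset).ae_eq hO ((hv.of_le (by norm_num)).hasWeakDerivOn hO)
  have hH' := ((hH.mono sdiff_subset).congr_ae hO.measurableSet hG' (EventuallyEq.refl _ _)).ae_eq hO
    (hv1.hasWeakDerivOn hO)
  refine not_integrableOn_hsNorm₂_fderiv_fderiv hm hr hp (mul_pos (abs_pos.2 hβ.ne) hl0)
    (by linarith : 1 < 1 - β) hβp hv (fun x => hB _) (fun x hx => ?_) ?_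
  · rw [hι.sum_norm_fderiv_comp_radialCurve hγ hl hx, neg_sub]
  · have hr0 : volume.restrict (Metric.ball (0 : Euc m) r) = volume.restrict O :=
      (restrict_diff_zero hm _).symm
    rw [IntegrableOn, hr0]
    have hcont : ContinuousOn
        (fun x => hsNorm₂ (fun e e' => fderiv ℝ (fderiv ℝ v) x e e') ^ p) O :=
      (continuous_hsNorm₂.comp_continuousOn (hv1.continuousOn_fderiv_of_isOpen hO le_rfl)).rpow_const
        fun _ _ => Or.inr (by linarith)
    refine (lintegral_ofReal_ne_top_iff_integrable (hcont.aestronglyMeasurable hO.measurableSet)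
      (Eventually.of_forall fun x => Real.rpow_nonneg (Real.sqrt_nonneg _) _)).1 ?_
    rw [hr0] at hE
    refine ne_of_eq_of_ne (lintegral_congr_ae ?_) hE.ne
    filter_upwards [hH'] with x hx
    rw [← hx]
    exact (ENNReal.ofReal_rpow_of_nonneg (Real.sqrt_nonneg _) (by linarith)).symm

end RadialNotMem

/-! ### The proposition. -/

theorem proposition4p7 {m n : ℕ} {N : Type*} [TopologicalSpace N] [T2Space N]
    [SecondCountableTopology N] [ChartedSpace (Euc n) N] [IsManifold (𝓡 n) 2 N]
    [RiemannianBundle (fun y : N => TangentSpace (𝓡 n) y)]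
    [IsContMDiffRiemannianBundle (𝓡 n) 1 (Euc n) (fun y : N => TangentSpace (𝓡 n) y)]
    (p r : ℝ) (hp : 1 ≤ p) (hpm : 2 * p < m) (hr : 0 < r)
    (γ : ℝ → N) (hγ : IsGeodesic n γ) (hγ_nontrivial : ∃ s t, γ s ≠ γ t)
    (hγ_bounded : ∃ C : ℝ≥0, ∀ s t, riemannianEDist (𝓡 n) (γ s) (γ t) ≤ C) :
    (∃ α : ℝ, 0 < α ∧ ∃ u : Euc m → N, (∀ x, u x = γ (‖x‖ ^ (-α))) ∧
      u ∈ Sobolev2 n N (Metric.ball 0 r) p ∩ LInfty n N (Metric.ball 0 r) ∧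
      ∃ U : ∀ x, Euc m →L[ℝ] TangentSpace (𝓡 n) (u x),
        HasColocalWeakDerivOn (Metric.ball 0 r) u U ∧
        firstEnergy (Metric.ball 0 r) u U (2 * p) = ⊤) ∧
    (∀ (ν : ℕ) (ι : N → Euc ν), IsIsometricEmbedding n ι →
      SobolevEmb2 ι (Metric.ball (0 : Euc m) r) p ⊂ Sobolev2 n N (Metric.ball 0 r) p) ∧
    ¬ ∃ C : ℝ≥0, ∀ (u : Euc m → N) (U : ∀ x, Euc m →L[ℝ] TangentSpace (𝓡 n) (u x))
      (D : ∀ x, Euc m →L[ℝ] Euc m →L[ℝ] TangentSpace (𝓡 n) (u x)),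
      IsSobolev2With (Metric.ball 0 r) p u U D → u ∈ LInfty n N (Metric.ball 0 r) →
      firstEnergy (Metric.ball 0 r) u U (2 * p) ≤
        C * essOsc n (Metric.ball 0 r) u ^ p * secondEnergy (Metric.ball 0 r) u D p := by
  obtain ⟨l, hl0, hl⟩ := hγ.exists_speed hγ_nontrivial
  obtain ⟨C, hC⟩ := hγ_bounded
  have hm : 2 ≤ m := by
    have : (2 : ℝ) < m := by linarith
    exact_mod_cast this.le
  have hp0 : 0 < p := by linarith
  -- The critical exponent: (1 + α)·2p = m, so |Tu|^(2p) is a multiple of |x|^(-m).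
  set α : ℝ := m / (2 * p) - 1 with hα
  have hα0 : 0 < α := sub_pos.2 ((one_lt_div (by positivity)).2 hpm)
  have hβp : 2 * (1 - -α) * p = m := by rw [hα]; field_simp; ring
  have hβ : -α < 0 := neg_lt_zero.2 hα0
  set u : Euc m → N := radialCurve γ (-α) with hu
  have hU : HasColocalWeakDerivOn (Metric.ball 0 r) u (radialDeriv n γ (-α)) :=
    -- Here 1 + α = m/(2p) < m because p ≥ 1.
    hasColocalWeakDerivOn_radialCurve hm Metric.isOpen_ball hγ.1 hl (by nlinarith)
  have hS : IsSobolev2With (Metric.ball 0 r) p u (radialDeriv n γ (-α)) (radialHess n γ (-α)) :=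
    ⟨hU, hγ.hasColocalWeakCovDerivOn_radialCurve hm Metric.isOpen_ball hl hl0 hβ,
      -- Here (2 + α)p = p + m/2 < m because 2p < m.
      secondEnergy_radialHess_lt_top (by omega) hl hp0.le (by nlinarith)⟩
  have hosc : essOsc n (Metric.ball 0 r) u < ⊤ := essOsc_radialCurve_lt_top hC
  have hL : u ∈ LInfty n N (Metric.ball 0 r) := ⟨hU.differentiable.measurable, hosc⟩
  have hfirst : firstEnergy (Metric.ball 0 r) u (radialDeriv n γ (-α)) (2 * p) = ⊤ :=
    firstEnergy_radialDeriv (by omega) hl hl0 hr (by positivity) hβ.ne (by linarith)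
  refine ⟨⟨α, hα0, u, fun _ => rfl, ⟨⟨_, _, hS⟩, hL⟩, _, hU, hfirst⟩, fun ν ι hι => ?_, ?_⟩
  · refine (ssubset_iff_of_subset (hι.sobolevEmb2_subset Metric.isOpen_ball hp0.le)).2
      ⟨u, ⟨_, _, hS⟩, ?_⟩
    exact hι.radialCurve_notMem_sobolevEmb2 (by omega) hr hp hγ.1 hl hl0 hβ hβp hC
  · rintro ⟨K, hK⟩
    have h := hK u _ _ hS hL
    rw [hfirst, top_le_iff] at h
    exact ENNReal.mul_ne_top (ENNReal.mul_ne_top ENNReal.coe_ne_top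
      (ENNReal.rpow_ne_top_of_nonneg hp0.le hosc.ne)) hS.energy_lt_top.ne h
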